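/- Let $k\ge 2$. Maps are finite connected maps on the oriented sphere, considered up to orientation-preserving isomorphism; their faces are named $f_0,\dots,f_k$, and isomorphisms preserve these names. An oriented edge $e$ has origin $e_-$, endpoint $e_+$ and reversal $\bar e$, and is incident to the face on its left. $\vec E$ denotes a set of oriented edges, and $V(f_0\cap f_i)$ the set of vertices incident to both $f_0$ and $f_i$. $\mathbf{LM}^{(k+1)}$ is the set of pairs $(\mathbf m,\mathbf l)$, where $\mathbf m$ is a rooted map (that is, with a distinguished oriented edge) with faces $f_0,\dots,f_k$ and $\mathbf l:V(\mathbf m)\to\mathbb Z$ satisfies $|\mathbf l(u)-\mathbf l(v)|\le 1$ for adjacent $u,v$, such that for every $1\le i\le k$ the set $V(f_0\cap f_i)$ is not empty and $\min_{V(f_0\cap f_i)}\mathbf l=0$. A *scheme* $\mathfrak s$ is an unrooted map with faces $f_0,\dots,f_k$ and a set $V_N$ of distinguished null-vertices, such that $V(f_0\cap f_i)\neq\emptyset$ for $1\le i\le k$; all degrees are at least $2$; all vertices of degree $2$ are null-vertices; $V_N\subset\bigcup_{i\ge 1}V(f_0\cap f_i)$; every $f_i$, $1\le i\le k$, is incident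 to a null-vertex; and no vertex of degree $2$ is adjacent to another null-vertex. Let $V_I=\bigcup_{i\ge1}V(f_0\cap f_i)\setminus V_N$. Among the edges incident to both $f_0$ and some $f_i$, $i\geq 1$, let $E_N$ be those with at least one extremity in $V_N$, and $E_I$ the others. An edge is *thin* if one of its orientations points to a null-vertex of degree $2$ and has $f_0$ on its left, or if it is in $E_N$ and is incident to a null-vertex of degree at least $3$. An *admissible family of discrete snakes* $(W_e,e\in\vec E(\mathfrak s))$ on $\mathfrak s$ is one that encodes the following data: * labels $\ell_v\in\mathbb Z$, $v\in V(\mathfrak s)$, with $\ell_v=0$ on $V_N$ and $\ell_v>0$ on $V_I$; * lengths $r_e=r_{\bar e}\ge 1$, $e\in\vec E(\mathfrak s)$; * walks $M_e=(M_e(0),\dots,M_e(r_e))$ in $\mathbb Z$ with steps in $\{-1,0,1\}$, with $M_e(i)=M_{\bar e}(r_e-i)$ and $M_e(0)=\ell_{e_-}$; if $e\in E_N\cup E_I$ then $M_e\ge 0$; if moreover $e$ is not thin, then $M_e>0$, except that $M_e(r_e)=0$ when $e\in E_N$ is oriented towards its null-vertex; * for every $e\in\vec E(\mathfrak s)$,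 a plane forest $F_e$ with $r_e$ plane trees, whose roots, followed by an extra vertex, are its floor vertices, successive floor vertices being linked by oriented floor edges; the vertices of $F_e$ have integer labels, the floor vertices have labels $M_e(0),\dots,M_e(r_e)$, and labels differ by at most $1$ between adjacent vertices. The *snake* $W_e$ of the labeled forest $F_e$ is the sequence of paths $W_e(0),W_e(1),\dots$ such that $W_e(t)$ lists the labels along the path from the extra floor vertex, back along the floor to the root of the tree visited at time $t$, and then up in this tree to the vertex visited at time $t$, when $F_e$ is explored in contour order, up to the extra vertex (visited last). Let $\vec E(F_e)$ consist of both orientations of the tree edges of $F_e$ and of the $r_e$ oriented floor edges. The *reconstruction* replaces every edge $e$ of $\mathfrak s$ with a chain of $r_e$ edges labeled by $M_e$, grafts $F_e$ on the left of $e$, its floor edges being identified with the edges of the chain oriented as $e$, for every $e\in\vec E(\mathfrak s)$, and takes a distinguished oriented edge of one of the forests as the root. **Proposition.** Every automorphism of the map $\mathfrak s$ of a scheme that preserves the names of the faces is the identity. An admissible family of discrete snakes on a scheme determines the labels, the lengths, the walks and the labeled forests that it encodes. The reconstruction maps every triple made of a scheme $\mathfrak s$, an admissible family of discrete snakes $(W_e,e\in\vec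 E(\mathfrak s))$ on $\mathfrak s$, and a distinguished oriented edge in $\bigcup_{e\in\vec E(\mathfrak s)}\vec E(F_e)$ (disjoint union) to an element of $\mathbf{LM}^{(k+1)}$, and it is a bijection from the set of these triples onto $\mathbf{LM}^{(k+1)}$, where for every scheme (an isomorphism class) a representative has been fixed on which the families of snakes are indexed. -/

import Mathlib

/-! ### Maps

A map on an oriented surface is given by its set of oriented edges (darts), the reversal of darts,
and the facial permutation: every dart `d` has its incident face on its left, and `next d` is the
dart that follows `d` in the (counterclockwise) contour of this face. -/

/-- The raw data of a finite map whose faces carry names `f₀, …, f_k`: `face d` is the name of the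
face on the left of `d`. The axioms of a planar map are in `NamedMap.IsPlanarMap`. -/
structure NamedMap (k : ℕ) where
  D : Type
  finite : Finite D
  rev : Equiv.Perm D
  next : Equiv.Perm D
  face : D → Fin (k + 1)

namespace NamedMap

variable {k : ℕ} (m : NamedMap k)

/-- Counterclockwise rotation of darts around their origin: `next d` is the dart that precedes
`rev d` around the endpoint of `d`, that is `rot (next d) = rev d`. -/
def rot : Equiv.Perm m.D := m.rev * m.next⁻¹

/-- Vertices are the cycles of `rot`. -/
def Vertex : Type := Quotient (Equiv.Perm.SameCycle.setoid m.rot)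

/-- Edges are the cycles of `rev`. -/
def Edge : Type := Quotient (Equiv.Perm.SameCycle.setoid m.rev)

/-- The origin `d₋`. -/
def tail (d : m.D) : m.Vertex := Quotient.mk _ d

/-- The endpoint `d₊`. -/
def head (d : m.D) : m.Vertex := m.tail (m.rev d)

noncomputable def degree (v : m.Vertex) : ℕ := Nat.card {d : m.D // m.tail d = v}

/-- The vertex `v` is incident to the face named `i`. -/
def Incident (v : m.Vertex) (i : Fin (k + 1)) : Prop := ∃ d, m.tail d = v ∧ m.face d = i

/-- `v` is incident to `f₀` and to some other face. -/
def IsInterfaceVertex (v : m.Vertex) : Prop :=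
  m.Incident v 0 ∧ ∃ i, i ≠ 0 ∧ m.Incident v i

/-- The edge of `d` is incident to `f₀` and to some other face. -/
def IsInterfaceEdge (d : m.D) : Prop :=
  (m.face d = 0 ∧ m.face (m.rev d) ≠ 0) ∨ (m.face d ≠ 0 ∧ m.face (m.rev d) = 0)

/-- `m` is a connected planar map (genus `0`, by Euler's formula) with exactly `k + 1` faces, which
are in bijection with their names `f₀, …, f_k`. -/
structure IsPlanarMap : Prop where
  rev_rev : ∀ d, m.rev (m.rev d) = d
  rev_ne : ∀ d, m.rev d ≠ d
  connected : ∀ d d', Relation.ReflTransGen (fun a b => b = m.rev a ∨ b = m.next a) d d'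
  face_eq_iff : ∀ d d', m.face d = m.face d' ↔ m.next.SameCycle d d'
  face_surjective : Function.Surjective m.face
  euler : Nat.card m.Vertex + (k + 1) = Nat.card m.Edge + 2

variable {m}

/-- Map isomorphisms (orientation preserving) that preserve the names of the faces. -/
structure IsIso {m m' : NamedMap k} (f : m.D ≃ m'.D) : Prop where
  rev : ∀ d, f (m.rev d) = m'.rev (f d)
  next : ∀ d, f (m.next d) = m'.next (f d)
  face : ∀ d, m'.face (f d) = m.face d

theorem IsIso.refl (m : NamedMap k) : IsIso (Equiv.refl m.D) :=
  ⟨fun _ => rfl, fun _ => rfl, fun _ => rfl⟩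

theorem IsIso.symm {m m' : NamedMap k} {f : m.D ≃ m'.D} (h : IsIso f) : IsIso f.symm where
  rev d := by rw [Equiv.symm_apply_eq, h.rev, Equiv.apply_symm_apply]
  next d := by rw [Equiv.symm_apply_eq, h.next, Equiv.apply_symm_apply]
  face d := by rw [← h.face, Equiv.apply_symm_apply]

theorem IsIso.trans {m m' m'' : NamedMap k} {f : m.D ≃ m'.D} {g : m'.D ≃ m''.D}
    (hf : IsIso f) (hg : IsIso g) : IsIso (f.trans g) where
  rev d := by simp [hf.rev, hg.rev]
  next d := by simp [hf.next, hg.next]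
  face d := by simp [hf.face, hg.face]

end NamedMap

/-! ### Labeled maps and the set `LM` -/

/-- The raw data of a rooted labeled map with named faces; `label d` is the label of the origin
of `d`. -/
structure LabeledMap (k : ℕ) extends NamedMap k where
  label : D → ℤ
  root : D

namespace LabeledMap

variable {k : ℕ}

/-- `(m, l)` is a rooted planar labeled map with faces `f₀, …, f_k` such that, for `1 ≤ i ≤ k`, the
faces `f₀` and `f_i` have a common incident vertex and the minimum of the labels over their common
incident vertices is `0`. -/
structure IsLM (m : LabeledMap k) : Prop where
  isPlanarMap : m.toNamedMap.IsPlanarMap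
  /-- `label` is a function on vertices -/
  label_eq : ∀ d d', m.tail d = m.tail d' → m.label d = m.label d'
  label_adj : ∀ d, |m.label (m.rev d) - m.label d| ≤ 1
  label_nonneg : ∀ i, i ≠ 0 → ∀ d, m.Incident (m.tail d) 0 → m.Incident (m.tail d) i →
    0 ≤ m.label d
  exists_label_zero : ∀ i, i ≠ 0 →
    ∃ d, m.Incident (m.tail d) 0 ∧ m.Incident (m.tail d) i ∧ m.label d = 0

/-- Isomorphism of rooted labeled maps with named faces. -/
def Iso (m m' : LabeledMap k) : Prop :=
  ∃ f : m.D ≃ m'.D, NamedMap.IsIso f ∧ (∀ d, m'.label (f d) = m.label d) ∧ f m.root = m'.root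

instance isoSetoid (k : ℕ) : Setoid (LabeledMap k) where
  r := Iso
  iseqv :=
    { refl := fun m => ⟨Equiv.refl _, .refl _, fun _ => rfl, rfl⟩
      symm := by
        rintro m m' ⟨f, hf, hl, hr⟩
        exact ⟨f.symm, hf.symm, fun d => by rw [← hl, Equiv.apply_symm_apply],
          by rw [Equiv.symm_apply_eq, hr]⟩
      trans := by
        rintro m m' m'' ⟨f, hf, hl, hr⟩ ⟨g, hg, hl', hr'⟩
        exact ⟨f.trans g, hf.trans hg, fun d => by simp [hl, hl'], by simp [hr, hr']⟩ }

end LabeledMap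

/-- The set `LM^{(k+1)}`, whose elements are isomorphism classes. -/
def LM (k : ℕ) : Set (Quotient (LabeledMap.isoSetoid k)) :=
  {c | ∃ m : LabeledMap k, m.IsLM ∧ Quotient.mk _ m = c}

/-! ### Schemes -/

/-- A scheme with `k + 1` faces; `null` is its set of null-vertices. -/
structure Scheme (k : ℕ) extends NamedMap k where
  null : Set toNamedMap.Vertex
  isPlanarMap : toNamedMap.IsPlanarMap
  common_vertex : ∀ i, i ≠ 0 → ∃ v, toNamedMap.Incident v 0 ∧ toNamedMap.Incident v i
  two_le_degree : ∀ v, 2 ≤ toNamedMap.degree v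
  degree_two_interface : ∀ v, toNamedMap.degree v = 2 → toNamedMap.IsInterfaceVertex v
  degree_two_not_adj : ∀ d, toNamedMap.tail d ≠ toNamedMap.head d →
    toNamedMap.degree (toNamedMap.tail d) = 2 → toNamedMap.degree (toNamedMap.head d) ≠ 2
  degree_two_null : ∀ v, toNamedMap.degree v = 2 → v ∈ null
  null_interface : ∀ v ∈ null, toNamedMap.IsInterfaceVertex v
  exists_null : ∀ i, i ≠ 0 → ∃ v ∈ null, toNamedMap.Incident v i
  degree_two_not_adj_null : ∀ d, toNamedMap.tail d ≠ toNamedMap.head d →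
    toNamedMap.degree (toNamedMap.tail d) = 2 → toNamedMap.head d ∉ null

namespace Scheme

variable {k : ℕ}

/-- Isomorphism of schemes. -/
def Iso (S S' : Scheme k) : Prop :=
  ∃ f : S.D ≃ S'.D, NamedMap.IsIso f ∧ ∀ d, S'.tail (f d) ∈ S'.null ↔ S.tail d ∈ S.null

instance isoSetoid (k : ℕ) : Setoid (Scheme k) where
  r := Iso
  iseqv :=
    { refl := fun S => ⟨Equiv.refl _, .refl _, fun _ => Iff.rfl⟩
      symm := by
        rintro S S' ⟨f, hf, hn⟩
        exact ⟨f.symm, hf.symm, fun d => by rw [← hn, Equiv.apply_symm_apply]⟩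
      trans := by
        rintro S S' S'' ⟨f, hf, hn⟩ ⟨g, hg, hn'⟩
        exact ⟨f.trans g, hf.trans hg, fun d => by simp [hn, hn']⟩ }

variable (S : Scheme k)

/-- The vertices in `V_I`. -/
def VI : Set S.Vertex := {v | S.IsInterfaceVertex v ∧ v ∉ S.null}

/-- The darts whose edge is in `E_N`. -/
def EN : Set S.D := {e | S.IsInterfaceEdge e ∧ (S.tail e ∈ S.null ∨ S.head e ∈ S.null)}

/-- The darts whose edge is in `E_I`. -/
def EI : Set S.D := {e | S.IsInterfaceEdge e ∧ e ∉ S.EN}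

/-- `e` points to a null-vertex of degree `2` and has `f₀` on its left. -/
def PointsThin (e : S.D) : Prop :=
  S.head e ∈ S.null ∧ S.degree (S.head e) = 2 ∧ S.face e = 0

/-- The darts whose edge is thin: the edges with an orientation that points to a null-vertex of
degree `2` with `f₀` on its left, and the edges of `E_N` incident to a null-vertex of degree at
least `3`. -/
def Thin : Set S.D :=
  {e | S.PointsThin e ∨ S.PointsThin (S.rev e) ∨
    (e ∈ S.EN ∧ ((S.tail e ∈ S.null ∧ 3 ≤ S.degree (S.tail e)) ∨
      (S.head e ∈ S.null ∧ 3 ≤ S.degree (S.head e))))}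

end Scheme

/-- The set `𝐒^{(k+1)}` of schemes with `k + 1` faces, up to isomorphism. -/
abbrev SchemeClass (k : ℕ) := Quotient (Scheme.isoSetoid k)

/-! ### Labeled plane forests and discrete snakes -/

/-- Finite ordered sequences of rooted plane trees with labeled vertices: `cons a f g` starts with
the tree whose root has label `a` and whose subtrees above the root form the sequence `f`, and
continues with the sequence `g`. -/
inductive Grove : Type
  | nil : Grove
  | cons (a : ℤ) (f g : Grove) : Grove

namespace Grove

/-- A sequence of trees is seen as hanging on a common parent vertex (not part of it), to which
every root is linked by an edge. `Dart` is the type of the oriented edges. -/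
inductive Dart : Grove → Type
  /-- from the common parent to the root of the first tree -/
  | up (a : ℤ) (f g : Grove) : Dart (cons a f g)
  /-- an edge of the first tree -/
  | above (a : ℤ) {f : Grove} (g : Grove) (d : Dart f) : Dart (cons a f g)
  /-- from the root of the first tree to the common parent -/
  | down (a : ℤ) (f g : Grove) : Dart (cons a f g)
  /-- an edge of the remaining trees, or from the common parent to one of their roots, or back -/
  | later (a : ℤ) (f : Grove) {g : Grove} (d : Dart g) : Dart (cons a f g)

/-- In facial order, the edges of `cons a f g` are: the edge up to the first root, the edges above
this root, the edge down from this root, the edges of the remaining trees. -/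
def dartEquiv (a : ℤ) (f g : Grove) :
    Dart (cons a f g) ≃ (Fin 1 ⊕ f.Dart) ⊕ (Fin 1 ⊕ g.Dart) where
  toFun
    | .up _ _ _ => .inl (.inl 0)
    | .above _ _ d => .inl (.inr d)
    | .down _ _ _ => .inr (.inl 0)
    | .later _ _ d => .inr (.inr d)
  invFun
    | .inl (.inl _) => .up a f g
    | .inl (.inr d) => .above a g d
    | .inr (.inl _) => .down a f g
    | .inr (.inr d) => .later a f d
  left_inv := by rintro (_ | _ | _ | _) <;> rfl
  right_inv := by
    rintro ((i | _) | (i | _))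
    · rw [Subsingleton.elim i 0]; rfl
    · rfl
    · rw [Subsingleton.elim i 0]; rfl
    · rfl

/-- The number of oriented edges. -/
def len : Grove → ℕ
  | nil => 0
  | cons _ f g => (1 + f.len) + (1 + g.len)

instance : IsEmpty (Dart nil) := ⟨fun d => nomatch d⟩

/-- The enumeration of the oriented edges in facial order. -/
def contour : (t : Grove) → t.Dart ≃ Fin t.len
  | nil => Equiv.equivOfIsEmpty (Dart nil) (Fin 0)
  | cons a f g => (dartEquiv a f g).trans <|
    (Equiv.sumCongr ((Equiv.sumCongr (Equiv.refl _) f.contour).trans finSumFinEquiv)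
      ((Equiv.sumCongr (Equiv.refl _) g.contour).trans finSumFinEquiv)).trans finSumFinEquiv

namespace Dart

/-- Reversal of oriented edges. -/
def rev : {t : Grove} → t.Dart → t.Dart
  | _, up a f g => down a f g
  | _, above a g d => above a g d.rev
  | _, down a f g => up a f g
  | _, later a f d => later a f d.rev

theorem rev_rev {t : Grove} (d : t.Dart) : d.rev.rev = d := by
  induction d <;> simp_all [rev]

/-- The labels of the ancestors of the origin of an oriented edge, ending with this origin; here
`p` is the list for the common parent. -/
def line : {t : Grove} → t.Dart → List ℤ → List ℤ
  | _, up _ _ _, p => p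
  | _, above a _ d, p => d.line (p ++ [a])
  | _, down a _ _, p => p ++ [a]
  | _, later _ _ d, p => d.line p

/-- The label of the origin of an oriented edge, when the common parent has label `c`. -/
def label : {t : Grove} → t.Dart → ℤ → ℤ
  | _, up _ _ _, c => c
  | _, above a _ d, _ => d.label a
  | _, down a _ _, _ => a
  | _, later _ _ d, c => d.label c

end Dart

/-- Labels differ by at most `1` along edges, when the common parent has label `c`. -/
def IsLabeling : Grove → ℤ → Prop
  | nil, _ => True
  | cons a f g, c => |a - c| ≤ 1 ∧ f.IsLabeling a ∧ g.IsLabeling c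

end Grove

/-- A plane forest with `r` trees and labeled vertices: `floor i` is the label of the `i`-th floor
vertex (the last one being the extra vertex), and `tree i` is what stands above it, that is, the
sequence of the subtrees above the root of the `i`-th tree. -/
structure LabeledForest where
  r : ℕ
  floor : Fin (r + 1) → ℤ
  tree : Fin r → Grove

namespace LabeledForest

variable (F : LabeledForest)

/-- The oriented edges of the forest: both orientations of the edges of the trees, and the `r`
floor edges, from each floor vertex to the next one. -/
inductive Dart : Type
  | tree (i : Fin F.r) (d : (F.tree i).Dart) : Dart
  | floor (i : Fin F.r) : Dart

/-- In facial order, the edges of the `i`-th tree are followed by the `i`-th floor edge. -/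
def dartEquiv : F.Dart ≃ Σ i : Fin F.r, ((F.tree i).Dart ⊕ Fin 1) where
  toFun
    | .tree i d => ⟨i, .inl d⟩
    | .floor i => ⟨i, .inr 0⟩
  invFun
    | ⟨i, .inl d⟩ => .tree i d
    | ⟨i, .inr _⟩ => .floor i
  left_inv := by rintro (_ | _) <;> rfl
  right_inv := by
    rintro ⟨i, d | j⟩
    · rfl
    · rw [Subsingleton.elim j 0]

/-- The number of oriented edges. -/
def len : ℕ := ∑ i : Fin F.r, ((F.tree i).len + 1)

/-- The enumeration of the oriented edges in facial order. -/
def contour : F.Dart ≃ Fin F.len :=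
  F.dartEquiv.trans <| (Equiv.sigmaCongrRight fun i =>
    (Equiv.sumCongr (F.tree i).contour (Equiv.refl _)).trans finSumFinEquiv).trans
    finSigmaFinEquiv

variable {F} in
/-- The label of the origin of an oriented edge. -/
def Dart.label : F.Dart → ℤ
  | .tree i d => d.label (F.floor i.castSucc)
  | .floor i => F.floor i.castSucc

/-- The labels of the floor vertices from the extra vertex back to the `i`-th one. -/
def floorLine (i : ℕ) : List ℤ := ((List.ofFn F.floor).drop i).reverse

variable {F} in
/-- The labels of the ancestors of the origin of an oriented edge, from the extra floor vertex,
back along the floor to the root of its tree, and up to this origin. -/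
def Dart.line : F.Dart → List ℤ
  | .tree i d => d.line (F.floorLine i)
  | .floor i => F.floorLine i

/-- The discrete snake of the labeled forest, given by its values at integer times: the `i`-th
entry is the path `(W(i, j), 0 ≤ j ≤ ζ(i))` of the labels of the ancestors of the vertex visited at
time `i` of the contour, `j` being the distance to the extra floor vertex, which is visited last. -/
def snake : List (List ℤ) :=
  (List.ofFn fun i : Fin F.len => (F.contour.symm i).line) ++ [F.floorLine F.r]

/-- Labels differ by at most `1` between neighbors in a tree and between successive floor
vertices. -/
def IsLabeling : Prop :=
  (∀ i : Fin F.r, |F.floor i.succ - F.floor i.castSucc| ≤ 1) ∧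
    ∀ i, (F.tree i).IsLabeling (F.floor i.castSucc)

theorem len_pos (h : 0 < F.r) : 0 < F.len :=
  Finset.sum_pos (fun _ _ => Nat.succ_pos _) ⟨⟨0, h⟩, Finset.mem_univ _⟩

instance : Finite F.Dart := Finite.of_equiv _ F.contour.symm

end LabeledForest

/-! ### Admissible families on a scheme -/

/-- An admissible labeling `ℓ`, a family of edge-lengths `r`, a compatible walk network `M` and
compatible labeled forests on the scheme `S`. The forest of the dart `e` has `r e` trees, floor
labels `M e` and trees given by `tree e`. -/
structure SnakeData {k : ℕ} (S : Scheme k) where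
  ℓ : S.Vertex → ℤ
  r : S.D → ℕ
  M : (e : S.D) → Fin (r e + 1) → ℤ
  tree : (e : S.D) → Fin (r e) → Grove
  ℓ_null : ∀ v ∈ S.null, ℓ v = 0
  ℓ_pos : ∀ v ∈ S.VI, 0 < ℓ v
  r_pos : ∀ e, 0 < r e
  r_rev : ∀ e, r (S.rev e) = r e
  M_rev : ∀ e (i : Fin (r e + 1)) (j : Fin (r (S.rev e) + 1)), (i : ℕ) + j = r e →
    M (S.rev e) j = M e i
  M_zero : ∀ e, M e 0 = ℓ (S.tail e)
  M_nonneg : ∀ e, e ∈ S.EN ∪ S.EI → ∀ i, 0 ≤ M e i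
  M_pos_EI : ∀ e ∈ S.EI, ∀ i, 0 < M e i
  /-- a non-thin edge of `E_N`, oriented towards its only null-vertex -/
  M_pos_EN : ∀ e ∈ S.EN, e ∉ S.Thin → S.head e ∈ S.null → ∀ i, i ≠ Fin.last _ → 0 < M e i
  isLabeling : ∀ e, (LabeledForest.mk (r e) (M e) (tree e)).IsLabeling

namespace SnakeData

variable {k : ℕ} {S : Scheme k} (δ : SnakeData S)

/-- The labeled forest `(F_e, L_e)`. -/
def forest (e : S.D) : LabeledForest := ⟨δ.r e, δ.M e, δ.tree e⟩

/-- The discrete snake `W_e`. -/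
def snake (e : S.D) : List (List ℤ) := (δ.forest e).snake

/-- The disjoint union of the oriented edges of the forests `F_e`. -/
def OrientedEdge : Type := Σ e : S.D, (δ.forest e).Dart

/-- Reversal of the oriented edges once the forests are grafted: the `i`-th floor edge of `F_e` is
glued to the floor edge of the forest of the reversed dart with the same extremities. -/
def glueRevFun : δ.OrientedEdge → δ.OrientedEdge
  | ⟨e, .tree i d⟩ => ⟨e, .tree i d.rev⟩
  | ⟨e, .floor i⟩ => ⟨S.rev e, .floor (Fin.cast (δ.r_rev e).symm (Fin.rev i))⟩

theorem floor_ext {e e' : S.D} {i : Fin (δ.r e)} {i' : Fin (δ.r e')} (he : e = e')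
    (hi : (i : ℕ) = i') : (⟨e, .floor i⟩ : δ.OrientedEdge) = ⟨e', .floor i'⟩ := by
  subst he
  obtain rfl : i = i' := Fin.ext hi
  rfl

theorem glueRevFun_glueRevFun (x : δ.OrientedEdge) : δ.glueRevFun (δ.glueRevFun x) = x := by
  obtain ⟨e, ⟨i, d⟩ | i⟩ := x
  · exact congrArg (fun d => (⟨e, .tree i d⟩ : δ.OrientedEdge)) d.rev_rev
  · refine δ.floor_ext (S.isPlanarMap.rev_rev e) ?_
    have h1 : (i : ℕ) < δ.r e := i.2
    have h2 := δ.r_rev e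
    change δ.r (S.rev e) - (δ.r e - (i + 1) + 1) = i
    omega

def glueRev : Equiv.Perm δ.OrientedEdge :=
  ⟨δ.glueRevFun, δ.glueRevFun, δ.glueRevFun_glueRevFun, δ.glueRevFun_glueRevFun⟩

end SnakeData

/-- Concatenation of contours: the successor of the `i`-th element of the block `e` is the next
element of the same block if there is one, and otherwise the first element of the block `φ e`. -/
def concatNext {D : Type} (φ : Equiv.Perm D) (n : D → ℕ) (hn : ∀ e, 0 < n e) :
    Equiv.Perm (Σ e : D, Fin (n e)) where
  toFun x := if h : (x.2 : ℕ) + 1 < n x.1 then ⟨x.1, ⟨x.2 + 1, h⟩⟩ else ⟨φ x.1, ⟨0, hn _⟩⟩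
  invFun x := if (x.2 : ℕ) = 0 then ⟨φ.symm x.1, ⟨n (φ.symm x.1) - 1, Nat.sub_lt (hn _) one_pos⟩⟩
    else ⟨x.1, ⟨x.2 - 1, lt_of_le_of_lt (Nat.sub_le _ _) x.2.2⟩⟩
  left_inv := by
    rintro ⟨e, i⟩
    have hi := i.2
    beta_reduce
    by_cases h : (i : ℕ) + 1 < n e
    · rw [dif_pos h]
      rfl
    · rw [dif_neg h, if_pos rfl]
      refine Sigma.ext (φ.symm_apply_apply e) ?_
      rw [Fin.heq_ext_iff (by simp)]
      simp only [Equiv.symm_apply_apply]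
      omega
  right_inv := by
    rintro ⟨e, i⟩
    have hi := i.2
    beta_reduce
    by_cases h : (i : ℕ) = 0
    · rw [if_pos h, dif_neg (by simp only; omega)]
      refine Sigma.ext (φ.apply_symm_apply e) ?_
      rw [Fin.heq_ext_iff (by simp)]
      exact h.symm
    · rw [if_neg h, dif_pos (by simp only; omega)]
      refine Sigma.ext rfl (heq_of_eq (Fin.ext ?_))
      simp only
      omega

namespace SnakeData

variable {k : ℕ} {S : Scheme k} (δ : SnakeData S)

/-- The facial permutation once the forests are grafted: since `F_e` is grafted on the left of `e`,
the contour of a face is the concatenation of the contours of the forests `F_e`, for `e` along the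
contour of the face of `S` with the same name. -/
def glueNext : Equiv.Perm δ.OrientedEdge :=
  (Equiv.sigmaCongrRight fun e => (δ.forest e).contour).trans <|
    (concatNext S.next (fun e => (δ.forest e).len)
      (fun e => (δ.forest e).len_pos (δ.r_pos e))).trans
    (Equiv.sigmaCongrRight fun e => (δ.forest e).contour).symm

/-- The reconstruction: every edge `e` of `S` is replaced with a chain of `r e` edges, the forests
`F_e` are grafted on the left of `e`, and the map is rooted at `x`. -/
def glue (x : δ.OrientedEdge) : LabeledMap k where
  D := δ.OrientedEdge
  finite := by
    have := S.finite
    exact inferInstanceAs (Finite (Σ e : S.D, (δ.forest e).Dart))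
  rev := δ.glueRev
  next := δ.glueNext
  face y := S.face y.1
  label y := y.2.label
  root := x

end SnakeData

/-- The admissible families of discrete snakes `(W_e)` on the scheme `S`. -/
def AdmissibleFamily {k : ℕ} (S : Scheme k) : Type :=
  {W : S.D → List (List ℤ) // ∃ δ : SnakeData S, δ.snake = W}

/-- The labeling, edge-lengths, walks and forests that are encoded by an admissible family of
discrete snakes. -/
noncomputable def AdmissibleFamily.data {k : ℕ} {S : Scheme k} (W : AdmissibleFamily S) :
    SnakeData S := Classical.choose W.2

/-- For a choice `rep` of a representative of every scheme: triples of a scheme, an admissible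
family of discrete snakes on it, and a distinguished oriented edge in one of the forests. -/
def SchemeTriple {k : ℕ} (rep : SchemeClass k → Scheme k) : Type 1 :=
  Σ s : SchemeClass k, Σ W : AdmissibleFamily (rep s), W.data.OrientedEdge

/-- The (isomorphism class of the) labeled map reconstructed from a triple. -/
noncomputable def reconstruct {k : ℕ} (rep : SchemeClass k → Scheme k) (t : SchemeTriple rep) :
    Quotient (LabeledMap.isoSetoid k) :=
  Quotient.mk _ (t.2.1.data.glue t.2.2)

/-! Rigidity. An automorphism that fixes a dart is the identity, so the group generated by an
automorphism of order `n` acts freely on the darts. The quotient is a transitive system of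
permutations, and such a system has nonnegative genus (`Equiv.Perm.card_cycles_add_le`). Face names
are preserved, so at least `k + 1` faces survive in the quotient. Comparison with Euler's formula
gives `(n - 1) (k + 1) ≤ 2 (n - 1)`, hence `n = 1` because `k ≥ 2`.

Snakes. The path at time `0` lists the labels of the floor. Afterwards the lengths of the paths are
the heights along the contour, and they show where each subtree starts and ends
(`Grove.eq_of_line`).

From a map to a scheme. Pruning all attached plane trees leaves the core, a map without vertices of
degree `1`; each core dart remembers the trees pruned on its left at its origin (`core.tree`). With
at least three faces the core has branching points, joined by chains of vertices of degree `2`. The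
vertices of the scheme are these branching points and some chosen vertices: on a chain between `f₀`
and another face whose ends have nonzero labels but which contains a zero, the last zero when the
chain is followed with `f₀` on the left. The null-vertices are the scheme vertices incident to `f₀`
and another face that have label `0`. The core is a subdivision of this scheme
(`markedMap.isSubdivision`, `IsReduced.exists_scheme`), and the positivity of walks on non-thin
edges expresses that the chosen zero is the last one.

Bijectivity. `IsDecomp` states that the core of a map is a subdivision of a scheme with the
prescribed labels and trees. Reconstructed maps have this property (`IsGlued.isDecomp`), and maps
with this property are reconstructed (`IsDecomp.exists_isGlued`). Admissibility implies that the
marked darts of the core are exactly the darts of the scheme (`IsDecomp.marked_iff`), so the map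
determines the scheme up to isomorphism. By rigidity this isomorphism is the identity on a fixed
representative, and lengths, walks, trees and root are then read off. Euler's formula passes between
scheme and map because tree edges and subdivisions add as many vertices as edges. -/

/-! ### Cycles of permutations -/

namespace Equiv.Perm

variable {α : Type*}

/-- The set of cycles of a permutation (fixed points included). -/
abbrev Cycles (σ : Perm α) : Type _ := Quotient (SameCycle.setoid σ)

theorem mem_of_sameCycle [Finite α] {σ : Perm α} {A : α → Prop} (hA : ∀ x, A x → A (σ x))
    {x y : α} (h : σ.SameCycle x y) (hx : A x) : A y := by
  obtain ⟨n, rfl⟩ := h.exists_nat_pow_eq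
  clear h
  induction n with
  | zero => exact hx
  | succ n ih => rw [pow_succ', mul_apply]; exact hA _ ih

theorem sameCycle_iterate (σ : Perm α) (n : ℕ) (x : α) : σ.SameCycle x (σ^[n] x) :=
  ⟨n, by rw [zpow_natCast, iterate_eq_pow]⟩

theorem SameCycle.exists_iterate_eq [Finite α] {σ : Perm α} {x y : α} (h : σ.SameCycle x y) :
    ∃ n, σ^[n] x = y := by
  obtain ⟨n, h⟩ := h.exists_nat_pow_eq
  exact ⟨n, by rw [iterate_eq_pow, h]⟩

theorem exists_iterate_eq_self [Finite α] (σ : Perm α) (x : α) : ∃ n, 0 < n ∧ σ^[n] x = x :=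
  ⟨orderOf σ, orderOf_pos σ, by rw [iterate_eq_pow, pow_orderOf_eq_one, one_apply]⟩

theorem cycles_mk_apply (σ : Perm α) (x : α) :
    (Quotient.mk _ (σ x) : σ.Cycles) = Quotient.mk _ x :=
  Quotient.sound (show σ.SameCycle _ _ from sameCycle_apply_left.2 (SameCycle.refl _ _))

/-- The genus of a transitive pair of permutations is nonnegative. -/
theorem card_cycles_add_le [Finite α] (σ τ : Perm α)
    (htr : ∀ g : α → ℝ, (∀ x, g (σ x) = g x) → (∀ x, g (τ x) = g x) → ∀ x y, g x = g y) :
    Nat.card σ.Cycles + Nat.card τ.Cycles + Nat.card (σ * τ).Cycles ≤ Nat.card α + 2 := by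
  classical
  rcases isEmpty_or_nonempty α with hα | ⟨⟨x₀⟩⟩
  · have : ∀ ρ : Perm α, Nat.card ρ.Cycles = 0 := fun ρ => by
      have : IsEmpty ρ.Cycles := ⟨fun q => Quotient.inductionOn q fun a => hα.elim a⟩
      exact Nat.card_of_isEmpty
    rw [this, this, this]; omega
  have := Fintype.ofFinite α
  have : ∀ ρ : Perm α, Fintype ρ.Cycles := fun ρ => Fintype.ofFinite _
  -- The inequality compares dimensions: functions on the three sets of cycles embed into functions
  -- on `α` plus two coordinates. These two evaluations at `x₀` only serve to kill the constants,
  -- `(c, -c)` in `(g, h)` and `c` in `u`.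
  let Ψ : ((σ.Cycles → ℝ) × (τ.Cycles → ℝ) × ((σ * τ).Cycles → ℝ)) →ₗ[ℝ] (α → ℝ) × ℝ × ℝ :=
    { toFun := fun p => (fun x => p.1 (Quotient.mk _ x) + p.2.1 (Quotient.mk _ x) +
        (p.2.2 (Quotient.mk _ (σ x)) - p.2.2 (Quotient.mk _ x)),
          p.1 (Quotient.mk _ x₀), p.2.2 (Quotient.mk _ x₀))
      map_add' := by
        intro p q
        refine Prod.ext (funext fun x => ?_) (Prod.ext rfl rfl)
        simp only [Prod.fst_add, Prod.snd_add, Pi.add_apply]; ring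
      map_smul' := by
        intro c p
        refine Prod.ext (funext fun x => ?_) (Prod.ext rfl rfl)
        simp only [Prod.smul_fst, Prod.smul_snd, Pi.smul_apply, smul_eq_mul, RingHom.id_apply]
        ring }
  have hΨ : Function.Injective Ψ := by
    rw [← LinearMap.ker_eq_bot, LinearMap.ker_eq_bot']
    rintro ⟨g, h, u⟩ hp
    have h1 : ∀ x, g (Quotient.mk _ x) + h (Quotient.mk _ x) +
        (u (Quotient.mk _ (σ x)) - u (Quotient.mk _ x)) = 0 := congrFun (congrArg Prod.fst hp)
    have h2 : g (Quotient.mk _ x₀) = 0 := congrArg (fun z => z.2.1) hp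
    have h3 : u (Quotient.mk _ x₀) = 0 := congrArg (fun z => z.2.2) hp
    -- `u` is invariant under `σ * τ`, so `σ` and `τ⁻¹` move it in the same way. Hence `u ∘ σ - u`
    -- is orthogonal to the `σ`-invariant functions and to the `τ`-invariant ones.
    have hu : ∀ y, u (Quotient.mk _ (σ y)) = u (Quotient.mk _ (τ.symm y)) := fun y => by
      have := cycles_mk_apply (σ * τ) (τ.symm y)
      rw [mul_apply, apply_symm_apply] at this
      rw [this]
    have e1 : ∑ x, g (Quotient.mk _ x) * (u (Quotient.mk _ (σ x)) - u (Quotient.mk _ x)) = 0 := by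
      simp_rw [mul_sub, Finset.sum_sub_distrib]
      rw [sub_eq_zero, ← Equiv.sum_comp σ fun x => g (Quotient.mk _ x) * u (Quotient.mk _ x)]
      exact Finset.sum_congr rfl fun x _ => by rw [cycles_mk_apply]
    have e2 : ∑ x, h (Quotient.mk _ x) * (u (Quotient.mk _ (σ x)) - u (Quotient.mk _ x)) = 0 := by
      simp_rw [mul_sub, Finset.sum_sub_distrib, hu]
      rw [sub_eq_zero, ← Equiv.sum_comp τ.symm fun x => h (Quotient.mk _ x) * u (Quotient.mk _ x)]
      refine Finset.sum_congr rfl fun x _ => ?_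
      rw [← cycles_mk_apply τ (τ.symm x), apply_symm_apply]
    -- The equation says that `g + h` is the opposite of `u ∘ σ - u`, which is orthogonal to it.
    have e3 : ∑ x, (g (Quotient.mk _ x) + h (Quotient.mk _ x)) ^ 2 = 0 := by
      rw [← neg_zero, ← add_zero (0 : ℝ)]
      nth_rw 1 [← e1]
      nth_rw 1 [← e2]
      rw [← Finset.sum_add_distrib, ← Finset.sum_neg_distrib]
      refine Finset.sum_congr rfl fun x _ => ?_
      linear_combination (g (Quotient.mk _ x) + h (Quotient.mk _ x)) * h1 x
    have e4 : ∀ x, g (Quotient.mk _ x) + h (Quotient.mk _ x) = 0 := fun x => by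
      have := (Finset.sum_eq_zero_iff_of_nonneg (fun x _ => sq_nonneg _)).1 e3 x (Finset.mem_univ x)
      exact pow_eq_zero_iff two_ne_zero |>.1 this
    have e5 : ∀ x, u (Quotient.mk _ (σ x)) = u (Quotient.mk _ x) := fun x => by
      linarith [h1 x, e4 x]
    -- Now `u` is invariant under `σ`, hence also under `τ`, and transitivity makes it constant;
    -- below, the same applies to `g = -h`.
    have e6 : ∀ x, u (Quotient.mk _ x) = 0 := fun x => by
      rw [← h3]
      refine htr (fun x => u (Quotient.mk _ x)) e5 (fun x => ?_) x x₀
      rw [← e5 (τ x), hu, symm_apply_apply]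
    have e7 : ∀ x, g (Quotient.mk _ x) = 0 := fun x => by
      rw [← h2]
      refine htr (fun x => g (Quotient.mk _ x)) (fun x => by rw [cycles_mk_apply]) (fun x => ?_) x x₀
      have a1 := e4 x
      have a2 := e4 (τ x)
      rw [cycles_mk_apply τ] at a2
      linarith
    refine Prod.ext (funext fun q => ?_) (Prod.ext (funext fun q => ?_) (funext fun q => ?_)) <;>
      induction q using Quotient.inductionOn with | _ x => ?_
    · exact e7 x
    · have := e4 x
      rw [e7 x, zero_add] at this
      exact this
    · exact e6 x
  have := LinearMap.finrank_le_finrank_of_injective hΨ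
  simp only [Module.finrank_prod, Module.finrank_pi, Module.finrank_self] at this
  simp only [Nat.card_eq_fintype_card]
  omega

/-! ### First return -/

section FirstReturn

variable [Finite α] (σ : Perm α) (A : α → Prop)

theorem exists_return (x : {x // A x}) : ∃ n, 0 < n ∧ A (σ^[n] x) := by
  obtain ⟨n, hn, h⟩ := σ.exists_iterate_eq_self x.1
  exact ⟨n, hn, by rw [h]; exact x.2⟩

open Classical in
/-- The first return time to `A`. -/
noncomputable def returnTime (x : {x // A x}) : ℕ := Nat.find (σ.exists_return A x)

theorem returnTime_pos (x : {x // A x}) : 0 < σ.returnTime A x := by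
  classical exact (Nat.find_spec (σ.exists_return A x)).1

theorem iterate_returnTime (x : {x // A x}) : A (σ^[σ.returnTime A x] x) := by
  classical exact (Nat.find_spec (σ.exists_return A x)).2

theorem not_of_lt_returnTime (x : {x // A x}) {i : ℕ} (h0 : 0 < i) (h : i < σ.returnTime A x) :
    ¬ A (σ^[i] x) := by
  classical exact fun hA => Nat.find_min (σ.exists_return A x) h ⟨h0, hA⟩

theorem returnTime_eq (x : {x // A x}) {n : ℕ} (h0 : 0 < n) (hn : A (σ^[n] x))
    (hlt : ∀ i, 0 < i → i < n → ¬ A (σ^[i] x)) : σ.returnTime A x = n := by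
  rcases lt_trichotomy (σ.returnTime A x) n with h | h | h
  · exact absurd (σ.iterate_returnTime A x) (hlt _ (σ.returnTime_pos A x) h)
  · exact h
  · exact absurd hn (σ.not_of_lt_returnTime A x h0 h)

/-- The permutation induced by `σ` on `A`. -/
noncomputable def induced : Perm {x // A x} :=
  Equiv.ofBijective (fun x => ⟨σ^[σ.returnTime A x] x, σ.iterate_returnTime A x⟩) <| by
    rw [← Finite.injective_iff_bijective]
    -- If two first returns coincide, one starting point is an iterate of the other at a time
    -- smaller than its return time, and this time must be `0`.
    have key : ∀ x y : {x // A x}, σ.returnTime A x ≤ σ.returnTime A y →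
        σ^[σ.returnTime A x] x.1 = σ^[σ.returnTime A y] y.1 → x = y := by
      intro x y h hxy
      obtain ⟨j, hj⟩ := Nat.exists_eq_add_of_le h
      rw [hj, Function.iterate_add_apply] at hxy
      have h1 : x.1 = σ^[j] y.1 := (σ.injective.iterate _) hxy
      rcases Nat.eq_zero_or_pos j with rfl | h0
      · exact Subtype.ext h1
      · refine absurd x.2 ?_
        rw [h1]
        exact σ.not_of_lt_returnTime A y h0 (by have := σ.returnTime_pos A x; omega)
    intro x y hxy
    have hxy' := congrArg Subtype.val hxy
    rcases le_total (σ.returnTime A x) (σ.returnTime A y) with h | h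
    · exact key x y h hxy'
    · exact (key y x h hxy'.symm).symm

theorem induced_apply (x : {x // A x}) : (σ.induced A x : α) = σ^[σ.returnTime A x] x := rfl

theorem induced_eq (x : {x // A x}) {n : ℕ} (h0 : 0 < n) (hn : A (σ^[n] x))
    (hlt : ∀ i, 0 < i → i < n → ¬ A (σ^[i] x)) : (σ.induced A x : α) = σ^[n] x := by
  rw [induced_apply, σ.returnTime_eq A x h0 hn hlt]

/-- The visits of an orbit of `σ` to `A` are the successive first returns, which strong induction on
the number of steps peels off one by one. -/
theorem sameCycle_induced_iff (x y : {x // A x}) :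
    (σ.induced A).SameCycle x y ↔ σ.SameCycle x y := by
  constructor
  · intro h
    refine mem_of_sameCycle (A := fun z : {x // A x} => σ.SameCycle x z) (fun z hz => ?_) h
      (SameCycle.refl _ _)
    exact hz.trans (σ.sameCycle_iterate _ _)
  · intro h
    obtain ⟨n, hn⟩ := h.exists_iterate_eq
    clear h
    induction n using Nat.strong_induction_on generalizing x with
    | _ n ih =>
      rcases Nat.eq_zero_or_pos n with rfl | h0
      · obtain rfl : x = y := Subtype.ext hn
        exact SameCycle.refl _ _
      · have hle : σ.returnTime A x ≤ n := by
          by_contra! hlt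
          exact σ.not_of_lt_returnTime A x h0 hlt (hn ▸ y.2)
        have hpos := σ.returnTime_pos A x
        have := ih (n - σ.returnTime A x) (by omega) (σ.induced A x) (by
          rw [induced_apply, ← Function.iterate_add_apply, Nat.sub_add_cancel hle, hn])
        exact sameCycle_apply_left.1 this

end FirstReturn

/-! ### Involutions and free commuting actions -/

theorem card_eq_two_mul_cycles [Finite α] (ρ : Perm α) (h : ∀ x, ρ (ρ x) = x)
    (hne : ∀ x, ρ x ≠ x) : Nat.card α = 2 * Nat.card ρ.Cycles := by
  classical
  have := Fintype.ofFinite ρ.Cycles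
  rw [← Nat.card_congr (Equiv.sigmaFiberEquiv fun x => (Quotient.mk _ x : ρ.Cycles)),
    Nat.card_sigma, Finset.sum_const_nat (m := 2), Finset.card_univ, Nat.card_eq_fintype_card,
    mul_comm]
  intro q _
  induction q using Quotient.inductionOn with | _ x => ?_
  have : ∀ y, (Quotient.mk _ y : ρ.Cycles) = Quotient.mk _ x ↔ y ∈ ({x, ρ x} : Set α) := by
    intro y
    rw [Quotient.eq]
    constructor
    · intro hy
      refine mem_of_sameCycle (A := fun y => y ∈ ({x, ρ x} : Set α)) ?_ hy.symm (Or.inl rfl)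
      rintro _ (rfl | rfl)
      · exact Or.inr rfl
      · exact Or.inl (h _)
    · rintro (rfl | rfl)
      · exact SameCycle.refl _ _
      · exact sameCycle_apply_left.2 (SameCycle.refl _ _)
  rw [Nat.card_congr (Equiv.subtypeEquivRight this)]
  exact Set.ncard_pair (hne x).symm

/-- The permutation of the cycles of `f` induced by a permutation that commutes with `f`. -/
def onCycles (f ρ : Perm α) (h : ∀ x, f (ρ x) = ρ (f x)) : Perm f.Cycles :=
  Quotient.congr ρ fun a b => by
    have h1 : ∀ i : ℤ, ∀ x, (f ^ i) (ρ x) = ρ ((f ^ i) x) := fun i x => by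
      have : Commute f ρ := Equiv.ext h
      exact congrArg (fun g : Perm α => g x) (this.zpow_left i).eq
    constructor
    · rintro ⟨i, hi⟩
      exact ⟨i, by rw [h1, hi]⟩
    · rintro ⟨i, hi⟩
      exact ⟨i, ρ.injective (by rw [← h1, hi])⟩

/-- The cycles of `ρ` above one cycle of the quotient are translates of each other by powers of `f`:
moving a lift along `ρ` brings it into the `f`-orbit of any point above that cycle. -/
theorem card_cycles_le_mul [Finite α] (f ρ : Perm α) (h : ∀ x, f (ρ x) = ρ (f x)) :
    Nat.card ρ.Cycles ≤ orderOf f * Nat.card (onCycles f ρ h).Cycles := by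
  rw [← Nat.card_fin (orderOf f), ← Nat.card_prod]
  refine Nat.card_le_card_of_surjective
    (fun p : Fin (orderOf f) × (onCycles f ρ h).Cycles =>
      (Quotient.mk _ ((f ^ (p.1 : ℕ)) p.2.out.out) : ρ.Cycles)) ?_
  intro q
  induction q using Quotient.inductionOn with | _ x => ?_
  let q : (onCycles f ρ h).Cycles := Quotient.mk _ (Quotient.mk _ x)
  have hq : (onCycles f ρ h).SameCycle q.out (Quotient.mk _ x) := Quotient.mk_out (s := SameCycle.setoid _) _
  obtain ⟨j, hj⟩ := hq.exists_iterate_eq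
  have h2 : ∀ j y, (onCycles f ρ h)^[j] (Quotient.mk _ y) = Quotient.mk _ (ρ^[j] y) := by
    intro j y
    induction j generalizing y with
    | zero => rfl
    | succ j ih => rw [Function.iterate_succ_apply, Function.iterate_succ_apply]; exact ih _
  rw [← Quotient.out_eq q.out, h2] at hj
  have hj' : f.SameCycle (ρ^[j] q.out.out) x := Quotient.exact hj
  obtain ⟨i, hi, h3⟩ := hj'.exists_pow_eq'
  refine ⟨⟨⟨i, hi⟩, q⟩, Quotient.sound (s := SameCycle.setoid ρ) ?_⟩
  have h4 : (f ^ i) (ρ^[j] q.out.out) = ρ^[j] ((f ^ i) q.out.out) := by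
    have : Commute f ρ := Equiv.ext h
    rw [iterate_eq_pow]
    exact congrArg (fun g : Perm α => g q.out.out) (this.pow_pow i j).eq
  rw [← h3, h4]
  exact ρ.sameCycle_iterate j _

/-- By freeness the translates of a point by distinct powers of `f` are distinct. -/
theorem mul_card_cycles_le [Finite α] (f : Perm α) (hf : ∀ i x, (f ^ i) x = x → f ^ i = 1) :
    orderOf f * Nat.card f.Cycles ≤ Nat.card α := by
  rw [← Nat.card_fin (orderOf f), ← Nat.card_prod]
  refine Nat.card_le_card_of_injective
    (fun p : Fin (orderOf f) × f.Cycles => (f ^ (p.1 : ℕ)) p.2.out) ?_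
  have key : ∀ (i j : Fin (orderOf f)) (x : α), (i : ℕ) ≤ j →
      (f ^ (i : ℕ)) x = (f ^ (j : ℕ)) x → i = j := by
    intro i j x hij h
    obtain ⟨l, hl⟩ := Nat.exists_eq_add_of_le hij
    rw [hl, pow_add, mul_apply] at h
    have h1 := hf l x ((f ^ (i : ℕ)).injective h).symm
    have h2 := fun hl => Nat.le_of_dvd hl (orderOf_dvd_of_pow_eq_one h1)
    refine Fin.ext ?_
    by_contra hne
    have := h2 (by omega)
    have := j.2
    omega
  rintro ⟨i, q⟩ ⟨j, q'⟩ h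
  simp only at h
  obtain rfl : q = q' := by
    rw [← Quotient.out_eq q, ← Quotient.out_eq q']
    refine Quotient.sound (s := SameCycle.setoid f) (SameCycle.trans ⟨(i : ℕ), rfl⟩ ?_)
    rw [zpow_natCast, h]
    exact SameCycle.symm ⟨(j : ℕ), rfl⟩
  rcases le_total (i : ℕ) j with hij | hij
  · rw [key i j _ hij h]
  · rw [key j i _ hij h.symm]

end Equiv.Perm

/-! ### Elementary facts on maps, and rigidity of planar maps. -/

namespace NamedMap

variable {k : ℕ} {m : NamedMap k}

instance (m : NamedMap k) : Finite m.D := m.finite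

instance (m : NamedMap k) : Finite m.Vertex := inferInstanceAs (Finite (Quotient _))

/-- A connected map on some closed oriented surface, with named faces. -/
structure IsMap (m : NamedMap k) : Prop where
  rev_rev : ∀ d, m.rev (m.rev d) = d
  rev_ne : ∀ d, m.rev d ≠ d
  connected : ∀ d d', Relation.ReflTransGen (fun a b => b = m.rev a ∨ b = m.next a) d d'
  face_eq_iff : ∀ d d', m.face d = m.face d' ↔ m.next.SameCycle d d'
  face_surjective : Function.Surjective m.face

/-- Euler's formula for the sphere. -/
def Euler (m : NamedMap k) : Prop := Nat.card m.Vertex + (k + 1) = Nat.card m.Edge + 2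

theorem IsPlanarMap.isMap (h : m.IsPlanarMap) : m.IsMap :=
  ⟨h.rev_rev, h.rev_ne, h.connected, h.face_eq_iff, h.face_surjective⟩

theorem IsMap.isPlanarMap (h : m.IsMap) (he : m.Euler) : m.IsPlanarMap :=
  ⟨h.rev_rev, h.rev_ne, h.connected, h.face_eq_iff, h.face_surjective, he⟩

theorem rot_next (d : m.D) : m.rot (m.next d) = m.rev d := by simp [rot]

theorem tail_eq_iff {d d' : m.D} : m.tail d = m.tail d' ↔ m.rot.SameCycle d d' := Quotient.eq

theorem tail_rot (d : m.D) : m.tail (m.rot d) = m.tail d :=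
  tail_eq_iff.2 (Equiv.Perm.sameCycle_apply_left.2 (Equiv.Perm.SameCycle.refl _ _))

theorem tail_next (d : m.D) : m.tail (m.next d) = m.head d := by
  rw [head, ← rot_next, tail_rot]

theorem exists_tail_eq (v : m.Vertex) : ∃ d, m.tail d = v :=
  Quotient.inductionOn v fun d => ⟨d, rfl⟩

namespace IsMap

theorem induction (hm : m.IsMap) {A : m.D → Prop} (hrev : ∀ d, A d → A (m.rev d))
    (hnext : ∀ d, A d → A (m.next d)) {d : m.D} (hd : A d) (d' : m.D) : A d' := by
  induction hm.connected d d' with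
  | refl => exact hd
  | tail _ h ih =>
    rcases h with rfl | rfl
    · exact hrev _ ih
    · exact hnext _ ih

theorem face_next (hm : m.IsMap) (d : m.D) : m.face (m.next d) = m.face d :=
  (hm.face_eq_iff _ _).2 (Equiv.Perm.sameCycle_apply_left.2 (Equiv.Perm.SameCycle.refl _ _))

theorem face_iterate (hm : m.IsMap) (n : ℕ) (d : m.D) : m.face (m.next^[n] d) = m.face d :=
  ((hm.face_eq_iff _ _).2 (m.next.sameCycle_iterate n d)).symm

theorem next_rev (hm : m.IsMap) (d : m.D) : m.next (m.rev d) = m.rot.symm d := by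
  rw [Equiv.eq_symm_apply, rot_next, hm.rev_rev]

theorem head_rev (hm : m.IsMap) (d : m.D) : m.head (m.rev d) = m.tail d := by
  rw [head, hm.rev_rev]

theorem card_eq (hm : m.IsMap) : Nat.card m.D = 2 * Nat.card m.Edge :=
  m.rev.card_eq_two_mul_cycles hm.rev_rev hm.rev_ne

/-- There are at least three faces, so that two names do not suffice. -/
theorem exists_face_ne (hm : m.IsMap) (hk : 2 ≤ k) (a b : Fin (k + 1)) :
    ∃ d, m.face d ≠ a ∧ m.face d ≠ b := by
  obtain ⟨c, hc⟩ : ∃ c, c ∉ ({a, b} : Finset (Fin (k + 1))) := by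
    by_contra! h
    have h1 : Finset.univ ⊆ ({a, b} : Finset (Fin (k + 1))) := fun c _ => h c
    have h2 := Finset.card_le_card h1
    have h3 := Finset.card_le_two (a := a) (b := b)
    simp at h2
    omega
  obtain ⟨d, rfl⟩ := hm.face_surjective c
  simp at hc
  exact ⟨d, hc⟩

/-- A map with at least two faces has a dart that separates a given face from another one. -/
theorem exists_face_rev_ne (hm : m.IsMap) (hk : 1 ≤ k) (i : Fin (k + 1)) :
    ∃ d, m.face d = i ∧ m.face (m.rev d) ≠ i := by
  by_contra! h
  obtain ⟨d, hd⟩ := hm.face_surjective i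
  obtain ⟨j, hj⟩ : ∃ j : Fin (k + 1), j ≠ i := by
    have : Nontrivial (Fin (k + 1)) := Fin.nontrivial_iff_two_le.2 (by omega)
    exact exists_ne i
  obtain ⟨d', hd'⟩ := hm.face_surjective j
  refine hj (hd' ▸ ?_)
  exact hm.induction (A := fun d => m.face d = i) h (fun d h => by rw [hm.face_next, h]) hd d'

end IsMap

/-- Agreement at one dart spreads along `rev` and `next` by connectedness; in particular nontrivial
automorphisms have no fixed dart. -/
theorem IsIso.eq_of_apply_eq {m' : NamedMap k} (hm : m.IsMap) {f g : m.D ≃ m'.D} (hf : IsIso f)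
    (hg : IsIso g) {d : m.D} (h : f d = g d) : f = g :=
  Equiv.ext <| hm.induction (A := fun d => f d = g d) (fun d h => by rw [hf.rev, hg.rev, h])
    (fun d h => by rw [hf.next, hg.next, h]) h

theorem IsIso.rot {m' : NamedMap k} {f : m.D ≃ m'.D} (hf : IsIso f) (d : m.D) :
    f (m.rot d) = m'.rot (f d) := by
  obtain ⟨d, rfl⟩ := m.next.surjective d
  rw [rot_next, hf.rev, hf.next, rot_next]

theorem IsIso.pow {f : m.D ≃ m.D} (hf : IsIso f) (n : ℕ) :
    IsIso (m := m) (m' := m) ((f : Equiv.Perm m.D) ^ n) := by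
  induction n with
  | zero => exact .refl m
  | succ n ih => rw [pow_succ]; exact hf.trans ih

/-- A planar map with at least three named faces has no nontrivial automorphism. -/
theorem IsPlanarMap.eq_refl_of_isIso (hm : m.IsPlanarMap) (hk : 2 ≤ k) {f : m.D ≃ m.D}
    (hf : IsIso (m := m) (m' := m) f) : f = Equiv.refl _ := by
  let F : Equiv.Perm m.D := f
  have hfree : ∀ i x, (F ^ i) x = x → F ^ i = 1 := fun i x h =>
    IsIso.eq_of_apply_eq hm.isMap (hf.pow i) (.refl m) h
  have hrot : ∀ x, F (m.rot x) = m.rot (F x) := hf.rot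
  have hnext : ∀ x, F (m.next x) = m.next (F x) := hf.next
  have hrev : ∀ x, F (m.rev x) = m.rev (F x) := hf.rev
  -- The relation `rot * next = rev` descends to the orbits of `F`. The quotient reversal may have
  -- fixed points, which the genus inequality tolerates.
  have hmul : F.onCycles _ hrot * F.onCycles _ hnext = F.onCycles _ hrev := by
    refine Equiv.ext fun q => ?_
    induction q using Quotient.inductionOn with | _ x => ?_
    exact congrArg (Quotient.mk _) (rot_next x)
  have h1 := Equiv.Perm.card_cycles_add_le (F.onCycles _ hrot) (F.onCycles _ hnext) (by
    intro g h1 h2 q q'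
    induction q using Quotient.inductionOn with | _ x => ?_
    induction q' using Quotient.inductionOn with | _ y => ?_
    refine (hm.isMap.induction (A := fun y => g (Quotient.mk _ y) = g (Quotient.mk _ x))
      (fun d hd => ?_) (fun d hd => ?_) rfl y).symm
    · rw [← hd, ← rot_next]
      exact (h1 (Quotient.mk _ (m.next d))).trans (h2 (Quotient.mk _ d))
    · rw [← hd]
      exact h2 (Quotient.mk _ d))
  rw [hmul] at h1
  have h2 := F.card_cycles_le_mul _ hrot
  have h3 := F.card_cycles_le_mul _ hrev
  have h4 := F.mul_card_cycles_le hfree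
  -- Darts with different names are never identified in the quotient, so no face is lost, while `h2`
  -- and `h3` bound the loss of vertices and edges by the factor `orderOf F`.
  have h5 : k + 1 ≤ Nat.card (F.onCycles _ hnext).Cycles := by
    rw [← Nat.card_fin (k + 1)]
    have hF : ∀ a b, F.SameCycle a b → m.face a = m.face b := fun a b h =>
      Equiv.Perm.mem_of_sameCycle (A := fun b => m.face a = m.face b)
        (fun x h => h.trans (hf.face x).symm) h rfl
    let φ : F.Cycles → Fin (k + 1) := Quotient.lift m.face hF
    refine Nat.card_le_card_of_surjective
      (Quotient.lift φ fun a b h => Equiv.Perm.mem_of_sameCycle (A := fun b => φ a = φ b)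
        (fun x h => h.trans ?_) h rfl) ?_
    · induction x using Quotient.inductionOn with | _ x => ?_
      exact (hm.isMap.face_next x).symm
    · intro i
      obtain ⟨d, hd⟩ := hm.face_surjective i
      exact ⟨Quotient.mk _ (Quotient.mk _ d), hd⟩
  have h6 := hm.euler
  have h7 := hm.isMap.card_eq
  have h8 : Nat.card m.rot.Cycles = Nat.card m.Vertex := rfl
  have h9 : Nat.card m.rev.Cycles = Nat.card m.Edge := rfl
  have h10 := orderOf_pos F
  -- Multiplied by the order `n`, the genus inequality becomes `V + n (k + 1) + E ≤ 2 E + 2 n`, and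
  -- Euler's formula turns it into `(n - 1) (k + 1) ≤ 2 (n - 1)`.
  have h11 : orderOf F = 1 := by
    have h12 : Nat.card (F.onCycles _ hrot).Cycles + (k + 1) +
      Nat.card (F.onCycles _ hrev).Cycles ≤ Nat.card F.Cycles + 2 := by omega
    have h13 := Nat.mul_le_mul_left (orderOf F) h12
    by_contra hne
    obtain ⟨n, hn⟩ : ∃ n, orderOf F = n + 2 := ⟨orderOf F - 2, by omega⟩
    obtain ⟨l, rfl⟩ : ∃ l, k = l + 2 := ⟨k - 2, by omega⟩
    rw [hn] at h2 h3 h4 h13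
    rw [h8] at h2
    rw [h9] at h3
    have h14 : 0 ≤ n * l := Nat.zero_le _
    nlinarith
  exact orderOf_eq_one_iff.1 h11

end NamedMap

/-! ### Contours of groves and forests -/

namespace Grove

/-- The rank of an oriented edge in facial order. -/
def pos {t : Grove} (x : t.Dart) : ℕ := t.contour x

theorem pos_lt {t : Grove} (x : t.Dart) : pos x < t.len := (t.contour x).2

theorem exists_pos_eq {t : Grove} {i : ℕ} (h : i < t.len) : ∃ x : t.Dart, pos x = i :=
  ⟨t.contour.symm ⟨i, h⟩, by simp [pos]⟩

theorem pos_up (a : ℤ) (f g : Grove) : pos (.up a f g) = 0 := rfl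

theorem pos_above (a : ℤ) {f : Grove} (g : Grove) (x : f.Dart) :
    pos (.above a g x) = pos x + 1 := by
  change ((finSumFinEquiv (m := 1 + f.len) (n := 1 + g.len)
    (.inl (finSumFinEquiv (.inr (f.contour x)))) : Fin _) : ℕ) = _
  simp [pos]; omega

theorem pos_down (a : ℤ) (f g : Grove) : pos (.down a f g) = f.len + 1 := by
  change ((finSumFinEquiv (m := 1 + f.len) (n := 1 + g.len)
    (.inr (finSumFinEquiv (.inl 0))) : Fin _) : ℕ) = _
  simp; omega

theorem pos_later (a : ℤ) (f : Grove) {g : Grove} (x : g.Dart) :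
    pos (.later a f x) = f.len + 2 + pos x := by
  change ((finSumFinEquiv (m := 1 + f.len) (n := 1 + g.len)
    (.inr (finSumFinEquiv (.inr (g.contour x)))) : Fin _) : ℕ) = _
  simp [pos]; omega

theorem len_cons (a : ℤ) (f g : Grove) : (cons a f g).len = f.len + 2 + g.len := by
  simp only [len]; omega

/-- The contour starts at the common parent even if there is no tree; in that case the start is also
the end. -/
theorem line_start {W : ℕ → List ℤ} {t : Grove} {o : ℕ} {p : List ℤ}
    (h : ∀ x : t.Dart, W (o + pos x) = x.line p) (h' : W (o + t.len) = p) : W o = p := by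
  cases t with
  | nil => exact h'
  | cons a f g => exact h (.up a f g)

/-- The labels of the ancestors along the contour determine the grove. -/
theorem eq_of_line {W : ℕ → List ℤ} {t t' : Grove} {o : ℕ} {p : List ℤ}
    (h : ∀ x : t.Dart, W (o + pos x) = x.line p) (h1 : W (o + t.len) = p)
    (h2 : (W (o + t.len + 1)).length < p.length)
    (h' : ∀ x : t'.Dart, W (o + pos x) = x.line p) (h1' : W (o + t'.len) = p)
    (h2' : (W (o + t'.len + 1)).length < p.length) : t = t' := by
  -- One step after the start, a nonempty sequence of trees has a longer path, whereas an empty one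
  -- has a shorter path by `h2` and `h2'`. The paths thus tell whether a tree follows, and the label
  -- of its root.
  have aux : ∀ {a : ℤ} {f g : Grove} {o : ℕ} {p : List ℤ},
      (∀ x : (cons a f g).Dart, W (o + pos x) = x.line p) → W (o + 1) = p ++ [a] := by
    intro a f g o p h
    refine line_start (t := f) (fun x => ?_) ?_
    · rw [← show (Dart.above a g x).line p = x.line (p ++ [a]) from rfl, ← h, pos_above]
      congr 1; omega
    · rw [← show (Dart.down a f g).line p = p ++ [a] from rfl, ← h, pos_down]
      congr 1; omega
  induction t generalizing t' o p with
  | nil =>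
    cases t' with
    | nil => rfl
    | cons a f g =>
      change (W (o + 1)).length < _ at h2
      rw [aux h'] at h2
      simp at h2
  | cons a f g ihf ihg =>
    cases t' with
    | nil =>
      change (W (o + 1)).length < _ at h2'
      rw [aux h] at h2'
      simp at h2'
    | cons a' f' g' =>
      obtain rfl : a = a' := by
        have := (aux h).symm.trans (aux h')
        simpa using this
      rw [len_cons] at h1 h2 h1' h2'
      have hg : ∀ x : g.Dart, W (o + (f.len + 2) + pos x) = x.line p := fun x => by
        rw [← show (Dart.later a f x).line p = x.line p from rfl, ← h, pos_later]
        congr 1; omega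
      have hg' : ∀ x : g'.Dart, W (o + (f'.len + 2) + pos x) = x.line p := fun x => by
        rw [← show (Dart.later a f' x).line p = x.line p from rfl, ← h', pos_later]
        congr 1; omega
      have e1 : W (o + (f.len + 2) + g.len) = p := by rw [← h1, add_assoc]
      have e2 : W (o + (f'.len + 2) + g'.len) = p := by rw [← h1', add_assoc]
      obtain rfl : f = f' := by
        refine ihf (o := o + 1) (p := p ++ [a]) (fun x => ?_) ?_ ?_ (fun x => ?_) ?_ ?_
        · rw [← show (Dart.above a g x).line p = x.line (p ++ [a]) from rfl, ← h, pos_above]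
          congr 1; omega
        · rw [← show (Dart.down a f g).line p = p ++ [a] from rfl, ← h, pos_down]
          congr 1; omega
        -- One step after the contour of `f`, the walk is back at the common parent, one level below
        -- the root labeled `a`.
        · rw [show o + 1 + f.len + 1 = o + (f.len + 2) by omega, line_start hg e1]
          simp
        · rw [← show (Dart.above a g' x).line p = x.line (p ++ [a]) from rfl, ← h', pos_above]
          congr 1; omega
        · rw [← show (Dart.down a f' g').line p = p ++ [a] from rfl, ← h', pos_down]
          congr 1; omega
        · rw [show o + 1 + f'.len + 1 = o + (f'.len + 2) by omega, line_start hg' e2]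
          simp
      obtain rfl : g = g' := by
        refine ihg hg e1 ?_ hg' e2 ?_
        · rwa [add_assoc o]
        · rwa [add_assoc o]
      rfl

end Grove

namespace LabeledForest

variable (F : LabeledForest)

/-- The time at which the contour visits the `i`-th floor vertex for the first time. -/
def offset (i : ℕ) : ℕ :=
  ∑ j ∈ Finset.range i, if h : j < F.r then (F.tree ⟨j, h⟩).len + 1 else 0

theorem offset_succ (i : Fin F.r) :
    F.offset (i + 1) = F.offset i + (F.tree i).len + 1 := by
  rw [offset, Finset.sum_range_succ, dif_pos i.2, ← offset, add_assoc]

theorem offset_r : F.offset F.r = F.len := by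
  rw [offset, Finset.sum_range, len]
  exact Finset.sum_congr rfl fun i _ => dif_pos i.2

theorem sum_eq_offset (i : Fin F.r) :
    (∑ j : Fin i, ((F.tree (Fin.castLE i.2.le j)).len + 1)) = F.offset i := by
  rw [offset, Finset.sum_range]
  exact Finset.sum_congr rfl fun j _ => by rw [dif_pos (j.2.trans i.2)]; rfl

theorem contour_tree (i : Fin F.r) (x : (F.tree i).Dart) :
    (F.contour (.tree i x) : ℕ) = F.offset i + Grove.pos x := by
  rw [← sum_eq_offset]
  change ((finSigmaFinEquiv (n := fun i => (F.tree i).len + 1) ⟨i, finSumFinEquiv (Sum.inl ((F.tree i).contour x))⟩ : Fin _) : ℕ) = _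
  rw [finSigmaFinEquiv_apply]
  simp [Grove.pos]

theorem contour_floor (i : Fin F.r) :
    (F.contour (.floor i) : ℕ) = F.offset i + (F.tree i).len := by
  rw [← sum_eq_offset]
  change ((finSigmaFinEquiv (n := fun i => (F.tree i).len + 1) ⟨i, finSumFinEquiv (Sum.inr 0)⟩ : Fin _) : ℕ) = _
  rw [finSigmaFinEquiv_apply]
  simp

theorem snake_getD (y : F.Dart) : F.snake.getD (F.contour y) [] = y.line := by
  have := (F.contour y).2
  simp [snake, List.getD_eq_getElem?_getD]

theorem snake_getD_len : F.snake.getD F.len [] = F.floorLine F.r := by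
  simp [snake, List.getD_eq_getElem?_getD]

theorem snake_getD_tree (i : Fin F.r) (x : (F.tree i).Dart) :
    F.snake.getD (F.offset i + Grove.pos x) [] = x.line (F.floorLine i) := by
  rw [← contour_tree, snake_getD]; rfl

theorem snake_getD_floor (i : Fin F.r) :
    F.snake.getD (F.offset i + (F.tree i).len) [] = F.floorLine i := by
  rw [← contour_floor, snake_getD]; rfl

theorem snake_getD_offset {i : ℕ} (hi : i ≤ F.r) : F.snake.getD (F.offset i) [] = F.floorLine i := by
  rcases hi.lt_or_eq with h | rfl
  · exact Grove.line_start (W := fun n => F.snake.getD n []) (F.snake_getD_tree ⟨i, h⟩) (F.snake_getD_floor ⟨i, h⟩)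
  · rw [offset_r, snake_getD_len]

theorem length_floorLine (i : ℕ) : (F.floorLine i).length = F.r + 1 - i := by
  simp [floorLine]

/-- A labeled forest is determined by its discrete snake. -/
theorem snake_injective : Function.Injective snake := by
  intro F F' h
  -- The path at time `0` runs along the whole floor, so it gives `r` and all floor labels.
  have h0 : F.floorLine 0 = F'.floorLine 0 := by
    rw [← F.snake_getD_offset (Nat.zero_le _), ← F'.snake_getD_offset (Nat.zero_le _), h]
    rfl
  have hr : F.r = F'.r := by
    have := congrArg List.length h0
    simpa [length_floorLine] using this
  obtain ⟨r, fl, tr⟩ := F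
  obtain ⟨r', fl', tr'⟩ := F'
  obtain rfl : r = r' := hr
  obtain rfl : fl = fl' := List.ofFn_injective (List.reverse_injective h0)
  -- Equality of the first `n` trees is needed to know that the `n`-th floor vertex is reached at
  -- the same time in both contours.
  suffices ∀ n ≤ r, offset ⟨r, fl, tr⟩ n = offset ⟨r, fl, tr'⟩ n ∧
      ∀ i : Fin r, (i : ℕ) < n → tr i = tr' i by
    obtain rfl : tr = tr' := funext fun i => (this r le_rfl).2 i i.2
    rfl
  intro n
  induction n with
  | zero => exact fun _ => ⟨rfl, fun i hi => absurd hi (Nat.not_lt_zero _)⟩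
  | succ n ih =>
    intro hn
    obtain ⟨h1, h2⟩ := ih (Nat.le_of_succ_le hn)
    let j : Fin r := ⟨n, hn⟩
    have key : tr j = tr' j := by
      have e1 := snake_getD_tree ⟨r, fl, tr⟩ j
      have e2 := snake_getD_floor ⟨r, fl, tr⟩ j
      have e3 := snake_getD_offset ⟨r, fl, tr⟩ hn
      have e1' := snake_getD_tree ⟨r, fl, tr'⟩ j
      have e2' := snake_getD_floor ⟨r, fl, tr'⟩ j
      have e3' := snake_getD_offset ⟨r, fl, tr'⟩ hn
      have e4 := offset_succ ⟨r, fl, tr⟩ j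
      have e4' := offset_succ ⟨r, fl, tr'⟩ j
      rw [← h] at e1' e2' e3'
      change _ = offset _ n at h1
      have h1' : offset ⟨r, fl, tr⟩ j = offset ⟨r, fl, tr'⟩ j := h1
      -- The end of a tree is visible in the snake: the next floor vertex is one step closer to the
      -- extra vertex, so the path gets shorter.
      refine Grove.eq_of_line (W := fun n => (snake ⟨r, fl, tr⟩).getD n [])
        (o := offset ⟨r, fl, tr⟩ j) e1 e2 ?_ (h1' ▸ e1') (h1' ▸ e2') ?_
      · rw [← e4, e3, length_floorLine, length_floorLine]
        change r + 1 - (n + 1) < r + 1 - n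
        omega
      · rw [h1', ← e4', e3', length_floorLine, length_floorLine]
        change r + 1 - (n + 1) < r + 1 - n
        omega
    refine ⟨?_, fun i hi => ?_⟩
    · have e4 := offset_succ ⟨r, fl, tr⟩ j
      have e4' := offset_succ ⟨r, fl, tr'⟩ j
      change offset _ (n + 1) = offset _ n + (tr j).len + 1 at e4
      change offset _ (n + 1) = offset _ n + (tr' j).len + 1 at e4'
      rw [e4, e4', h1, key]
    · rcases Nat.lt_succ_iff_lt_or_eq.1 hi with hi | hi
      · exact h2 i hi
      · obtain rfl : i = j := Fin.ext hi
        exact key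

end LabeledForest

namespace SnakeData

variable {k : ℕ} {S : Scheme k}

/-- Apart from proofs, only `ℓ` is not contained in the forests; it is the initial value of the
walks, every vertex being the origin of a dart. -/
theorem forest_injective : Function.Injective fun δ : SnakeData S => δ.forest := by
  intro δ δ' h
  have hF : ∀ e, δ.forest e = δ'.forest e := congrFun h
  obtain ⟨ℓ, r, M, tree⟩ := δ
  obtain ⟨ℓ', r', M', tree', _, _, _, _, _, M_zero'⟩ := δ'
  obtain rfl : r = r' := funext fun e => congrArg LabeledForest.r (hF e)
  obtain rfl : M = M' := funext fun e => by
    have := hF e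
    simp only [forest, LabeledForest.mk.injEq, heq_eq_eq, true_and] at this
    exact this.1
  obtain rfl : tree = tree' := funext fun e => by
    have := hF e
    simp only [forest, LabeledForest.mk.injEq, heq_eq_eq, true_and] at this
    exact this
  obtain rfl : ℓ = ℓ' := funext fun v => by
    obtain ⟨e, rfl⟩ := NamedMap.exists_tail_eq v
    rw [← M_zero']
    symm
    apply_assumption
  rfl

/-- The discrete snakes determine the labeling, the lengths, the walks and the forests. -/
theorem snake_injective : Function.Injective fun δ : SnakeData S => δ.snake := fun _ _ h =>
  forest_injective <| funext fun e => LabeledForest.snake_injective (congrFun h e)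

end SnakeData

/-! ### Plane trees in a map, and the core -/

namespace NamedMap

variable {k : ℕ} {m : NamedMap k} {L : m.D → ℤ}

/-- `Fits m L d t d'`: the facial walk that starts with the dart `d` follows the contour of a
sequence of trees isomorphic to `t` (with labels given by `L`) and arrives at `d'`. -/
inductive Fits (m : NamedMap k) (L : m.D → ℤ) : m.D → Grove → m.D → Prop
  | nil (d : m.D) : Fits m L d .nil d
  | cons {d d' : m.D} {f g : Grove} : Fits m L (m.next d) f (m.rev d) →
      Fits m L (m.next (m.rev d)) g d' → Fits m L d (.cons (L (m.rev d)) f g) d'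

/-- The `2` counts both sides of the edge below the first root. -/
theorem iterate_len_cons {d : m.D} {f : Grove} (h : m.next^[f.len] (m.next d) = m.rev d) (j : ℕ) :
    m.next^[f.len + 2 + j] d = m.next^[j] (m.next (m.rev d)) := by
  rw [show f.len + 2 + j = j + 1 + f.len + 1 by omega, Function.iterate_succ_apply,
    Function.iterate_add_apply, h, Function.iterate_succ_apply]

namespace Fits

theorem iterate_len {d d' : m.D} {t : Grove} (h : Fits m L d t d') : m.next^[t.len] d = d' := by
  induction h with
  | nil d => rfl
  | cons _ _ ihf ihg => rw [Grove.len_cons, iterate_len_cons ihf, ihg]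

theorem face_eq (hm : m.IsMap) {d d' : m.D} {t : Grove} (h : Fits m L d t d') :
    m.face d' = m.face d := by
  rw [← h.iterate_len, hm.face_iterate]

theorem iterate_pos_rev (hm : m.IsMap) {d d' : m.D} {t : Grove} (h : Fits m L d t d')
    (x : t.Dart) : m.next^[Grove.pos x.rev] d = m.rev (m.next^[Grove.pos x] d) := by
  induction h with
  | nil d => nomatch x
  | @cons d d' f g hf hg ihf ihg =>
    have e := hf.iterate_len
    cases x with
    | up =>
      rw [Grove.Dart.rev, Grove.pos_down, Grove.pos_up, Function.iterate_succ_apply, e]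
      rfl
    | above _ _ x =>
      rw [Grove.Dart.rev, Grove.pos_above, Grove.pos_above, Function.iterate_succ_apply, ihf]
      rfl
    | down =>
      rw [Grove.Dart.rev, Grove.pos_down, Grove.pos_up, Function.iterate_succ_apply, e, hm.rev_rev]
      rfl
    | later _ _ x =>
      rw [Grove.Dart.rev, Grove.pos_later, Grove.pos_later, iterate_len_cons e,
        iterate_len_cons e, ihg]

/-- Recognition of a tree: it suffices that the successive darts of the face are matched by `rev` as
in `t`. Here `c` is the label at the common parent. -/
theorem of_pos {t : Grove} {d : m.D} (c : ℤ) (ι : t.Dart → m.D)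
    (hι : ∀ x, ι x = m.next^[Grove.pos x] d) (hrev : ∀ x, ι x.rev = m.rev (ι x))
    (hL : ∀ x, L (ι x) = x.label c) : Fits m L d t (m.next^[t.len] d) := by
  induction t generalizing d c with
  | nil => exact .nil d
  | cons a f g ihf ihg =>
    have e1 : ι (.up a f g) = d := hι _
    have e2 : ι (.down a f g) = m.rev d := by rw [← e1, ← hrev]; rfl
    have e3 : m.next^[f.len] (m.next d) = m.rev d := by
      rw [← e2, hι, Grove.pos_down, Function.iterate_succ_apply]
    have e4 : L (m.rev d) = a := by rw [← e2, hL]; rfl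
    rw [Grove.len_cons, iterate_len_cons e3, ← e4]
    refine .cons ?_ ?_
    · have := ihf (d := m.next d) a (fun x => ι (.above a g x))
        (fun x => by rw [hι, Grove.pos_above, Function.iterate_succ_apply])
        (fun x => by rw [← hrev]; rfl) (fun x => by rw [hL]; rfl)
      rwa [e3] at this
    · exact ihg (d := m.next (m.rev d)) c (fun x => ι (.later a f x))
        (fun x => by rw [hι, Grove.pos_later, iterate_len_cons e3])
        (fun x => by rw [← hrev]; rfl) (fun x => by rw [hL]; rfl)

theorem label_pos (hm : m.IsMap) (hL : ∀ d, L (m.next d) = L (m.rev d)) {d d' : m.D} {t : Grove}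
    (h : Fits m L d t d') (x : t.Dart) : L (m.next^[Grove.pos x] d) = x.label (L d) := by
  induction h with
  | nil d => nomatch x
  | @cons d d' f g hf hg ihf ihg =>
    have e := hf.iterate_len
    cases x with
    | up => rfl
    | above _ _ x =>
      rw [Grove.pos_above, Function.iterate_succ_apply, ihf, hL]
      rfl
    | down =>
      rw [Grove.pos_down, Function.iterate_succ_apply, e]
      rfl
    | later _ _ x =>
      rw [Grove.pos_later, iterate_len_cons e, ihg, hL, hm.rev_rev]
      rfl

theorem label_eq (hm : m.IsMap) (hL : ∀ d, L (m.next d) = L (m.rev d)) {d d' : m.D} {t : Grove}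
    (h : Fits m L d t d') : L d' = L d := by
  induction h with
  | nil d => rfl
  | cons _ _ _ ih => rw [ih, hL, hm.rev_rev]

theorem isLabeling (hm : m.IsMap) (hL : ∀ d, L (m.next d) = L (m.rev d))
    (hadj : ∀ d, |L (m.rev d) - L d| ≤ 1) {d d' : m.D} {t : Grove}
    (h : Fits m L d t d') : t.IsLabeling (L d) := by
  induction h with
  | nil d => trivial
  | cons _ _ ihf ihg =>
    rw [hL] at ihf ihg
    rw [hm.rev_rev] at ihg
    exact ⟨hadj _, ihf, ihg⟩

end Fits

/-- The dart `d` leads from the root towards a leaf in a tree attached to the rest of the map. -/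
def Up (m : NamedMap k) (L : m.D → ℤ) (d : m.D) : Prop :=
  ∃ t, Fits m L (m.next d) t (m.rev d)

/-- The darts whose edge does not belong to an attached tree. -/
def Core (m : NamedMap k) (L : m.D → ℤ) (c : m.D) : Prop := ¬ m.Up L c ∧ ¬ m.Up L (m.rev c)

/-- Clockwise rotation from a dart that leads to a subtree. -/
def Jump (m : NamedMap k) (L : m.D → ℤ) (d d' : m.D) : Prop := m.Up L d ∧ d' = m.rot.symm d

theorem Up.face_rev (hm : m.IsMap) {d : m.D} (h : m.Up L d) : m.face (m.rev d) = m.face d := by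
  obtain ⟨t, ht⟩ := h
  rw [ht.face_eq hm, hm.face_next]

theorem Fits.up_or_up_rev (hm : m.IsMap) {d d' : m.D} {t : Grove} (h : Fits m L d t d') {i : ℕ}
    (hi : i < t.len) : m.Up L (m.next^[i] d) ∨ m.Up L (m.rev (m.next^[i] d)) := by
  obtain ⟨x, rfl⟩ := Grove.exists_pos_eq hi
  clear hi
  induction h with
  | nil d => nomatch x
  | @cons d d' f g hf hg ihf ihg =>
    have e := hf.iterate_len
    cases x with
    | up => exact Or.inl ⟨f, hf⟩
    | above _ _ x =>
      rw [Grove.pos_above, Function.iterate_succ_apply]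
      exact ihf x
    | down =>
      rw [Grove.pos_down, Function.iterate_succ_apply, e, hm.rev_rev]
      exact Or.inr ⟨f, hf⟩
    | later _ _ x =>
      rw [Grove.pos_later, iterate_len_cons e]
      exact ihg x

/-- With its converse `exists_fits_of_jumps`, this turns the contour of a sequence of trees into a
rotation around the common parent, so that the cycles of `rot` can be used. -/
theorem Fits.jumps (hm : m.IsMap) {d d' : m.D} {t : Grove} (h : Fits m L d t d') :
    Relation.ReflTransGen (m.Jump L) d d' := by
  induction h with
  | nil d => exact .refl
  | @cons d d' f g hf _ _ ih => exact .head ⟨⟨f, hf⟩, (hm.next_rev d)⟩ ih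

theorem exists_fits_of_jumps (hm : m.IsMap) {d d' : m.D}
    (h : Relation.ReflTransGen (m.Jump L) d d') : ∃ t, Fits m L d t d' := by
  induction h using Relation.ReflTransGen.head_induction_on with
  | refl => exact ⟨_, .nil _⟩
  | head h _ ih =>
    obtain ⟨⟨f, hf⟩, rfl⟩ := h
    obtain ⟨g, hg⟩ := ih
    rw [← hm.next_rev] at hg
    exact ⟨_, .cons hf hg⟩

/-- A face whose contour is the contour of a tree is the only one. -/
theorem Fits.eq_nil (hm : m.IsMap) (hk : 1 ≤ k) {d : m.D} {t : Grove} (h : Fits m L d t d) :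
    t = .nil := by
  by_contra hne
  have hpos : 0 < t.len := by
    cases t with
    | nil => exact absurd rfl hne
    | cons a f g => rw [Grove.len_cons]; omega
  obtain ⟨d', hd', hd''⟩ := hm.exists_face_rev_ne hk (m.face d)
  -- A closed contour of a tree is stable under `next`, and under `rev` because both sides of each
  -- edge are visited. By connectedness it is the whole map, which then has a single face.
  have : ∀ y, ∃ i < t.len, y = m.next^[i] d := by
    refine hm.induction (d := d) ?_ ?_ ⟨0, hpos, rfl⟩
    · rintro _ ⟨i, hi, rfl⟩
      obtain ⟨x, rfl⟩ := Grove.exists_pos_eq hi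
      exact ⟨_, Grove.pos_lt _, (h.iterate_pos_rev hm x).symm⟩
    · rintro _ ⟨i, hi, rfl⟩
      rcases Nat.lt_or_ge (i + 1) t.len with h1 | h1
      · exact ⟨i + 1, h1, (Function.iterate_succ_apply' _ _ _).symm⟩
      · refine ⟨0, hpos, ?_⟩
        rw [← Function.iterate_succ_apply' m.next, show i.succ = t.len by omega, h.iterate_len]
        rfl
  obtain ⟨i, _, hi⟩ := this (m.rev d')
  exact hd'' (by rw [hi, hm.face_iterate])

/-- Otherwise the trees at both ends of the edge would make the whole map a plane tree. -/
theorem Up.not_up_rev (hm : m.IsMap) (hk : 1 ≤ k) {d : m.D} (h : m.Up L d) :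
    ¬ m.Up L (m.rev d) := by
  rintro ⟨g, hg⟩
  obtain ⟨f, hf⟩ := h
  rw [hm.rev_rev] at hg
  have h2 : Fits m L (m.rev d) (.cons (L (m.rev (m.rev d))) g f) (m.rev d) := by
    refine .cons ?_ ?_
    · rwa [hm.rev_rev]
    · rw [hm.rev_rev]; exact hf
  exact Grove.noConfusion (h2.eq_nil hm hk)

/-- Reading a contour is deterministic: a further subtree starts exactly when the current dart is
`Up`. The inner readings end at the reversal of an `Up` dart, which is not `Up`. -/
theorem Fits.unique (hm : m.IsMap) (hk : 1 ≤ k) {d d' d'' : m.D} {t t' : Grove}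
    (h : Fits m L d t d') (hd' : ¬ m.Up L d') (h' : Fits m L d t' d'') (hd'' : ¬ m.Up L d'') :
    t = t' ∧ d' = d'' := by
  induction h generalizing t' d'' with
  | nil d =>
    cases h' with
    | nil => exact ⟨rfl, rfl⟩
    | cons hf _ => exact absurd ⟨_, hf⟩ hd'
  | @cons d d' f g hf hg ihf ihg =>
    cases h' with
    | nil => exact absurd ⟨_, hf⟩ hd''
    | cons hf' hg' =>
      have hn : ¬ m.Up L (m.rev d) := Up.not_up_rev hm hk ⟨_, hf⟩
      obtain ⟨rfl, -⟩ := ihf hn hf' hn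
      obtain ⟨rfl, rfl⟩ := ihg hd' hg' hd''
      exact ⟨rfl, rfl⟩

theorem sameCycle_rot_symm {a b : m.D} : Equiv.Perm.SameCycle m.rot.symm a b ↔ m.rot.SameCycle a b :=
  Equiv.Perm.sameCycle_inv

/-- Around the root of an attached tree, every other dart leads to a subtree. -/
theorem Up.around (hm : m.IsMap) {u z : m.D} (h : m.Up L u) (hz : m.tail z = m.head u) :
    z = m.rev u ∨ m.Up L z ∧ Relation.ReflTransGen (m.Jump L) z (m.rev u) := by
  -- Clockwise rotation from `rev u` begins with `next u`, passes the edges to the children of the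
  -- endpoint of `u`, and comes back to `rev u`.
  have h0 : Relation.ReflTransGen (m.Jump L) (m.rot.symm (m.rev u)) (m.rev u) := by
    obtain ⟨f, hf⟩ := h
    rw [← rot_next, Equiv.symm_apply_apply, rot_next]
    exact hf.jumps hm
  have key : ∀ z, Relation.ReflTransGen (m.Jump L) z (m.rev u) →
      z = m.rev u ∨ m.Up L z ∧ Relation.ReflTransGen (m.Jump L) z (m.rev u) := fun z hz => by
    rcases hz.cases_head with h1 | ⟨b, h1, h2⟩
    · exact Or.inl h1
    · exact Or.inr ⟨h1.1, hz⟩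
  refine Equiv.Perm.mem_of_sameCycle (A := fun z => z = m.rev u ∨
    m.Up L z ∧ Relation.ReflTransGen (m.Jump L) z (m.rev u)) ?_
    (sameCycle_rot_symm.2 (tail_eq_iff.1 hz.symm)) (Or.inl rfl)
  rintro y (rfl | ⟨hy, hy'⟩)
  · exact key _ h0
  · refine key _ ?_
    rcases hy'.cases_head with h1 | ⟨b, h1, h2⟩
    · rw [h1]; exact h0
    · rwa [← h1.2]

theorem Core.rev (hm : m.IsMap) {c : m.D} (h : m.Core L c) : m.Core L (m.rev c) :=
  ⟨h.2, by rw [hm.rev_rev]; exact h.1⟩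

/-- All darts at the endpoint of an `Up` dart belong to attached trees, so a vertex of the core can
only be a root of such trees. -/
theorem Core.not_up_rev_of_tail_eq (hm : m.IsMap) {c z : m.D} (h : m.Core L c)
    (hz : m.tail z = m.tail c) : ¬ m.Up L (m.rev z) := by
  intro hu
  rcases hu.around hm (z := c) (by rw [hm.head_rev, hz]) with h1 | h1
  · rw [h1] at h
    exact h.2 (by rwa [hm.rev_rev])
  · exact h.1 h1.1

theorem tail_iterate_rot_symm (n : ℕ) (d : m.D) : m.tail (m.rot.symm^[n] d) = m.tail d :=
  (tail_eq_iff.2 (sameCycle_rot_symm.1 (Equiv.Perm.sameCycle_iterate m.rot.symm n d))).symm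

theorem jumps_iterate {z : m.D} {n : ℕ} (h : ∀ i < n, m.Up L (m.rot.symm^[i] z)) :
    Relation.ReflTransGen (m.Jump L) z (m.rot.symm^[n] z) := by
  induction n with
  | zero => exact .refl
  | succ n ih =>
    refine (ih fun i hi => h i (by omega)).tail ⟨h n (by omega), ?_⟩
    rw [Function.iterate_succ_apply']

/-- Every vertex of the core is reached by clockwise rotation through attached trees. -/
theorem Core.exists_fits (hm : m.IsMap) {c z : m.D} (h : m.Core L c) (hz : m.tail z = m.tail c) :
    ∃ n, m.Core L (m.rot.symm^[n] z) ∧ (∀ i < n, m.Up L (m.rot.symm^[i] z)) ∧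
      ∃ t, Fits m L z t (m.rot.symm^[n] z) := by
  obtain ⟨N, hN⟩ := (sameCycle_rot_symm.2 (tail_eq_iff.1 hz)).exists_iterate_eq
  have hex : ∃ n, ¬ m.Up L (m.rot.symm^[n] z) := ⟨N, by rw [hN]; exact h.1⟩
  classical
  have hup : ∀ i < Nat.find hex, m.Up L (m.rot.symm^[i] z) :=
    fun i hi => not_not.1 (Nat.find_min hex hi)
  refine ⟨Nat.find hex, ⟨Nat.find_spec hex, ?_⟩, hup, ?_⟩
  · exact h.not_up_rev_of_tail_eq hm (by rw [tail_iterate_rot_symm, hz])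
  · exact exists_fits_of_jumps hm (jumps_iterate hup)

/-- If all darts at a vertex led to subtrees, a full turn would read a closed contour, contrary to
`Fits.eq_nil`. -/
theorem exists_not_up (hm : m.IsMap) (hk : 1 ≤ k) (z : m.D) :
    ∃ y, m.tail y = m.tail z ∧ ¬ m.Up L y := by
  by_contra! h
  obtain ⟨n, hn, hz⟩ := Equiv.Perm.exists_iterate_eq_self m.rot.symm z
  obtain ⟨n, rfl⟩ := Nat.exists_eq_add_of_lt hn
  obtain ⟨f, hf⟩ := h z rfl
  rw [zero_add, Function.iterate_succ_apply] at hz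
  have := jumps_iterate (L := L) (z := m.rot.symm z) (n := n) fun i _ => h _ (by
    rw [tail_iterate_rot_symm]; exact tail_iterate_rot_symm 1 z)
  rw [hz] at this
  obtain ⟨g, hg⟩ := exists_fits_of_jumps hm this
  rw [← hm.next_rev] at hg
  exact Grove.noConfusion ((Fits.cons hf hg).eq_nil hm hk)

theorem core_of_face_ne (hm : m.IsMap) {c : m.D} (h : m.face (m.rev c) ≠ m.face c) :
    m.Core L c :=
  ⟨fun hc => h (hc.face_rev hm), fun hc => h (by rw [← hc.face_rev hm, hm.rev_rev])⟩

theorem jumps_face_eq (hm : m.IsMap) {d d' : m.D} (h : Relation.ReflTransGen (m.Jump L) d d') :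
    m.face d' = m.face d := by
  obtain ⟨t, ht⟩ := exists_fits_of_jumps hm h
  exact ht.face_eq hm

/-- A vertex incident to two faces is a vertex of the core. -/
theorem exists_core_of_incident (hm : m.IsMap) (hk : 1 ≤ k) (L : m.D → ℤ) {v : m.Vertex}
    {i j : Fin (k + 1)} (hi : m.Incident v i) (hj : m.Incident v j) (hij : i ≠ j) :
    ∃ c, m.Core L c ∧ m.tail c = v := by
  obtain ⟨d, rfl, rfl⟩ := hi
  obtain ⟨d', hd', rfl⟩ := hj
  obtain ⟨y, hy, hy'⟩ := exists_not_up (L := L) hm hk d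
  -- If `rev y` were `Up`, every dart at this vertex would be linked to `y` by jumps, which stay in
  -- one face.
  refine ⟨y, ⟨hy', fun hu => hij ?_⟩, hy⟩
  have h1 := hu.around hm (z := d) (by rw [hm.head_rev, hy])
  have h2 := hu.around hm (z := d') (by rw [hm.head_rev, hy, hd'])
  have h3 : ∀ z, (z = m.rev (m.rev y) ∨ m.Up L z ∧
      Relation.ReflTransGen (m.Jump L) z (m.rev (m.rev y))) → m.face z = m.face y := by
    rintro z (rfl | ⟨_, hz⟩)
    · rw [hm.rev_rev]
    · rw [← jumps_face_eq hm hz, hm.rev_rev]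
  rw [h3 _ h1, h3 _ h2]

end NamedMap

/-! ### The core as a map, and its Euler characteristic. -/

namespace NamedMap

variable {k : ℕ} {m : NamedMap k}

/-- The core: the map that remains when all attached trees are removed. -/
noncomputable def core (hm : m.IsMap) (L : m.D → ℤ) : NamedMap k where
  D := {c // m.Core L c}
  finite := inferInstance
  rev := m.rev.subtypePerm fun c => ⟨fun h => by simpa [hm.rev_rev] using h.rev hm, fun h => h.rev hm⟩
  next := m.next.induced (m.Core L)
  face c := m.face c.1

namespace core

variable {hm : m.IsMap} {L : m.D → ℤ}

theorem rev_coe (c : (core hm L).D) : ((core hm L).rev c).1 = m.rev c.1 := rfl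

theorem face_coe (c : (core hm L).D) : (core hm L).face c = m.face c.1 := rfl

/-- No dart on the contour of the attached trees is in the core, so the first return to the core
along the face is where this contour ends. -/
theorem exists_fits (c : (core hm L).D) :
    ∃ t, Fits m L (m.next c.1) t ((core hm L).next c).1 := by
  obtain ⟨n, h1, -, t, ht⟩ := (c.2.rev hm).exists_fits hm (m.tail_next c.1)
  refine ⟨t, ?_⟩
  convert ht
  have h2 := ht.iterate_len
  rw [← Function.iterate_succ_apply] at h2
  rw [← h2]
  refine Equiv.Perm.induced_eq _ _ _ (Nat.succ_pos _) (by rw [h2]; exact h1) fun i hi hi' hc => ?_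
  obtain ⟨i, rfl⟩ := Nat.exists_eq_add_of_lt hi
  rw [zero_add, Function.iterate_succ_apply] at hc
  rcases ht.up_or_up_rev hm (i := i) (by omega) with h | h
  · exact hc.1 h
  · exact hc.2 h

theorem exists_fits_symm (c : (core hm L).D) :
    ∃ t, Fits m L (m.next ((core hm L).next.symm c).1) t c.1 := by
  have h := exists_fits ((core hm L).next.symm c)
  rwa [Equiv.apply_symm_apply] at h

/-- The sequence of trees grafted on the left of a core dart, at its origin. -/
noncomputable def tree (c : (core hm L).D) : Grove :=
  (exists_fits_symm c).choose

theorem fits_tree (c : (core hm L).D) : Fits m L (m.next ((core hm L).next.symm c).1) (tree c) c.1 :=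
  (exists_fits_symm c).choose_spec

theorem fits_tree_next (c : (core hm L).D) :
    Fits m L (m.next c.1) (tree ((core hm L).next c)) ((core hm L).next c).1 := by
  have := fits_tree ((core hm L).next c)
  rwa [Equiv.symm_apply_apply] at this

/-- The tool for computing in the core: by uniqueness, any contour of trees that ends at a core dart
gives both `next` and the grafted trees. -/
theorem next_eq_of_fits (hk : 1 ≤ k) {c c' : (core hm L).D} {t : Grove}
    (h : Fits m L (m.next c.1) t c'.1) : (core hm L).next c = c' ∧ tree c' = t := by
  obtain ⟨h1, h2⟩ := (fits_tree_next c).unique hm hk ((core hm L).next c).2.1 h c'.2.1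
  have h3 : (core hm L).next c = c' := Subtype.ext h2
  exact ⟨h3, by rw [← h1, h3]⟩

theorem rot_symm_eq (c : (core hm L).D) :
    (core hm L).rot.symm c = (core hm L).next ((core hm L).rev c) := by
  rw [Equiv.symm_apply_eq, rot_next]
  exact Subtype.ext (hm.rev_rev _).symm

/-- The rotation of the core comes from `rev` and `next`. Seen as a first return of the rotation of
`m`, it identifies the vertices of the core with the vertices of `m` that carry a core dart. -/
theorem rot_symm_eq_induced (hk : 1 ≤ k) (c : (core hm L).D) :
    (core hm L).rot.symm c = Equiv.Perm.induced m.rot.symm (m.Core L) c := by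
  obtain ⟨n, h1, h2, t, ht⟩ := (c.2).exists_fits hm (z := m.rot.symm c.1) (tail_iterate_rot_symm 1 _)
  rw [rot_symm_eq]
  have h3 : m.rot.symm c.1 = m.next ((core hm L).rev c).1 := by rw [rev_coe, hm.next_rev]
  rw [(next_eq_of_fits hk (c' := ⟨_, h1⟩) (by rw [← h3]; exact ht)).1]
  refine Subtype.ext ?_
  refine (Equiv.Perm.induced_eq m.rot.symm (m.Core L) c (Nat.succ_pos n)
    (by rw [Function.iterate_succ_apply]; exact h1) fun i hi hi' hc => ?_).symm
  obtain ⟨i, rfl⟩ := Nat.exists_eq_add_of_lt hi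
  rw [zero_add, Function.iterate_succ_apply] at hc
  exact hc.1 (h2 i (by omega))

theorem tail_eq_iff (hk : 1 ≤ k) {c c' : (core hm L).D} :
    (core hm L).tail c = (core hm L).tail c' ↔ m.tail c.1 = m.tail c'.1 := by
  rw [NamedMap.tail_eq_iff, NamedMap.tail_eq_iff, ← sameCycle_rot_symm, ← sameCycle_rot_symm,
    show (core hm L).rot.symm = Equiv.Perm.induced m.rot.symm (m.Core L) from
      Equiv.ext fun c => rot_symm_eq_induced hk c]
  exact Equiv.Perm.sameCycle_induced_iff m.rot.symm (m.Core L) c c'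

/-- A leaf of the core, with the trees attached to it, would itself be an attached tree. -/
theorem rot_ne (c : (core hm L).D) : (core hm L).rot c ≠ c := by
  intro h
  have h1 : (core hm L).next ((core hm L).rev c) = c := by
    rw [← rot_symm_eq, Equiv.symm_apply_eq, h]
  obtain ⟨t, ht⟩ := exists_fits ((core hm L).rev c)
  rw [h1] at ht
  exact c.2.2 ⟨t, by rwa [hm.rev_rev]⟩

/-- An attached tree lies in one corner of the core, so it brings no new incident face. -/
theorem incident_iff (hk : 1 ≤ k) {c : (core hm L).D} {i : Fin (k + 1)} :
    (core hm L).Incident ((core hm L).tail c) i ↔ m.Incident (m.tail c.1) i := by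
  constructor
  · rintro ⟨c', h, rfl⟩
    exact ⟨c'.1, (tail_eq_iff hk).1 h, rfl⟩
  · rintro ⟨d, hd, rfl⟩
    obtain ⟨n, h1, -, t, ht⟩ := (c.2).exists_fits hm hd
    refine ⟨⟨_, h1⟩, (tail_eq_iff hk).2 ?_, ht.face_eq hm⟩
    rw [← hd]
    exact tail_iterate_rot_symm _ _

theorem exists_face_eq (hm : m.IsMap) (L : m.D → ℤ) (hk : 1 ≤ k) (i : Fin (k + 1)) :
    ∃ c : (core hm L).D, (core hm L).face c = i := by
  obtain ⟨d, rfl, h⟩ := hm.exists_face_rev_ne hk i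
  exact ⟨⟨d, core_of_face_ne hm h⟩, rfl⟩

theorem iterate_lt_not_core (c : (core hm L).D) {j : ℕ} (hj : j < (tree c).len) :
    ¬ m.Core L (m.next^[j] (m.next ((core hm L).next.symm c).1)) := fun h => by
  rcases (fits_tree c).up_or_up_rev hm hj with h1 | h1
  · exact h.1 h1
  · exact h.2 h1

/-- The property `A` of core darts, extended to the trees grafted before them. -/
theorem induction_arc {A : (core hm L).D → Prop} (hrev : ∀ c, A c → A ((core hm L).rev c))
    (hnext : ∀ c, A c → A ((core hm L).next c)) {c₀ : (core hm L).D} (h₀ : A c₀) (y : m.D) :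
    ∃ c, A c ∧ ∃ j ≤ (tree c).len, y = m.next^[j] (m.next ((core hm L).next.symm c).1) := by
  have hcore : ∀ c, A c → ∃ c', A c' ∧ ∃ j ≤ (tree c').len,
      c.1 = m.next^[j] (m.next ((core hm L).next.symm c').1) := fun c hc =>
    ⟨c, hc, _, le_rfl, (fits_tree c).iterate_len.symm⟩
  refine hm.induction (A := fun y => ∃ c, A c ∧ ∃ j ≤ (tree c).len,
    y = m.next^[j] (m.next ((core hm L).next.symm c).1)) ?_ ?_ (hcore _ h₀) y
  · rintro _ ⟨c, hc, j, hj, rfl⟩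
    rcases hj.lt_or_eq with h | rfl
    · obtain ⟨x, rfl⟩ := Grove.exists_pos_eq h
      exact ⟨c, hc, _, (Grove.pos_lt _).le, ((fits_tree c).iterate_pos_rev hm x).symm⟩
    · rw [(fits_tree c).iterate_len]
      exact hcore _ (hrev c hc)
  · rintro _ ⟨c, hc, j, hj, rfl⟩
    rcases hj.lt_or_eq with h | rfl
    · exact ⟨c, hc, j + 1, h, (Function.iterate_succ_apply' _ _ _).symm⟩
    · refine ⟨_, hnext c hc, 0, Nat.zero_le _, ?_⟩
      rw [(fits_tree c).iterate_len, Equiv.symm_apply_apply]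
      rfl

theorem isMap (hm : m.IsMap) (L : m.D → ℤ) (hk : 1 ≤ k) : (core hm L).IsMap where
  rev_rev c := Subtype.ext (hm.rev_rev _)
  rev_ne c h := hm.rev_ne _ (congrArg Subtype.val h)
  connected c c' := by
    obtain ⟨c'', h, j, hj, hc⟩ := induction_arc
      (A := Relation.ReflTransGen (fun a b => b = (core hm L).rev a ∨ b = (core hm L).next a) c)
      (fun _ h => h.tail (Or.inl rfl)) (fun _ h => h.tail (Or.inr rfl)) .refl c'.1
    rcases hj.lt_or_eq with h1 | rfl
    · exact absurd (hc ▸ c'.2) (iterate_lt_not_core _ h1)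
    · rw [(fits_tree c'').iterate_len] at hc
      rwa [show c' = c'' from Subtype.ext hc]
  face_eq_iff c c' := by
    rw [face_coe, face_coe, hm.face_eq_iff]
    exact (Equiv.Perm.sameCycle_induced_iff m.next (m.Core L) c c').symm
  face_surjective i := exists_face_eq hm L hk i

theorem card_D (hm : m.IsMap) (L : m.D → ℤ) (hk : 1 ≤ k) : Nat.card m.D =
    2 * Nat.card {d // m.Up L (m.rev d)} + Nat.card (core hm L).D := by
  have e1 : Nat.card {d // m.Up L d} = Nat.card {d // m.Up L (m.rev d)} :=
    Nat.card_congr (m.rev.subtypeEquiv fun d => by rw [hm.rev_rev])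
  let φ : {d // m.Up L d} ⊕ {d // m.Up L (m.rev d)} ⊕ (core hm L).D → m.D :=
    Sum.elim Subtype.val (Sum.elim Subtype.val Subtype.val)
  have hφ : Function.Bijective φ := by
    constructor
    · rintro (⟨d, hd⟩ | ⟨d, hd⟩ | ⟨d, hd⟩) (⟨d', hd'⟩ | ⟨d', hd'⟩ | ⟨d', hd'⟩) h <;>
        obtain rfl : d = d' := h
      · rfl
      · exact absurd hd' (hd.not_up_rev hm hk)
      · exact absurd hd hd'.1
      · exact absurd hd (hd'.not_up_rev hm hk)
      · rfl
      · exact absurd hd hd'.2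
      · exact absurd hd' hd.1
      · exact absurd hd' hd.2
      · rfl
    · intro d
      by_cases h1 : m.Up L d
      · exact ⟨.inl ⟨d, h1⟩, rfl⟩
      by_cases h2 : m.Up L (m.rev d)
      · exact ⟨.inr (.inl ⟨d, h2⟩), rfl⟩
      · exact ⟨.inr (.inr ⟨d, h1, h2⟩), rfl⟩
  have : Finite (core hm L).D := (core hm L).finite
  rw [← Nat.card_congr (Equiv.ofBijective φ hφ), Nat.card_sum, Nat.card_sum, e1]
  omega

/-- A vertex outside the core has exactly one dart whose reversal is `Up`, the one to its parent,
and a core vertex has none. -/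
theorem card_vertex (hm : m.IsMap) (L : m.D → ℤ) (hk : 1 ≤ k) : Nat.card m.Vertex =
    Nat.card {d // m.Up L (m.rev d)} + Nat.card (core hm L).Vertex := by
  let ψ : (core hm L).Vertex → m.Vertex := Quotient.lift (fun c => m.tail c.1) fun c c' h =>
    (tail_eq_iff hk).1 (Quotient.sound h)
  let φ : {d // m.Up L (m.rev d)} ⊕ (core hm L).Vertex → m.Vertex :=
    Sum.elim (fun d => m.tail d.1) ψ
  have hψ : ∀ c, ψ ((core hm L).tail c) = m.tail c.1 := fun _ => rfl
  have h0 : ∀ (d : {d // m.Up L (m.rev d)}) (c : (core hm L).D), m.tail d.1 ≠ m.tail c.1 :=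
    fun d c h => c.2.not_up_rev_of_tail_eq hm h d.2
  have hφ : Function.Bijective φ := by
    constructor
    · rintro (d | v) (d' | v') h
      · have h1 : m.tail d.1 = m.tail d'.1 := h
        rcases d'.2.around hm (z := d.1) (by rw [hm.head_rev, h1]) with h2 | h2
        · rw [hm.rev_rev] at h2
          rw [Subtype.ext h2]
        · exact absurd d.2 (h2.1.not_up_rev hm hk)
      · obtain ⟨c, rfl⟩ := exists_tail_eq v'
        exact absurd h (h0 d c)
      · obtain ⟨c, rfl⟩ := exists_tail_eq v
        exact absurd h.symm (h0 d' c)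
      · obtain ⟨c, rfl⟩ := exists_tail_eq v
        obtain ⟨c', rfl⟩ := exists_tail_eq v'
        rw [(tail_eq_iff hk).2 h]
    · intro v
      obtain ⟨z, rfl⟩ := exists_tail_eq v
      obtain ⟨y, hy, hy'⟩ := exists_not_up (L := L) hm hk z
      by_cases h2 : m.Up L (m.rev y)
      · exact ⟨.inl ⟨y, h2⟩, hy⟩
      · exact ⟨.inr ((core hm L).tail ⟨y, hy', h2⟩), hy⟩
  rw [← Nat.card_congr (Equiv.ofBijective φ hφ), Nat.card_sum]

/-- Pruning keeps the faces and removes one vertex and one edge for each `Up` dart. -/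
theorem euler_iff (hm : m.IsMap) (L : m.D → ℤ) (hk : 1 ≤ k) : (core hm L).Euler ↔ m.Euler := by
  have h1 := card_vertex hm L hk
  have h2 := card_D hm L hk
  rw [hm.card_eq, (isMap hm L hk).card_eq] at h2
  unfold Euler
  omega

end core

end NamedMap

/-! ### Subdivisions -/

namespace NamedMap

variable {k : ℕ} {m : NamedMap k}

theorem tail_eq_iff_of_rot_rot {d : m.D} (h : m.rot (m.rot d) = d) (d' : m.D) :
    m.tail d' = m.tail d ↔ d' = d ∨ d' = m.rot d := by
  constructor
  · intro h'
    refine Equiv.Perm.mem_of_sameCycle (A := fun d' => d' = d ∨ d' = m.rot d) ?_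
      (tail_eq_iff.1 h'.symm) (Or.inl rfl)
    rintro _ (rfl | rfl)
    · exact Or.inr rfl
    · exact Or.inl h
  · rintro (rfl | rfl)
    · rfl
    · exact tail_rot d

theorem degree_eq_two {d : m.D} (h : m.rot (m.rot d) = d) (h' : m.rot d ≠ d) :
    m.degree (m.tail d) = 2 := by
  rw [degree, Nat.card_congr (Equiv.subtypeEquivRight (tail_eq_iff_of_rot_rot h))]
  exact Set.ncard_pair h'.symm

theorem three_le_degree {d : m.D} (h : m.rot (m.rot d) ≠ d) : 3 ≤ m.degree (m.tail d) := by
  have h' : m.rot d ≠ d := fun h' => h (by rw [h', h'])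
  have h3 : ({d, m.rot d, m.rot (m.rot d)} : Set m.D).ncard = 3 :=
    Set.ncard_eq_three.2 ⟨_, _, _, h'.symm, h.symm, fun h4 => h' (m.rot.injective h4).symm, rfl⟩
  rw [← h3]
  refine Set.ncard_le_ncard (t := {d' | m.tail d' = m.tail d}) ?_ (Set.toFinite _)
  rintro _ (rfl | rfl | rfl)
  · rfl
  · exact tail_rot d
  · exact (tail_rot _).trans (tail_rot d)

theorem rot_ne_of_two_le_degree {d : m.D} (h : 2 ≤ m.degree (m.tail d)) : m.rot d ≠ d := by
  intro h'
  have : m.degree (m.tail d) = 1 := by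
    rw [degree, Nat.card_congr (Equiv.subtypeEquivRight
      (tail_eq_iff_of_rot_rot (by rw [h', h'])))]
    rw [h']
    simp
  omega

theorem three_le_degree_iff {d : m.D} : 3 ≤ m.degree (m.tail d) ↔ m.rot (m.rot d) ≠ d := by
  refine ⟨fun h h' => ?_, three_le_degree⟩
  have := degree_eq_two h' (rot_ne_of_two_le_degree (by omega))
  omega

/-- `C` is obtained from `S` by replacing every edge `e` with a chain of `r e` edges, the first of
which is `ι e`. -/
structure IsSubdivision (S C : NamedMap k) (r : S.D → ℕ) (ι : S.D → C.D) : Prop where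
  r_pos : ∀ e, 0 < r e
  r_rev : ∀ e, r (S.rev e) = r e
  next_r : ∀ e, C.next^[r e] (ι e) = ι (S.next e)
  rev_next : ∀ e i, i < r e → C.rev (C.next^[i] (ι e)) = C.next^[r e - 1 - i] (ι (S.rev e))
  exists_eq : ∀ c, ∃ e i, i < r e ∧ C.next^[i] (ι e) = c
  inj : ∀ e e' i i', i < r e → i' < r e' → C.next^[i] (ι e) = C.next^[i'] (ι e') → e = e' ∧ i = i'
  face : ∀ e, C.face (ι e) = S.face e

namespace IsSubdivision

variable {S C : NamedMap k} {r : S.D → ℕ} {ι : S.D → C.D}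

theorem injective (h : IsSubdivision S C r ι) : Function.Injective ι := fun e e' he =>
  (h.inj e e' 0 0 (h.r_pos e) (h.r_pos e') he).1

theorem rev_last (h : IsSubdivision S C r ι) (e : S.D) :
    C.rev (C.next^[r e - 1] (ι e)) = ι (S.rev e) := by
  have := h.r_pos e
  rw [h.rev_next e _ (by omega), Nat.sub_self]
  rfl

theorem rev_rev (h : IsSubdivision S C r ι) (hC : C.IsMap) (e : S.D) : S.rev (S.rev e) = e := by
  refine h.injective ?_
  have h2 := h.rev_next e 0 (h.r_pos _)
  rw [← h.rev_last, h.r_rev, ← Nat.sub_zero (r e - 1), ← h2, hC.rev_rev]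
  rfl

theorem rot_symm (h : IsSubdivision S C r ι) (hC : C.IsMap) (e : S.D) :
    C.rot.symm (ι e) = ι (S.rot.symm e) := by
  have h1 : S.next (S.rev e) = S.rot.symm e := by
    rw [Equiv.eq_symm_apply, rot_next, h.rev_rev hC]
  have h2 := h.rev_next e 0 (h.r_pos e)
  rw [Function.iterate_zero_apply] at h2
  rw [← hC.next_rev, h2, ← Function.iterate_succ_apply' C.next, ← h1, ← h.next_r, h.r_rev]
  congr 2
  have := h.r_pos e
  omega

theorem rot (h : IsSubdivision S C r ι) (hC : C.IsMap) (e : S.D) : C.rot (ι e) = ι (S.rot e) := by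
  rw [← Equiv.eq_symm_apply, h.rot_symm hC, Equiv.symm_apply_apply]

theorem exists_of_tail_eq (h : IsSubdivision S C r ι) (hC : C.IsMap) {e : S.D} {c : C.D}
    (hc : C.tail c = C.tail (ι e)) : ∃ e', S.tail e' = S.tail e ∧ ι e' = c := by
  refine Equiv.Perm.mem_of_sameCycle (A := fun c => ∃ e', S.tail e' = S.tail e ∧ ι e' = c) ?_
    (tail_eq_iff.1 hc.symm) ⟨e, rfl, rfl⟩
  rintro _ ⟨e', he, rfl⟩
  exact ⟨S.rot e', by rw [tail_rot, he], (h.rot hC e').symm⟩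

theorem tail_eq_iff (h : IsSubdivision S C r ι) (hC : C.IsMap) {e e' : S.D} :
    C.tail (ι e) = C.tail (ι e') ↔ S.tail e = S.tail e' := by
  constructor
  · intro h1
    obtain ⟨e'', h2, h3⟩ := h.exists_of_tail_eq hC h1
    rw [← h2, h.injective h3]
  · intro h1
    refine Equiv.Perm.mem_of_sameCycle (A := fun e' => C.tail (ι e) = C.tail (ι e')) ?_
      (NamedMap.tail_eq_iff.1 h1) rfl
    intro x hx
    rw [hx, ← h.rot hC, tail_rot]

theorem rot_symm_interior (h : IsSubdivision S C r ι) (hC : C.IsMap) (e : S.D) {i : ℕ}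
    (hi : i < r e) : C.rot.symm (C.next^[i] (ι e)) = C.next^[r e - i] (ι (S.rev e)) := by
  rw [← hC.next_rev, h.rev_next e i hi, ← Function.iterate_succ_apply' C.next]
  congr 2
  omega

theorem rot_rot_interior (h : IsSubdivision S C r ι) (hC : C.IsMap) (e : S.D) {i : ℕ} (h0 : 0 < i)
    (hi : i < r e) : C.rot (C.rot (C.next^[i] (ι e))) = C.next^[i] (ι e) := by
  rw [← Equiv.eq_symm_apply, ← Equiv.eq_symm_apply, h.rot_symm_interior hC e hi,
    h.rot_symm_interior hC (S.rev e) (by rw [h.r_rev]; omega), h.rev_rev hC, h.r_rev]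
  congr 2
  omega

theorem rot_interior (h : IsSubdivision S C r ι) (hC : C.IsMap) (e : S.D) {i : ℕ} (h0 : 0 < i)
    (hi : i < r e) : C.rot (C.next^[i] (ι e)) = C.next^[r e - i] (ι (S.rev e)) := by
  rw [← h.rot_symm_interior hC e hi, Equiv.eq_symm_apply, h.rot_rot_interior hC e h0 hi]

theorem not_mem_range_interior (h : IsSubdivision S C r ι) (e : S.D) {i : ℕ} (h0 : 0 < i)
    (hi : i < r e) (e' : S.D) : ι e' ≠ C.next^[i] (ι e) := fun h' =>
  h0.ne (h.inj e' e 0 i (h.r_pos _) hi h').2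

theorem face_iterate (h : IsSubdivision S C r ι) (hC : C.IsMap) (e : S.D) (i : ℕ) :
    C.face (C.next^[i] (ι e)) = S.face e := by
  rw [hC.face_iterate, h.face]

theorem face_rev_iterate (h : IsSubdivision S C r ι) (hC : C.IsMap) (e : S.D) {i : ℕ}
    (hi : i < r e) : C.face (C.rev (C.next^[i] (ι e))) = S.face (S.rev e) := by
  rw [h.rev_next e i hi, h.face_iterate hC]

theorem incident_iff (h : IsSubdivision S C r ι) (hC : C.IsMap) {e : S.D} {j : Fin (k + 1)} :
    C.Incident (C.tail (ι e)) j ↔ S.Incident (S.tail e) j := by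
  constructor
  · rintro ⟨c, hc, rfl⟩
    obtain ⟨e', h1, rfl⟩ := h.exists_of_tail_eq hC hc
    exact ⟨e', h1, (h.face e').symm⟩
  · rintro ⟨e', h1, rfl⟩
    exact ⟨ι e', (h.tail_eq_iff hC).2 h1, h.face e'⟩

theorem incident_interior_iff (h : IsSubdivision S C r ι) (hC : C.IsMap) (e : S.D) {i : ℕ}
    (h0 : 0 < i) (hi : i < r e) {j : Fin (k + 1)} :
    C.Incident (C.tail (C.next^[i] (ι e))) j ↔ S.face e = j ∨ S.face (S.rev e) = j := by
  have h1 := tail_eq_iff_of_rot_rot (h.rot_rot_interior hC e h0 hi)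
  constructor
  · rintro ⟨c, hc, rfl⟩
    rcases (h1 c).1 hc with rfl | rfl
    · exact Or.inl (h.face_iterate hC e i).symm
    · rw [h.rot_interior hC e h0 hi]
      exact Or.inr (h.face_iterate hC _ _).symm
  · rintro (rfl | rfl)
    · exact ⟨_, rfl, h.face_iterate hC e i⟩
    · exact ⟨_, tail_rot _, by rw [h.rot_interior hC e h0 hi, h.face_iterate hC]⟩

/-- A property of the darts of `C` that holds along the chains of the darts with property `A`. -/
theorem induction_chain (h : IsSubdivision S C r ι) (hC : C.IsMap) {A : S.D → Prop}
    (hrev : ∀ e, A e → A (S.rev e)) (hnext : ∀ e, A e → A (S.next e)) {e₀ : S.D} (h₀ : A e₀)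
    (c : C.D) : ∃ e, A e ∧ ∃ i < r e, C.next^[i] (ι e) = c := by
  refine hC.induction (A := fun c => ∃ e, A e ∧ ∃ i < r e, C.next^[i] (ι e) = c) ?_ ?_
    (d := ι e₀) ⟨e₀, h₀, 0, h.r_pos _, rfl⟩ c
  · rintro _ ⟨e, he, i, hi, rfl⟩
    exact ⟨_, hrev e he, r e - 1 - i, by rw [h.r_rev]; omega, (h.rev_next e i hi).symm⟩
  · rintro _ ⟨e, he, i, hi, rfl⟩
    rw [← Function.iterate_succ_apply' C.next]
    rcases Nat.lt_or_ge (i + 1) (r e) with h1 | h1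
    · exact ⟨e, he, _, h1, rfl⟩
    · refine ⟨_, hnext e he, 0, h.r_pos _, ?_⟩
      rw [← h.next_r, show i.succ = r e by omega]
      rfl

theorem sameCycle_next_iff (h : IsSubdivision S C r ι) {e e' : S.D} :
    C.next.SameCycle (ι e) (ι e') ↔ S.next.SameCycle e e' := by
  have hS := S.finite
  constructor
  · intro h1
    obtain ⟨e'', h2, i, hi, h3⟩ := Equiv.Perm.mem_of_sameCycle
      (A := fun c => ∃ e'', S.next.SameCycle e e'' ∧ ∃ i < r e'', C.next^[i] (ι e'') = c)
      (by
        rintro _ ⟨e'', h2, i, hi, rfl⟩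
        rw [← Function.iterate_succ_apply' C.next]
        rcases Nat.lt_or_ge (i + 1) (r e'') with h1 | h1
        · exact ⟨e'', h2, _, h1, rfl⟩
        · refine ⟨_, h2.trans (S.next.sameCycle_iterate 1 _), 0, h.r_pos _, ?_⟩
          rw [Function.iterate_one, ← h.next_r, show i.succ = r e'' by omega]
          rfl) h1 ⟨e, .refl _ _, 0, h.r_pos _, rfl⟩
    rwa [(h.inj e'' e' i 0 hi (h.r_pos _) h3).1] at h2
  · intro h1
    refine Equiv.Perm.mem_of_sameCycle (A := fun e' => C.next.SameCycle (ι e) (ι e')) ?_ h1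
      (.refl _ _)
    intro x hx
    rw [← h.next_r]
    exact hx.trans (C.next.sameCycle_iterate _ _)

theorem isMap (h : IsSubdivision S C r ι) (hC : C.IsMap) (hleaf : ∀ c, C.rot c ≠ c) : S.IsMap where
  rev_rev := h.rev_rev hC
  -- If `rev e = e`, the chain is folded onto itself: its middle vertex is a leaf if the length is
  -- even, and its middle dart is fixed by `rev` if the length is odd.
  rev_ne e he := by
    have h1 : ∀ i < r e, C.rev (C.next^[i] (ι e)) = C.next^[r e - 1 - i] (ι e) := fun i hi => by
      have := h.rev_next e i hi
      rwa [he] at this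
    have h2 := h.r_pos e
    rcases Nat.even_or_odd' (r e) with ⟨s, hs | hs⟩
    · have h3 := h1 (s - 1) (by omega)
      rw [show r e - 1 - (s - 1) = s - 1 + 1 by omega, Function.iterate_succ_apply'] at h3
      apply hleaf (C.rev (C.next^[s - 1] (ι e)))
      nth_rw 1 [h3]
      rw [rot_next]
    · have h3 := h1 s (by omega)
      rw [show r e - 1 - s = s by omega] at h3
      exact hC.rev_ne _ h3
  connected e e' := by
    obtain ⟨e'', h1, i, hi, h2⟩ := h.induction_chain hC
      (A := Relation.ReflTransGen (fun a b => b = S.rev a ∨ b = S.next a) e)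
      (fun _ h => h.tail (Or.inl rfl)) (fun _ h => h.tail (Or.inr rfl)) .refl (ι e')
    rwa [(h.inj e'' e' i 0 hi (h.r_pos _) h2).1] at h1
  face_eq_iff e e' := by
    rw [← h.face, ← h.face, hC.face_eq_iff, h.sameCycle_next_iff]
  face_surjective j := by
    obtain ⟨c, rfl⟩ := hC.face_surjective j
    obtain ⟨e, i, hi, rfl⟩ := h.exists_eq c
    exact ⟨e, (h.face_iterate hC e i).symm⟩

theorem not_mem_range_iff (h : IsSubdivision S C r ι) (hC : C.IsMap) (c : C.D) :
    (∀ e, ι e ≠ C.rot c) ↔ ∀ e, ι e ≠ c := by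
  constructor
  · intro h1 e he
    exact h1 (S.rot e) (by rw [← h.rot hC, he])
  · intro h1 e he
    refine h1 (S.rot.symm e) ?_
    rw [← h.rot_symm hC, he, Equiv.symm_apply_apply]

theorem rot_rot_of_not_mem_range (h : IsSubdivision S C r ι) (hC : C.IsMap) {c : C.D}
    (hc : ∀ e, ι e ≠ c) : C.rot (C.rot c) = c := by
  obtain ⟨e, i, hi, rfl⟩ := h.exists_eq c
  rcases Nat.eq_zero_or_pos i with rfl | h0
  · exact absurd rfl (hc e)
  · exact h.rot_rot_interior hC e h0 hi

/-- The cycles of `ρ` are the interior vertices of the chains. Each has two darts, so subdividing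
adds as many edges as vertices. -/
theorem euler_iff (h : IsSubdivision S C r ι) (hC : C.IsMap) (hleaf : ∀ c, C.rot c ≠ c) :
    C.Euler ↔ S.Euler := by
  have hS := h.isMap hC hleaf
  let ρ : Equiv.Perm {c // ∀ e, ι e ≠ c} := C.rot.subtypePerm (h.not_mem_range_iff hC)
  have e1 : Nat.card {c // ∀ e, ι e ≠ c} = 2 * Nat.card ρ.Cycles :=
    ρ.card_eq_two_mul_cycles (fun c => Subtype.ext (h.rot_rot_of_not_mem_range hC c.2))
      (fun c hc => hleaf c.1 (congrArg Subtype.val hc))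
  have e2 : Nat.card C.D = Nat.card S.D + Nat.card {c // ∀ e, ι e ≠ c} := by
    rw [← Nat.card_sum]
    refine (Nat.card_congr (Equiv.ofBijective (Sum.elim ι Subtype.val) ⟨?_, ?_⟩)).symm
    · rintro (e | c) (e' | c') h1
      · rw [h.injective h1]
      · exact absurd h1 (c'.2 e)
      · exact absurd h1.symm (c.2 e')
      · rw [Subtype.ext h1]
    · intro c
      by_cases hc : ∀ e, ι e ≠ c
      · exact ⟨.inr ⟨c, hc⟩, rfl⟩
      · push Not at hc
        obtain ⟨e, he⟩ := hc
        exact ⟨.inl e, he⟩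
  have e3 : Nat.card C.Vertex = Nat.card S.Vertex + Nat.card ρ.Cycles := by
    have hρ : ∀ c c' : {c // ∀ e, ι e ≠ c}, ρ.SameCycle c c' ↔ C.tail c.1 = C.tail c'.1 := by
      intro c c'
      constructor
      · intro h1
        refine Equiv.Perm.mem_of_sameCycle (A := fun c' : {c // ∀ e, ι e ≠ c} =>
          C.tail c.1 = C.tail c'.1) (fun x hx => ?_) h1 rfl
        rw [hx]
        exact (tail_rot _).symm
      · intro h1
        rcases (tail_eq_iff_of_rot_rot (h.rot_rot_of_not_mem_range hC c.2) _).1 h1.symm with h2 | h2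
        · rw [Subtype.ext h2]
        · exact ⟨1, Subtype.ext h2.symm⟩
    let ψ : S.Vertex → C.Vertex := Quotient.lift (fun e => C.tail (ι e)) fun e e' h1 =>
      (h.tail_eq_iff hC).2 (Quotient.sound h1)
    let χ : ρ.Cycles → C.Vertex := Quotient.lift (fun c => C.tail c.1) fun c c' h1 => (hρ c c').1 h1
    have h0 : ∀ (e : S.D) (c : {c // ∀ e, ι e ≠ c}), C.tail (ι e) ≠ C.tail c.1 := by
      intro e c h1
      obtain ⟨e', -, h2⟩ := h.exists_of_tail_eq hC h1.symm
      exact c.2 e' h2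
    rw [← Nat.card_sum]
    refine (Nat.card_congr (Equiv.ofBijective (Sum.elim ψ χ) ⟨?_, ?_⟩)).symm
    · rintro (v | q) (v' | q') h1
      · obtain ⟨e, rfl⟩ := exists_tail_eq v
        obtain ⟨e', rfl⟩ := exists_tail_eq v'
        rw [(h.tail_eq_iff hC).1 h1]
      · obtain ⟨e, rfl⟩ := exists_tail_eq v
        induction q' using Quotient.inductionOn with | _ c => ?_
        exact absurd h1 (h0 e c)
      · obtain ⟨e, rfl⟩ := exists_tail_eq v'
        induction q using Quotient.inductionOn with | _ c => ?_
        exact absurd h1.symm (h0 e c)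
      · induction q using Quotient.inductionOn with | _ c => ?_
        induction q' using Quotient.inductionOn with | _ c' => ?_
        exact congrArg Sum.inr (Quotient.sound ((hρ c c').2 h1))
    · intro v
      obtain ⟨c, rfl⟩ := exists_tail_eq v
      by_cases hc : ∀ e, ι e ≠ c
      · exact ⟨.inr (Quotient.mk _ ⟨c, hc⟩), rfl⟩
      · push Not at hc
        obtain ⟨e, rfl⟩ := hc
        exact ⟨.inl (S.tail e), rfl⟩
  have e4 := hC.card_eq
  have e5 := hS.card_eq
  unfold Euler
  omega

end IsSubdivision

end NamedMap

/-! ### The map underlying the reconstruction -/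

namespace Grove

theorem Dart.rev_ne {t : Grove} (x : t.Dart) : x.rev ≠ x := by
  induction x with
  | up => exact fun h => nomatch h
  | above a g x ih => exact fun h => ih (by simpa [rev] using h)
  | down => exact fun h => nomatch h
  | later a f x ih => exact fun h => ih (by simpa [rev] using h)

theorem exists_pos_zero (t : Grove) :
    t.len = 0 ∨ ∃ x : t.Dart, pos x = 0 ∧ ∀ c, x.label c = c := by
  cases t with
  | nil => exact Or.inl rfl
  | cons a f g => exact Or.inr ⟨.up a f g, rfl, fun _ => rfl⟩

/-- Each edge of the contour starts where the previous one ends, and the last one ends at the common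
parent. This yields the consistency of labels after gluing. -/
theorem exists_pos_succ {t : Grove} (x : t.Dart) :
    (∃ x' : t.Dart, pos x' = pos x + 1 ∧ ∀ c, x'.label c = x.rev.label c) ∨
      (pos x + 1 = t.len ∧ ∀ c, x.rev.label c = c) := by
  induction x with
  | up a f g =>
    rcases f.exists_pos_zero with h | ⟨x, h, h'⟩
    · exact Or.inl ⟨.down a f g, by rw [pos_down, pos_up, h], fun _ => rfl⟩
    · exact Or.inl ⟨.above a g x, by rw [pos_above, pos_up, h], fun _ => h' a⟩
  | @above a f g x ih =>
    rcases ih with ⟨x', h, h'⟩ | ⟨h, h'⟩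
    · exact Or.inl ⟨.above a g x', by rw [pos_above, pos_above, h], fun _ => h' a⟩
    · exact Or.inl ⟨.down a f g, by rw [pos_down, pos_above, h], fun _ => (h' a).symm⟩
  | down a f g =>
    rcases g.exists_pos_zero with h | ⟨x, h, h'⟩
    · exact Or.inr ⟨by rw [pos_down, len_cons, h], fun _ => rfl⟩
    · exact Or.inl ⟨.later a f x, by rw [pos_later, pos_down, h], fun c => h' c⟩
  | @later a f g x ih =>
    rcases ih with ⟨x', h, h'⟩ | ⟨h, h'⟩
    · exact Or.inl ⟨.later a f x', by rw [pos_later, pos_later, h]; omega, fun c => h' c⟩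
    · exact Or.inr ⟨by rw [pos_later, len_cons]; omega, fun c => h' c⟩

theorem IsLabeling.abs_sub_le {t : Grove} {c : ℤ} (h : t.IsLabeling c) (x : t.Dart) :
    |x.rev.label c - x.label c| ≤ 1 := by
  induction x generalizing c with
  | up a f g => exact h.1
  | above a g x ih => exact ih h.2.1
  | down a f g => rw [abs_sub_comm]; exact h.1
  | later a f x ih => exact ih h.2.2

end Grove

namespace SnakeData

variable {k : ℕ} {S : Scheme k} (δ : SnakeData S)

instance : Finite δ.OrientedEdge := by
  have := S.finite
  exact inferInstanceAs (Finite (Σ e : S.D, (δ.forest e).Dart))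

/-- The reconstructed map, without labels and root. -/
def glueMap : NamedMap k where
  D := δ.OrientedEdge
  finite := inferInstance
  rev := δ.glueRev
  next := δ.glueNext
  face y := S.face y.1

/-- The dart of the scheme whose forest contains an oriented edge. -/
def base (y : δ.OrientedEdge) : S.D := y.1

/-- The rank of an oriented edge in the contour of its forest. -/
def rank (y : δ.OrientedEdge) : ℕ := (δ.forest y.1).contour y.2

/-- The label of the origin of an oriented edge. -/
def label (y : δ.OrientedEdge) : ℤ := y.2.label

/-- The number of oriented edges of `F_e`. -/
def forestLen (e : S.D) : ℕ := (δ.forest e).len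

/-- The first visit time of the `i`-th floor vertex of `F_e`. -/
def offset (e : S.D) (i : ℕ) : ℕ := (δ.forest e).offset i

/-- An edge of the `i`-th tree of `F_e`. -/
def treeDart (e : S.D) (i : Fin (δ.r e)) (x : (δ.tree e i).Dart) : δ.OrientedEdge := ⟨e, .tree i x⟩

/-- The `i`-th floor edge of `F_e`. -/
def floorDart (e : S.D) (i : Fin (δ.r e)) : δ.OrientedEdge := ⟨e, .floor i⟩

theorem exists_eq (y : δ.OrientedEdge) :
    (∃ e i x, y = δ.treeDart e i x) ∨ ∃ e i, y = δ.floorDart e i := by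
  obtain ⟨e, ⟨i, x⟩ | i⟩ := y
  · exact Or.inl ⟨e, i, x, rfl⟩
  · exact Or.inr ⟨e, i, rfl⟩

theorem base_treeDart (e : S.D) (i : Fin (δ.r e)) (x : (δ.tree e i).Dart) :
    δ.base (δ.treeDart e i x) = e := rfl

theorem base_floorDart (e : S.D) (i : Fin (δ.r e)) : δ.base (δ.floorDart e i) = e := rfl

theorem label_treeDart (e : S.D) (i : Fin (δ.r e)) (x : (δ.tree e i).Dart) :
    δ.label (δ.treeDart e i x) = x.label (δ.M e i.castSucc) := rfl

theorem rank_treeDart (e : S.D) (i : Fin (δ.r e)) (x : (δ.tree e i).Dart) :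
    δ.rank (δ.treeDart e i x) = δ.offset e i + Grove.pos x := (δ.forest e).contour_tree i x

theorem rank_floorDart (e : S.D) (i : Fin (δ.r e)) :
    δ.rank (δ.floorDart e i) = δ.offset e i + (δ.tree e i).len := (δ.forest e).contour_floor i

theorem offset_r (e : S.D) : δ.offset e (δ.r e) = δ.forestLen e := (δ.forest e).offset_r

theorem offset_succ (e : S.D) (i : Fin (δ.r e)) :
    δ.offset e (i + 1) = δ.offset e i + (δ.tree e i).len + 1 := (δ.forest e).offset_succ i

theorem glueRev_floorDart (e : S.D) (i : Fin (δ.r e)) : δ.glueRev (δ.floorDart e i) =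
    δ.floorDart (S.rev e) (Fin.cast (δ.r_rev e).symm (Fin.rev i)) := rfl

theorem glueRev_treeDart (e : S.D) (i : Fin (δ.r e)) (x : (δ.tree e i).Dart) :
    δ.glueRev (δ.treeDart e i x) = δ.treeDart e i x.rev := rfl

theorem floorDart_injective {e e' : S.D} {i : Fin (δ.r e)} {i' : Fin (δ.r e')}
    (h : δ.floorDart e i = δ.floorDart e' i') : e = e' ∧ (i : ℕ) = i' := by
  obtain rfl : e = e' := congrArg δ.base h
  exact ⟨rfl, congrArg Fin.val (LabeledForest.Dart.floor.inj (eq_of_heq (Sigma.mk.inj h).2))⟩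

theorem treeDart_injective {e : S.D} {i : Fin (δ.r e)} {x x' : (δ.tree e i).Dart}
    (h : δ.treeDart e i x = δ.treeDart e i x') : x = x' :=
  eq_of_heq (LabeledForest.Dart.tree.inj (eq_of_heq (Sigma.mk.inj h).2)).2

theorem ext_rank {y y' : δ.OrientedEdge} (h : δ.base y = δ.base y') (h' : δ.rank y = δ.rank y') :
    y = y' := by
  obtain ⟨e, y⟩ := y
  obtain ⟨e', y'⟩ := y'
  obtain rfl : e = e' := h
  exact congrArg (Sigma.mk e) ((δ.forest e).contour.injective (Fin.ext h'))

theorem forestLen_pos (e : S.D) : 0 < δ.forestLen e := (δ.forest e).len_pos (δ.r_pos e)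

theorem rank_lt (y : δ.OrientedEdge) : δ.rank y < δ.forestLen (δ.base y) :=
  ((δ.forest y.1).contour y.2).2

/-- The first oriented edge in the contour of the forest `F_e`. -/
def start (e : S.D) : δ.OrientedEdge := ⟨e, (δ.forest e).contour.symm ⟨0, δ.forestLen_pos e⟩⟩

theorem base_start (e : S.D) : δ.base (δ.start e) = e := rfl

theorem rank_start (e : S.D) : δ.rank (δ.start e) = 0 := by
  change (((δ.forest e).contour ((δ.forest e).contour.symm ⟨0, δ.forestLen_pos e⟩) : Fin _) : ℕ) = 0
  rw [Equiv.apply_symm_apply]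

theorem glueNext_of_lt {y : δ.OrientedEdge} (h : δ.rank y + 1 < δ.forestLen (δ.base y)) :
    δ.base (δ.glueNext y) = δ.base y ∧ δ.rank (δ.glueNext y) = δ.rank y + 1 := by
  obtain ⟨e, y⟩ := y
  have h1 : δ.glueNext ⟨e, y⟩ = ⟨e, (δ.forest e).contour.symm ⟨_, h⟩⟩ :=
    congrArg (Equiv.sigmaCongrRight fun e => (δ.forest e).contour).symm (dif_pos h)
  exact ⟨(congrArg δ.base h1).trans rfl, (congrArg δ.rank h1).trans
    (congrArg Fin.val ((δ.forest e).contour.apply_symm_apply ⟨_, h⟩))⟩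

theorem glueNext_last {y : δ.OrientedEdge} (h : δ.rank y + 1 = δ.forestLen (δ.base y)) :
    δ.glueNext y = δ.start (S.next (δ.base y)) := by
  obtain ⟨e, y⟩ := y
  exact congrArg (Equiv.sigmaCongrRight fun e => (δ.forest e).contour).symm (dif_neg h.not_lt)

theorem glueNext_eq {y y' : δ.OrientedEdge} (h : δ.base y' = δ.base y)
    (h' : δ.rank y' = δ.rank y + 1) : δ.glueNext y = y' := by
  obtain ⟨h1, h2⟩ := δ.glueNext_of_lt (y := y) (by rw [← h', ← h]; exact δ.rank_lt y')
  exact δ.ext_rank (h1.trans h.symm) (h2.trans h'.symm)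

theorem base_rank_iterate (e : S.D) {j : ℕ} (h : j < δ.forestLen e) :
    δ.base (δ.glueNext^[j] (δ.start e)) = e ∧ δ.rank (δ.glueNext^[j] (δ.start e)) = j := by
  induction j with
  | zero => exact ⟨rfl, δ.rank_start e⟩
  | succ j ih =>
    rw [Function.iterate_succ_apply']
    obtain ⟨h1, h2⟩ := ih (by omega)
    obtain ⟨h3, h4⟩ := δ.glueNext_of_lt (y := δ.glueNext^[j] (δ.start e)) (by rw [h1, h2]; exact h)
    exact ⟨h3.trans h1, by rw [h4, h2]⟩

theorem iterate_rank (y : δ.OrientedEdge) : δ.glueNext^[δ.rank y] (δ.start (δ.base y)) = y := by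
  obtain ⟨h1, h2⟩ := δ.base_rank_iterate (δ.base y) (δ.rank_lt y)
  exact δ.ext_rank h1 h2

theorem iterate_forestLen (e : S.D) :
    δ.glueNext^[δ.forestLen e] (δ.start e) = δ.start (S.next e) := by
  have h := δ.forestLen_pos e
  obtain ⟨n, hn⟩ : ∃ n, δ.forestLen e = n + 1 := ⟨_, (Nat.sub_add_cancel h).symm⟩
  obtain ⟨h1, h2⟩ := δ.base_rank_iterate e (j := n) (by omega)
  rw [hn, Function.iterate_succ_apply', δ.glueNext_last (by rw [h1, h2, hn]), h1]

theorem exists_rank_eq_offset (e : S.D) (i : Fin (δ.r e)) : ∃ y,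
    δ.base y = e ∧ δ.rank y = δ.offset e i ∧ δ.label y = δ.M e i.castSucc := by
  rcases (δ.tree e i).exists_pos_zero with h | ⟨x, h, h'⟩
  · exact ⟨δ.floorDart e i, rfl, by rw [rank_floorDart, h]; rfl, rfl⟩
  · exact ⟨δ.treeDart e i x, rfl, by rw [rank_treeDart, h]; rfl, h' _⟩

theorem label_start (e : S.D) : δ.label (δ.start e) = δ.ℓ (S.tail e) := by
  obtain ⟨y, h0, h, h'⟩ := δ.exists_rank_eq_offset e ⟨0, δ.r_pos e⟩
  rw [← δ.M_zero, δ.ext_rank (y := δ.start e) (y' := y) h0.symm (by rw [h, rank_start]; rfl), h']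
  rfl

theorem M_last (e : S.D) : δ.M e (Fin.last _) = δ.ℓ (S.head e) := by
  rw [NamedMap.head, ← δ.M_zero]
  exact (δ.M_rev e (Fin.last _) 0 (by simp)).symm

theorem label_glueRev_floorDart (e : S.D) (i : Fin (δ.r e)) :
    δ.label (δ.glueRev (δ.floorDart e i)) = δ.M e i.succ := by
  refine δ.M_rev e i.succ (Fin.castSucc (Fin.cast (δ.r_rev e).symm (Fin.rev i))) ?_
  have := i.2
  rw [Fin.val_succ, Fin.val_castSucc, Fin.val_cast, Fin.val_rev]
  omega

/-- Since `rot (next y) = rev y`, this is the invariance of labels around vertices. From one forest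
to the next, it holds because both walks take the value of `ℓ` at the common vertex. -/
theorem label_glueNext (y : δ.OrientedEdge) :
    δ.label (δ.glueNext y) = δ.label (δ.glueRev y) := by
  rcases δ.exists_eq y with ⟨e, i, x, rfl⟩ | ⟨e, i, rfl⟩
  · rw [glueRev_treeDart, label_treeDart]
    rcases Grove.exists_pos_succ x with ⟨x', h, h'⟩ | ⟨h, h'⟩
    · rw [δ.glueNext_eq (y := δ.treeDart e i x) (y' := δ.treeDart e i x') rfl
        (by rw [rank_treeDart, rank_treeDart, h, add_assoc])]
      exact h' _
    · rw [δ.glueNext_eq (y := δ.treeDart e i x) (y' := δ.floorDart e i) rfl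
        (by rw [rank_treeDart, rank_floorDart, add_assoc, h])]
      exact (h' _).symm
  · rw [label_glueRev_floorDart]
    rcases Nat.lt_or_ge (i + 1) (δ.r e) with h | h
    · obtain ⟨y, hy0, hy, hy'⟩ := δ.exists_rank_eq_offset e ⟨i + 1, h⟩
      rw [δ.glueNext_eq (y := δ.floorDart e i) (y' := y) hy0 (by rw [rank_floorDart, hy, ← offset_succ])]
      exact hy'
    · have h1 : (i : ℕ) + 1 = δ.r e := by omega
      rw [δ.glueNext_last (by
        rw [rank_floorDart, ← offset_succ, h1, offset_r, base_floorDart]), label_start,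
        show i.succ = Fin.last _ from Fin.ext h1, M_last, NamedMap.tail_next, base_floorDart]

theorem abs_label_glueRev_sub_le (y : δ.OrientedEdge) :
    |δ.label (δ.glueRev y) - δ.label y| ≤ 1 := by
  rcases δ.exists_eq y with ⟨e, i, x, rfl⟩ | ⟨e, i, rfl⟩
  · exact ((δ.isLabeling e).2 i).abs_sub_le x
  · rw [label_glueRev_floorDart]
    exact (δ.isLabeling e).1 i

theorem sameCycle_start (y : δ.OrientedEdge) : δ.glueNext.SameCycle (δ.start (δ.base y)) y := by
  have h := δ.glueNext.sameCycle_iterate (δ.rank y) (δ.start (δ.base y))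
  rwa [iterate_rank] at h

theorem sameCycle_start_next (e : S.D) :
    δ.glueNext.SameCycle (δ.start e) (δ.start (S.next e)) := by
  have h := δ.glueNext.sameCycle_iterate (δ.forestLen e) (δ.start e)
  rwa [iterate_forestLen] at h

/-- Each forest is swept by `next`, and reversing a floor edge of `F_e` leads to the forest of `rev
e`, so the connectedness of the scheme carries over. -/
theorem glueMap_induction {A : δ.OrientedEdge → Prop} (hrev : ∀ y, A y → A (δ.glueRev y))
    (hnext : ∀ y, A y → A (δ.glueNext y)) {y₀ : δ.OrientedEdge} (h₀ : A y₀) (y : δ.OrientedEdge) :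
    A y := by
  have h1 : ∀ y, A y → A (δ.start (δ.base y)) := fun y =>
    Equiv.Perm.mem_of_sameCycle hnext (δ.sameCycle_start y).symm
  refine Equiv.Perm.mem_of_sameCycle hnext (δ.sameCycle_start y) <|
    S.isPlanarMap.isMap.induction (A := fun e => A (δ.start e)) (fun e he => ?_)
    (fun e => Equiv.Perm.mem_of_sameCycle hnext (δ.sameCycle_start_next e)) (h1 y₀ h₀) _
  exact h1 _ (hrev _ (Equiv.Perm.mem_of_sameCycle hnext
    (δ.sameCycle_start (δ.floorDart e ⟨0, δ.r_pos e⟩)) he))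

theorem sameCycle_glueNext_iff (y y' : δ.OrientedEdge) :
    δ.glueNext.SameCycle y y' ↔ S.next.SameCycle (δ.base y) (δ.base y') := by
  have hS := S.finite
  constructor
  · refine fun h => Equiv.Perm.mem_of_sameCycle
      (A := fun z => S.next.SameCycle (δ.base y) (δ.base z)) (fun z hz => ?_) h (.refl _ _)
    rcases Nat.lt_or_ge (δ.rank z + 1) (δ.forestLen (δ.base z)) with h | h
    · rw [(δ.glueNext_of_lt h).1]; exact hz
    · rw [δ.glueNext_last (le_antisymm (δ.rank_lt z) h), base_start]
      exact hz.trans (S.next.sameCycle_iterate 1 _)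
  · intro h
    refine ((δ.sameCycle_start y).symm.trans ?_).trans (δ.sameCycle_start y')
    exact Equiv.Perm.mem_of_sameCycle
      (A := fun e => δ.glueNext.SameCycle (δ.start (δ.base y)) (δ.start e))
      (fun e he => he.trans (δ.sameCycle_start_next e)) h (.refl _ _)

theorem glueMap_isMap : δ.glueMap.IsMap where
  rev_rev := δ.glueRevFun_glueRevFun
  rev_ne y (h : δ.glueRev y = y) := by
    rcases δ.exists_eq y with ⟨e, i, x, rfl⟩ | ⟨e, i, rfl⟩
    · rw [glueRev_treeDart] at h
      exact x.rev_ne (δ.treeDart_injective h)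
    · exact S.isPlanarMap.rev_ne e (congrArg δ.base h)
  connected y y' := δ.glueMap_induction (A := Relation.ReflTransGen
    (fun a b => b = δ.glueMap.rev a ∨ b = δ.glueMap.next a) y)
    (fun _ h => h.tail (Or.inl rfl)) (fun _ h => h.tail (Or.inr rfl)) .refl y'
  face_eq_iff y y' :=
    (S.isPlanarMap.face_eq_iff _ _).trans (δ.sameCycle_glueNext_iff y y').symm
  face_surjective i := by
    obtain ⟨e, he⟩ := S.isPlanarMap.face_surjective i
    exact ⟨δ.start e, he⟩

end SnakeData

/-! ### The core of a reconstructed map -/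

namespace NamedMap

variable {k : ℕ} {m : NamedMap k} {L : m.D → ℤ}

/-- Both contours are read by the same rule, and one that ends at a dart which is not `Up` cannot
stop first; the other is an initial segment of it. -/
theorem Fits.exists_of_fits {x c y : m.D} {t t' : Grove}
    (h : Fits m L x t c) (h' : Fits m L x t' y) (hy : ¬ m.Up L y) :
    ∃ s, Fits m L c s y ∧ s.len ≤ t'.len := by
  induction h generalizing t' with
  | nil d => exact ⟨t', h', le_rfl⟩
  | @cons d d' f g hf hg ihf ihg =>
    cases h' with
    | nil => exact absurd ⟨_, hf⟩ hy
    | cons hf' hg' =>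
      obtain ⟨s, hs, hs'⟩ := ihg hg'
      exact ⟨s, hs, hs'.trans (by rw [Grove.len_cons]; omega)⟩

theorem Fits.eq_or_exists {x y : m.D} {t : Grove} (h : Fits m L x t y) :
    x = y ∨ ∃ f, Fits m L (m.next x) f (m.rev x) ∧ f.len < t.len := by
  cases h with
  | nil => exact Or.inl rfl
  | cons hf _ => exact Or.inr ⟨_, hf, by rw [Grove.len_cons]; omega⟩

/-- A map whose core is a subdivision of the scheme, with labels and trees as in `δ`. -/
structure IsDecomp (hm : m.IsMap) (L : m.D → ℤ) {S : Scheme k} (δ : SnakeData S)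
    (ι : S.D → (core hm L).D) : Prop where
  sub : IsSubdivision S.toNamedMap (core hm L) δ.r ι
  label : ∀ e (i : Fin (δ.r e)), L ((core hm L).next^[i] (ι e)).1 = δ.M e i.castSucc
  tree : ∀ e (i : Fin (δ.r e)), core.tree ((core hm L).next^[i] (ι e)) = δ.tree e i

end NamedMap

namespace SnakeData

open NamedMap

variable {k : ℕ} {S : Scheme k} {δ : SnakeData S} {m : NamedMap k} {L : m.D → ℤ}

/-- `φ` identifies the reconstructed labeled map with `m`. -/
structure IsGlued (δ : SnakeData S) (m : NamedMap k) (L : m.D → ℤ) (φ : δ.OrientedEdge ≃ m.D) :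
    Prop where
  rev : ∀ y, φ (δ.glueRev y) = m.rev (φ y)
  next : ∀ y, φ (δ.glueNext y) = m.next (φ y)
  face : ∀ y, m.face (φ y) = S.face (δ.base y)
  label : ∀ y, L (φ y) = δ.label y

theorem isGlued_refl (δ : SnakeData S) : IsGlued δ δ.glueMap δ.label (Equiv.refl _) :=
  ⟨fun _ => rfl, fun _ => rfl, fun _ => rfl, fun _ => rfl⟩

namespace IsGlued

variable {φ : δ.OrientedEdge ≃ m.D}

theorem iterate (h : IsGlued δ m L φ) (n : ℕ) (y : δ.OrientedEdge) :
    φ (δ.glueNext^[n] y) = m.next^[n] (φ y) :=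
  Function.Semiconj.iterate_right (f := φ) (ga := δ.glueNext) (gb := m.next) h.next n y

theorem eq_iterate (h : IsGlued δ m L φ) (y : δ.OrientedEdge) :
    φ y = m.next^[δ.rank y] (φ (δ.start (δ.base y))) := by
  rw [← h.iterate, iterate_rank]

theorem fits (h : IsGlued δ m L φ) (e : S.D) (i : Fin (δ.r e)) :
    Fits m L (m.next^[δ.offset e i] (φ (δ.start e))) (δ.tree e i) (φ (δ.floorDart e i)) := by
  have h1 : φ (δ.floorDart e i) =
      m.next^[(δ.tree e i).len] (m.next^[δ.offset e i] (φ (δ.start e))) := by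
    rw [← Function.iterate_add_apply, h.eq_iterate, rank_floorDart, add_comm]
    rfl
  rw [h1]
  refine Fits.of_pos (δ.M e i.castSucc) (fun x => φ (δ.treeDart e i x)) (fun x => ?_) (fun x => ?_)
    (fun x => ?_)
  · rw [← Function.iterate_add_apply, h.eq_iterate, rank_treeDart, add_comm]
    rfl
  · rw [← h.rev]
    rfl
  · rw [h.label]
    rfl

theorem next_floorDart (h : IsGlued δ m L φ) (e : S.D) (i : Fin (δ.r e)) :
    m.next (φ (δ.floorDart e i)) = m.next^[δ.offset e (i + 1)] (φ (δ.start e)) := by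
  rw [← (h.fits e i).iterate_len, ← Function.iterate_add_apply,
    ← Function.iterate_succ_apply' m.next, offset_succ]
  congr 2
  omega

theorem fits_next_of_lt (h : IsGlued δ m L φ) (e : S.D) (i : Fin (δ.r e))
    (hi : (i : ℕ) + 1 < δ.r e) : Fits m L (m.next (φ (δ.floorDart e i))) (δ.tree e ⟨i + 1, hi⟩)
      (φ (δ.floorDart e ⟨i + 1, hi⟩)) := by
  rw [h.next_floorDart]
  exact h.fits e ⟨i + 1, hi⟩

theorem fits_next_last (h : IsGlued δ m L φ) (e : S.D) (i : Fin (δ.r e))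
    (hi : (i : ℕ) + 1 = δ.r e) : Fits m L (m.next (φ (δ.floorDart e i)))
      (δ.tree (S.next e) ⟨0, δ.r_pos _⟩) (φ (δ.floorDart (S.next e) ⟨0, δ.r_pos _⟩)) := by
  rw [h.next_floorDart, hi, offset_r, ← h.iterate, iterate_forestLen]
  exact h.fits (S.next e) ⟨0, δ.r_pos _⟩

/-- The next floor edge differs from the reversal of the current one: inside a chain because `rev e
≠ e`, at its end because the scheme has no vertex of degree `1`. -/
theorem exists_fits_next (h : IsGlued δ m L φ) (e : S.D) (i : Fin (δ.r e)) :
    ∃ e' i' t, Fits m L (m.next (φ (δ.floorDart e i))) t (φ (δ.floorDart e' i')) ∧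
      φ (δ.floorDart e' i') ≠ m.rev (φ (δ.floorDart e i)) := by
  rcases Nat.lt_or_ge (i + 1) (δ.r e) with hi | hi
  · refine ⟨_, _, _, h.fits_next_of_lt e i hi, fun h1 => ?_⟩
    rw [← h.rev, glueRev_floorDart] at h1
    exact S.isPlanarMap.rev_ne e (δ.floorDart_injective (φ.injective h1)).1.symm
  · refine ⟨_, _, _, h.fits_next_last e i (le_antisymm i.2 hi), fun h1 => ?_⟩
    rw [← h.rev, glueRev_floorDart] at h1
    have h2 : S.next e = S.rev e := (δ.floorDart_injective (φ.injective h1)).1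
    refine rot_ne_of_two_le_degree (S.two_le_degree (S.tail (S.next e))) ?_
    rw [rot_next, h2]

/-- Descent on the length of a supposed tree above a floor edge: past the grafted trees, its contour
meets another floor edge, which would carry a strictly shorter tree. -/
theorem not_up_floorDart (h : IsGlued δ m L φ) (hm : m.IsMap) (hk : 1 ≤ k) (e : S.D)
    (i : Fin (δ.r e)) : ¬ m.Up L (φ (δ.floorDart e i)) := by
  rintro ⟨t, ht⟩
  obtain ⟨n, hn⟩ : ∃ n, t.len = n := ⟨_, rfl⟩
  induction n using Nat.strong_induction_on generalizing e i t with
  | _ n ih =>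
    obtain ⟨e', i', t', ht', hne⟩ := h.exists_fits_next e i
    obtain ⟨s, hs, hs'⟩ := ht'.exists_of_fits ht (Up.not_up_rev hm hk ⟨t, ht⟩)
    rcases hs.eq_or_exists with h1 | ⟨f, hf, hlt⟩
    · exact hne h1
    · exact ih f.len (by omega) e' i' f hf rfl

theorem core_floorDart (h : IsGlued δ m L φ) (hm : m.IsMap) (hk : 1 ≤ k) (e : S.D)
    (i : Fin (δ.r e)) : m.Core L (φ (δ.floorDart e i)) := by
  refine ⟨h.not_up_floorDart hm hk e i, ?_⟩
  rw [← h.rev, glueRev_floorDart]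
  exact h.not_up_floorDart hm hk _ _

theorem exists_eq_of_core (h : IsGlued δ m L φ) (hm : m.IsMap) {c : m.D} (hc : m.Core L c) :
    ∃ e i, c = φ (δ.floorDart e i) := by
  obtain ⟨y, rfl⟩ := φ.surjective c
  rcases δ.exists_eq y with ⟨e, i, x, rfl⟩ | ⟨e, i, rfl⟩
  · exfalso
    have h1 := (h.fits e i).up_or_up_rev hm (Grove.pos_lt x)
    have h2 : m.next^[Grove.pos x] (m.next^[δ.offset e i] (φ (δ.start e))) =
        φ (δ.treeDart e i x) := by
      rw [← Function.iterate_add_apply, h.eq_iterate (δ.treeDart e i x), rank_treeDart, add_comm]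
      rfl
    rw [h2] at h1
    rcases h1 with h1 | h1
    · exact hc.1 h1
    · exact hc.2 h1
  · exact ⟨e, i, rfl⟩

/-- The floor edges, as darts of the core. -/
def floor (h : IsGlued δ m L φ) (hm : m.IsMap) (hk : 1 ≤ k) (e : S.D) (i : Fin (δ.r e)) :
    (core hm L).D := ⟨φ (δ.floorDart e i), h.core_floorDart hm hk e i⟩

theorem next_floor_of_lt (h : IsGlued δ m L φ) (hm : m.IsMap) (hk : 1 ≤ k) (e : S.D)
    (i : Fin (δ.r e)) (hi : (i : ℕ) + 1 < δ.r e) :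
    (core hm L).next (h.floor hm hk e i) = h.floor hm hk e ⟨i + 1, hi⟩ :=
  (core.next_eq_of_fits hk (c := h.floor hm hk e i) (c' := h.floor hm hk e ⟨i + 1, hi⟩)
    (h.fits_next_of_lt e i hi)).1

theorem next_floor_last (h : IsGlued δ m L φ) (hm : m.IsMap) (hk : 1 ≤ k) (e : S.D)
    (i : Fin (δ.r e)) (hi : (i : ℕ) + 1 = δ.r e) :
    (core hm L).next (h.floor hm hk e i) = h.floor hm hk (S.next e) ⟨0, δ.r_pos _⟩ :=
  (core.next_eq_of_fits hk (c := h.floor hm hk e i)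
    (c' := h.floor hm hk (S.next e) ⟨0, δ.r_pos _⟩) (h.fits_next_last e i hi)).1

theorem iterate_floor (h : IsGlued δ m L φ) (hm : m.IsMap) (hk : 1 ≤ k) (e : S.D)
    {i : ℕ} (hi : i < δ.r e) :
    (core hm L).next^[i] (h.floor hm hk e ⟨0, δ.r_pos e⟩) = h.floor hm hk e ⟨i, hi⟩ := by
  induction i with
  | zero => rfl
  | succ i ih =>
    rw [Function.iterate_succ_apply', ih (by omega)]
    exact h.next_floor_of_lt hm hk e ⟨i, by omega⟩ hi

theorem iterate_floor_r (h : IsGlued δ m L φ) (hm : m.IsMap) (hk : 1 ≤ k) (e : S.D) :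
    (core hm L).next^[δ.r e] (h.floor hm hk e ⟨0, δ.r_pos e⟩) =
      h.floor hm hk (S.next e) ⟨0, δ.r_pos _⟩ := by
  have h0 := δ.r_pos e
  obtain ⟨n, hn⟩ : ∃ n, δ.r e = n + 1 := ⟨_, (Nat.sub_add_cancel h0).symm⟩
  rw [show (core hm L).next^[δ.r e] = (core hm L).next^[n + 1] by rw [hn],
    Function.iterate_succ_apply', h.iterate_floor hm hk e (by omega)]
  exact h.next_floor_last hm hk e ⟨n, by omega⟩ hn.symm

theorem isDecomp (h : IsGlued δ m L φ) (hm : m.IsMap) (hk : 1 ≤ k) :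
    IsDecomp hm L δ fun e => h.floor hm hk e ⟨0, δ.r_pos e⟩ where
  sub :=
    { r_pos := δ.r_pos
      r_rev := δ.r_rev
      next_r := h.iterate_floor_r hm hk
      rev_next := fun e i hi => by
        rw [h.iterate_floor hm hk e hi, h.iterate_floor hm hk (S.rev e)
          (by rw [δ.r_rev]; omega)]
        refine Subtype.ext ?_
        change m.rev (φ _) = φ _
        rw [← h.rev, glueRev_floorDart]
        congr 2
        refine Fin.ext ?_
        simp only [Fin.val_cast, Fin.val_rev]
        omega
      exists_eq := fun c => by
        obtain ⟨e, i, hc⟩ := h.exists_eq_of_core hm c.2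
        refine ⟨e, i, i.2, ?_⟩
        rw [h.iterate_floor hm hk e i.2]
        exact Subtype.ext hc.symm
      inj := fun e e' i i' hi hi' h1 => by
        rw [h.iterate_floor hm hk e hi, h.iterate_floor hm hk e' hi'] at h1
        exact δ.floorDart_injective (φ.injective (congrArg Subtype.val h1))
      face := fun e => h.face _ }
  label e i := by
    rw [h.iterate_floor hm hk e i.2]
    exact h.label _
  tree e i := by
    rw [h.iterate_floor hm hk e i.2]
    -- The first tree of `F_e` follows the last floor edge of the preceding forest along the face;
    -- the other trees follow a floor edge of `F_e` itself.
    rcases Nat.eq_zero_or_pos i with hi | hi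
    · obtain ⟨e', rfl⟩ := S.next.surjective e
      have h0 := δ.r_pos e'
      have := (core.next_eq_of_fits hk (c := h.floor hm hk e' ⟨δ.r e' - 1, by omega⟩)
        (c' := h.floor hm hk (S.next e') ⟨0, δ.r_pos _⟩)
        (h.fits_next_last e' _ (by simp only; omega))).2
      rwa [show i = ⟨0, δ.r_pos _⟩ from Fin.ext hi]
    · have h1 := i.2
      have h2 : (⟨i - 1 + 1, by omega⟩ : Fin (δ.r e)) = i := Fin.ext (by simp only; omega)
      have := (core.next_eq_of_fits hk (c := h.floor hm hk e ⟨i - 1, by omega⟩)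
        (c' := h.floor hm hk e ⟨i - 1 + 1, by omega⟩)
        (h.fits_next_of_lt e ⟨i - 1, by omega⟩ (by simp only; omega))).2
      rw [h2] at this
      exact this

end IsGlued

end SnakeData

/-! ### Labels and Euler's formula of a decomposed map. -/

namespace NamedMap

variable {k : ℕ} {m : NamedMap k} {L : m.D → ℤ}

theorem label_eq_of_tail_eq (hL : ∀ d, L (m.next d) = L (m.rev d)) {d d' : m.D}
    (h : m.tail d = m.tail d') : L d = L d' := by
  refine Equiv.Perm.mem_of_sameCycle (A := fun d' => L d = L d') (fun x hx => ?_)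
    (tail_eq_iff.1 h) rfl
  obtain ⟨y, rfl⟩ := m.next.surjective x
  rw [hx, rot_next, hL]

theorem core.label_eq {hm : m.IsMap} (hk : 1 ≤ k) (hL : ∀ d, L (m.next d) = L (m.rev d))
    {c c' : (core hm L).D} (h : (core hm L).tail c = (core hm L).tail c') : L c.1 = L c'.1 :=
  label_eq_of_tail_eq hL ((core.tail_eq_iff hk).1 h)

theorem core.label_next {hm : m.IsMap} (hk : 1 ≤ k) (hL : ∀ d, L (m.next d) = L (m.rev d))
    (c : (core hm L).D) : L ((core hm L).next c).1 = L ((core hm L).rev c).1 :=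
  core.label_eq hk hL (tail_next c)

namespace IsDecomp

variable {hm : m.IsMap} {S : Scheme k} {δ : SnakeData S} {ι : S.D → (core hm L).D}

theorem label_zero (h : IsDecomp hm L δ ι) (e : S.D) : L (ι e).1 = δ.ℓ (S.tail e) := by
  rw [← δ.M_zero]
  exact h.label e ⟨0, δ.r_pos e⟩

theorem label_le (h : IsDecomp hm L δ ι) (e : S.D) (i : Fin (δ.r e + 1)) :
    L ((core hm L).next^[i] (ι e)).1 = δ.M e i := by
  rcases Nat.lt_or_ge i (δ.r e) with hi | hi
  · exact h.label e ⟨i, hi⟩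
  · obtain rfl : i = Fin.last _ := Fin.ext (by have := i.2; rw [Fin.val_last]; omega)
    rw [δ.M_last, Fin.val_last, h.sub.next_r, h.label_zero, tail_next]

/-- A vertex incident to two faces is in the core. It is a vertex of the scheme, with label `0` or
in `V_I`, or it is interior to an edge of `E_N ∪ E_I`, where walks are nonnegative. -/
theorem label_nonneg (h : IsDecomp hm L δ ι) (hk : 1 ≤ k)
    (hL : ∀ d, L (m.next d) = L (m.rev d)) {i : Fin (k + 1)} (hi : i ≠ 0) {d : m.D}
    (h0 : m.Incident (m.tail d) 0) (h1 : m.Incident (m.tail d) i) : 0 ≤ L d := by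
  have hC := core.isMap hm L hk
  obtain ⟨c, hc, hcd⟩ := exists_core_of_incident hm hk L h0 h1 hi.symm
  rw [← label_eq_of_tail_eq hL hcd]
  rw [← hcd] at h0 h1
  have h0' := (core.incident_iff (hm := hm) (L := L) hk (c := ⟨c, hc⟩)).2 h0
  have h1' := (core.incident_iff (hm := hm) (L := L) hk (c := ⟨c, hc⟩)).2 h1
  obtain ⟨e, j, hj, he⟩ := h.sub.exists_eq ⟨c, hc⟩
  have hlab := h.label e ⟨j, hj⟩
  rw [← he] at h0' h1'
  rw [show ((core hm L).next^[((⟨j, hj⟩ : Fin (δ.r e)) : ℕ)] (ι e)).1 = c from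
    congrArg Subtype.val he] at hlab
  rw [hlab]
  rcases Nat.eq_zero_or_pos j with rfl | hpos
  · rw [Function.iterate_zero_apply, h.sub.incident_iff hC] at h0' h1'
    change 0 ≤ δ.M e 0
    rw [δ.M_zero]
    by_cases hn : S.tail e ∈ S.null
    · rw [δ.ℓ_null _ hn]
    · exact (δ.ℓ_pos _ ⟨⟨h0', i, hi, h1'⟩, hn⟩).le
  · rw [h.sub.incident_interior_iff hC e hpos hj] at h0' h1'
    have hint : S.IsInterfaceEdge e := by
      rcases h0' with h0' | h0' <;> rcases h1' with h1' | h1'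
      · exact absurd (h1'.symm.trans h0') hi
      · exact Or.inl ⟨h0', h1' ▸ hi⟩
      · exact Or.inr ⟨h1' ▸ hi, h0'⟩
      · exact absurd (h1'.symm.trans h0') hi
    refine δ.M_nonneg e ?_ _
    by_cases hEN : e ∈ S.EN
    · exact Or.inl hEN
    · exact Or.inr ⟨hint, hEN⟩

theorem exists_label_zero (h : IsDecomp hm L δ ι) (hk : 1 ≤ k) {i : Fin (k + 1)} (hi : i ≠ 0) :
    ∃ d, m.Incident (m.tail d) 0 ∧ m.Incident (m.tail d) i ∧ L d = 0 := by
  have hC := core.isMap hm L hk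
  obtain ⟨v, hv, hvi⟩ := S.exists_null i hi
  have hv0 := (S.null_interface v hv).1
  obtain ⟨e, rfl⟩ := exists_tail_eq v
  refine ⟨(ι e).1, (core.incident_iff hk).1 ((h.sub.incident_iff hC).2 hv0),
    (core.incident_iff hk).1 ((h.sub.incident_iff hC).2 hvi), ?_⟩
  rw [h.label_zero, δ.ℓ_null _ hv]

theorem euler (h : IsDecomp hm L δ ι) (hk : 1 ≤ k) : m.Euler :=
  (core.euler_iff hm L hk).1 ((h.sub.euler_iff (core.isMap hm L hk) core.rot_ne).2
    S.isPlanarMap.euler)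

end IsDecomp

end NamedMap

/-- The reconstruction yields a labeled map of the required type. -/
theorem SnakeData.isLM_glue {k : ℕ} (hk : 1 ≤ k) {S : Scheme k} (δ : SnakeData S)
    (x : δ.OrientedEdge) : (δ.glue x).IsLM := by
  have h := δ.isGlued_refl.isDecomp δ.glueMap_isMap hk
  exact
    { isPlanarMap := δ.glueMap_isMap.isPlanarMap (h.euler hk)
      label_eq := fun d d' => NamedMap.label_eq_of_tail_eq (m := δ.glueMap) δ.label_glueNext
      label_adj := δ.abs_label_glueRev_sub_le
      label_nonneg := fun i hi d => h.label_nonneg hk δ.label_glueNext hi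
      exists_label_zero := fun i hi => h.exists_label_zero hk hi }

/-! ### Gluing the forests along the core -/

namespace NamedMap

variable {k : ℕ} {m : NamedMap k} {L : m.D → ℤ}

/-- The beginning of the contour of the trees grafted before a core dart. -/
noncomputable def core.arc {hm : m.IsMap} (c : (core hm L).D) : m.D :=
  m.next ((core hm L).next.symm c).1

theorem core.arc_next {hm : m.IsMap} (c : (core hm L).D) :
    core.arc ((core hm L).next c) = m.next c.1 := by
  rw [arc, Equiv.symm_apply_apply]

theorem core.fits_arc {hm : m.IsMap} (c : (core hm L).D) :
    Fits m L (core.arc c) (core.tree c) c.1 := core.fits_tree c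

namespace IsDecomp

variable {hm : m.IsMap} {S : Scheme k} {δ : SnakeData S} {ι : S.D → (core hm L).D}

theorem iterate_offset (h : IsDecomp hm L δ ι) (e : S.D) {i : ℕ} (hi : i ≤ δ.r e) :
    m.next^[δ.offset e i] (core.arc (ι e)) = core.arc ((core hm L).next^[i] (ι e)) := by
  induction i with
  | zero => rfl
  | succ i ih =>
    have h1 := (core.fits_arc ((core hm L).next^[i] (ι e))).iterate_len
    rw [h.tree e ⟨i, hi⟩] at h1
    have h2 := δ.offset_succ e ⟨i, hi⟩
    rw [show δ.offset e (i + 1) = (δ.tree e ⟨i, hi⟩).len + δ.offset e i + 1 by rw [h2]; ring,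
      Function.iterate_succ_apply', Function.iterate_add_apply, ih (by omega), h1,
      Function.iterate_succ_apply' (core hm L).next, core.arc_next]

/-- The identification of the reconstructed map with a decomposed one. -/
noncomputable def toMap (_ : IsDecomp hm L δ ι) (y : δ.OrientedEdge) : m.D :=
  m.next^[δ.rank y] (core.arc (ι (δ.base y)))

theorem toMap_floorDart (h : IsDecomp hm L δ ι) (e : S.D) (i : Fin (δ.r e)) :
    h.toMap (δ.floorDart e i) = ((core hm L).next^[i] (ι e)).1 := by
  rw [toMap, SnakeData.rank_floorDart, SnakeData.base_floorDart, add_comm,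
    Function.iterate_add_apply, h.iterate_offset e i.2.le, ← h.tree]
  exact (core.fits_arc _).iterate_len

theorem toMap_treeDart (h : IsDecomp hm L δ ι) (e : S.D) (i : Fin (δ.r e))
    (x : (δ.tree e i).Dart) : h.toMap (δ.treeDart e i x) =
      m.next^[Grove.pos x] (core.arc ((core hm L).next^[i] (ι e))) := by
  rw [toMap, SnakeData.rank_treeDart, SnakeData.base_treeDart, add_comm,
    Function.iterate_add_apply, h.iterate_offset e i.2.le]

theorem toMap_glueNext (h : IsDecomp hm L δ ι) (y : δ.OrientedEdge) :
    h.toMap (δ.glueNext y) = m.next (h.toMap y) := by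
  rw [toMap, toMap, ← Function.iterate_succ_apply' m.next]
  rcases Nat.lt_or_ge (δ.rank y + 1) (δ.forestLen (δ.base y)) with h1 | h1
  · rw [(δ.glueNext_of_lt h1).1, (δ.glueNext_of_lt h1).2]
  · have h2 : δ.rank y + 1 = δ.forestLen (δ.base y) := le_antisymm (δ.rank_lt y) h1
    rw [δ.glueNext_last h2, SnakeData.rank_start, SnakeData.base_start, Nat.succ_eq_add_one, h2,
      ← SnakeData.offset_r, h.iterate_offset _ le_rfl, h.sub.next_r]
    rfl

theorem fits (h : IsDecomp hm L δ ι) (e : S.D) (i : Fin (δ.r e)) :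
    Fits m L (core.arc ((core hm L).next^[i] (ι e))) (δ.tree e i)
      ((core hm L).next^[i] (ι e)).1 := by
  rw [← h.tree]
  exact core.fits_arc _

theorem toMap_glueRev (h : IsDecomp hm L δ ι) (y : δ.OrientedEdge) :
    h.toMap (δ.glueRev y) = m.rev (h.toMap y) := by
  rcases δ.exists_eq y with ⟨e, i, x, rfl⟩ | ⟨e, i, rfl⟩
  · rw [SnakeData.glueRev_treeDart, toMap_treeDart, toMap_treeDart]
    exact (h.fits e i).iterate_pos_rev hm x
  · rw [SnakeData.glueRev_floorDart, toMap_floorDart, toMap_floorDart, ← core.rev_coe,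
      h.sub.rev_next e i i.2]
    congr 3
    simp only [Fin.val_cast, Fin.val_rev]
    omega

theorem face_toMap (h : IsDecomp hm L δ ι) (y : δ.OrientedEdge) :
    m.face (h.toMap y) = S.face (δ.base y) := by
  rw [toMap, hm.face_iterate, ← (core.fits_arc _).face_eq hm, ← core.face_coe, h.sub.face]

theorem label_toMap (h : IsDecomp hm L δ ι) (hL : ∀ d, L (m.next d) = L (m.rev d))
    (y : δ.OrientedEdge) : L (h.toMap y) = δ.label y := by
  rcases δ.exists_eq y with ⟨e, i, x, rfl⟩ | ⟨e, i, rfl⟩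
  · rw [toMap_treeDart, (h.fits e i).label_pos hm hL, ← (h.fits e i).label_eq hm hL, h.label]
    rfl
  · rw [toMap_floorDart, h.label]
    rfl

/-- Having a single preimage is a property stable under `rev` and `next`, so one point suffices for
injectivity. A floor edge works: its image is in the core, unlike the images of tree edges.
Surjectivity is connectedness of `m`. -/
theorem toMap_bijective (h : IsDecomp hm L δ ι) : Function.Bijective h.toMap := by
  obtain ⟨e₀, -⟩ := S.isPlanarMap.face_surjective 0
  let y₀ := δ.floorDart e₀ ⟨0, δ.r_pos e₀⟩
  constructor
  · have h0 : ∀ y', h.toMap y' = h.toMap y₀ → y' = y₀ := by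
      intro y' hy
      have h1 : h.toMap y₀ = (ι e₀).1 := h.toMap_floorDart _ _
      rw [h1] at hy
      rcases δ.exists_eq y' with ⟨e, i, x, rfl⟩ | ⟨e, i, rfl⟩
      · rw [toMap_treeDart] at hy
        refine absurd (ι e₀).2 ?_
        rw [← hy]
        refine core.iterate_lt_not_core _ ?_
        rw [h.tree]
        exact Grove.pos_lt x
      · rw [toMap_floorDart] at hy
        obtain ⟨rfl, hi⟩ := h.sub.inj e e₀ i 0 i.2 (δ.r_pos _) (Subtype.ext hy)
        rw [show i = ⟨0, δ.r_pos _⟩ from Fin.ext hi]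
    have h1 := δ.glueMap_induction (A := fun y => ∀ y', h.toMap y' = h.toMap y → y' = y)
      (fun y hy y' h1 => ?_) (fun y hy y' h1 => ?_) h0
    · exact fun y' y hy => h1 y y' hy
    · rw [← hy (δ.glueRev y') (by rw [toMap_glueRev, h1, toMap_glueRev, hm.rev_rev])]
      exact (δ.glueRevFun_glueRevFun y').symm
    · have h2 := hy (δ.glueNext.symm y') (m.next.injective (by
        rw [← toMap_glueNext, ← toMap_glueNext, Equiv.apply_symm_apply, h1]))
      rw [← h2, Equiv.apply_symm_apply]
  · intro d
    refine hm.induction (A := fun d => ∃ y, h.toMap y = d) ?_ ?_ ⟨y₀, rfl⟩ d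
    · rintro _ ⟨y, rfl⟩
      exact ⟨_, h.toMap_glueRev y⟩
    · rintro _ ⟨y, rfl⟩
      exact ⟨_, h.toMap_glueNext y⟩

theorem exists_isGlued (h : IsDecomp hm L δ ι) (hL : ∀ d, L (m.next d) = L (m.rev d)) :
    ∃ φ, SnakeData.IsGlued δ m L φ :=
  ⟨Equiv.ofBijective h.toMap h.toMap_bijective, h.toMap_glueRev, h.toMap_glueNext, h.face_toMap,
    h.label_toMap hL⟩

end IsDecomp

end NamedMap

/-! ### The darts of the scheme inside the core -/

namespace NamedMap

variable {k : ℕ}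

/-- The origin of `c` has degree at least `3` (in a map without vertices of degree `1`). -/
def Branch (C : NamedMap k) (c : C.D) : Prop := C.rot (C.rot c) ≠ c

/-- The origin of `c`, of degree `2`, is chosen as a null-vertex, and `f₀` is on the left of `c`: it
is the last vertex with label `0` before the next branching point, and neither this branching
point nor the previous one has label `0`. -/
structure Chosen (C : NamedMap k) (L : C.D → ℤ) (c : C.D) : Prop where
  face : C.face c = 0
  face_rev : C.face (C.rev c) ≠ 0
  not_branch : ¬ C.Branch c
  label : L c = 0
  ahead : ∀ n, 0 < n → (∀ i, 0 < i → i < n → ¬ C.Branch (C.next^[i] c)) → L (C.next^[n] c) ≠ 0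
  behind : ∀ n, 0 < n → (∀ i, 0 < i → i < n → ¬ C.Branch (C.next^[i] (C.rot c))) →
    C.Branch (C.next^[n] (C.rot c)) → L (C.next^[n] (C.rot c)) ≠ 0

/-- The origin of `c` is a vertex of the scheme. -/
def Marked (C : NamedMap k) (L : C.D → ℤ) (c : C.D) : Prop :=
  C.Branch c ∨ C.Chosen L c ∨ C.Chosen L (C.rot c)

end NamedMap

namespace Scheme

open NamedMap

variable {k : ℕ} {S : Scheme k}

theorem isMap (S : Scheme k) : S.toNamedMap.IsMap := S.isPlanarMap.isMap

theorem rot_rot_of_degree_lt {e : S.D} (h : ¬ 3 ≤ S.degree (S.tail e)) : S.rot (S.rot e) = e := by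
  rwa [three_le_degree_iff, not_not] at h

theorem mem_null_of_degree_lt {e : S.D} (h : ¬ 3 ≤ S.degree (S.tail e)) : S.tail e ∈ S.null :=
  S.degree_two_null _ (by have := S.two_le_degree (S.tail e); omega)

/-- Around a vertex of degree `2`. -/
theorem next_rev_eq_rot {e : S.D} (h : S.rot (S.rot e) = e) : S.next (S.rev e) = S.rot e := by
  rw [S.isMap.next_rev, Equiv.symm_apply_eq, h]

theorem face_rev_eq_face_rot {e : S.D} (h : S.rot (S.rot e) = e) :
    S.face (S.rev e) = S.face (S.rot e) := by
  rw [← next_rev_eq_rot h, S.isMap.face_next]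

theorem face_rev_ne_zero {e : S.D} (h : S.rot (S.rot e) = e) (hi : S.IsInterfaceVertex (S.tail e))
    (h0 : S.face e = 0) : S.face (S.rev e) ≠ 0 := by
  obtain ⟨-, i, hi, d, hd, rfl⟩ := hi
  rcases (tail_eq_iff_of_rot_rot h d).1 hd with rfl | rfl
  · exact absurd h0 hi
  · rwa [face_rev_eq_face_rot h]

/-- There is no loop at a vertex of degree `2`. -/
theorem tail_ne_head (hk : 2 ≤ k) {e : S.D} (h : S.rot (S.rot e) = e) : S.tail e ≠ S.head e := by
  intro he
  have hS := S.isMap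
  have h1 : S.rev e = S.rot e := by
    rcases (tail_eq_iff_of_rot_rot h (S.rev e)).1 he.symm with h1 | h1
    · exact absurd h1 (hS.rev_ne e)
    · exact h1
  have h2 : S.next (S.rev e) = S.rev e := by rw [next_rev_eq_rot h, h1]
  have h3 : S.next e = e := by
    have : S.rot (S.next e) = S.rot e := by rw [rot_next, h1]
    exact S.rot.injective this
  -- Both darts of the loop are fixed by `next`, so they form the whole map, which has too few
  -- faces.
  obtain ⟨d, hd, hd'⟩ := hS.exists_face_ne hk (S.face e) (S.face (S.rev e))
  have := hS.induction (A := fun d => d = e ∨ d = S.rev e) (d := e) (by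
    rintro _ (rfl | rfl)
    · exact Or.inr rfl
    · exact Or.inl (hS.rev_rev e)) (by
    rintro _ (rfl | rfl)
    · exact Or.inl h3
    · exact Or.inr h2) (Or.inl rfl) d
  rcases this with rfl | rfl
  · exact hd rfl
  · exact hd' rfl

theorem head_not_mem_null (hk : 2 ≤ k) {e : S.D} (h : ¬ 3 ≤ S.degree (S.tail e)) :
    S.head e ∉ S.null :=
  S.degree_two_not_adj_null e (tail_ne_head hk (rot_rot_of_degree_lt h))
    (by have := S.two_le_degree (S.tail e); omega)

theorem three_le_degree_head (hk : 2 ≤ k) {e : S.D} (h : ¬ 3 ≤ S.degree (S.tail e)) :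
    3 ≤ S.degree (S.head e) := by
  by_contra h1
  exact head_not_mem_null hk h (mem_null_of_degree_lt (e := S.rev e) h1)

theorem isInterfaceVertex_head {e : S.D} (h : S.IsInterfaceEdge e) :
    S.IsInterfaceVertex (S.head e) := by
  have h1 : S.Incident (S.head e) (S.face e) := ⟨S.next e, tail_next e, S.isMap.face_next e⟩
  have h2 : S.Incident (S.head e) (S.face (S.rev e)) := ⟨S.rev e, rfl, rfl⟩
  rcases h with ⟨h3, h4⟩ | ⟨h3, h4⟩
  · exact ⟨h3 ▸ h1, _, h4, h2⟩
  · exact ⟨h4 ▸ h2, _, h3, h1⟩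

theorem isInterfaceEdge_rev {e : S.D} (h : S.IsInterfaceEdge e) : S.IsInterfaceEdge (S.rev e) := by
  unfold NamedMap.IsInterfaceEdge at h ⊢
  rw [S.isMap.rev_rev]
  tauto

/-- The edge that leaves a null-vertex of degree `2` with `f₀` on its left is not thin. -/
theorem rev_not_mem_thin {e : S.D} (h : ¬ 3 ≤ S.degree (S.tail e))
    (hh : S.head e ∉ S.null) (hf : S.face (S.rev e) ≠ 0) : S.rev e ∉ S.Thin := by
  have h1 : S.head (S.rev e) = S.tail e := S.isMap.head_rev e
  rintro (h2 | h2 | ⟨-, h2 | h2⟩)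
  · exact hf h2.2.2
  · rw [PointsThin, S.isMap.rev_rev] at h2
    exact hh h2.1
  · exact hh h2.1
  · rw [h1] at h2
    exact h h2.2

theorem rev_mem_EN {e : S.D} (hi : S.IsInterfaceEdge e) (hn : S.tail e ∈ S.null) :
    S.rev e ∈ S.EN :=
  ⟨isInterfaceEdge_rev hi, Or.inr (by rwa [S.isMap.head_rev])⟩

end Scheme

/-! ### The scheme is determined by the core and its labels. -/

namespace NamedMap

namespace IsDecomp

variable {k : ℕ} {m : NamedMap k} {L : m.D → ℤ} {hm : m.IsMap} {S : Scheme k} {δ : SnakeData S}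
  {ι : S.D → (core hm L).D}

theorem branch_iff (h : IsDecomp hm L δ ι) (hk : 1 ≤ k) (e : S.D) :
    (core hm L).Branch (ι e) ↔ 3 ≤ S.degree (S.tail e) := by
  have hC := core.isMap hm L hk
  rw [three_le_degree_iff, Branch, h.sub.rot hC, h.sub.rot hC, h.sub.injective.ne_iff]

theorem not_branch_interior (h : IsDecomp hm L δ ι) (hk : 1 ≤ k) (e : S.D) {i : ℕ} (h0 : 0 < i)
    (hi : i < δ.r e) : ¬ (core hm L).Branch ((core hm L).next^[i] (ι e)) :=
  not_not.2 (h.sub.rot_rot_interior (core.isMap hm L hk) e h0 hi)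

/-- Along the edge that leaves a null-vertex of degree `2` with `f₀` on its left, labels are
positive. -/
theorem label_ahead_pos (h : IsDecomp hm L δ ι) {e : S.D}
    (hdeg : ¬ 3 ≤ S.degree (S.tail e)) (hh : S.head e ∉ S.null) (hi : S.IsInterfaceEdge e)
    (hf : S.face (S.rev e) ≠ 0) {n : ℕ} (hn : 0 < n) (hn' : n ≤ δ.r e) :
    0 < L ((core hm L).next^[n] (ι e)).1 := by
  have h1 := δ.r_rev e
  have h2 := h.label_le e ⟨n, by omega⟩
  rw [show ((⟨n, by omega⟩ : Fin (δ.r e + 1)) : ℕ) = n from rfl] at h2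
  -- The walk is read backwards, along `rev e`, a non-thin edge of `E_N` oriented towards its
  -- null-vertex; its only zero is its last value, which corresponds to `n = 0`.
  rw [h2, ← δ.M_rev e ⟨n, by omega⟩ ⟨δ.r e - n, by omega⟩ (by simp only; omega)]
  refine δ.M_pos_EN _ (Scheme.rev_mem_EN hi (Scheme.mem_null_of_degree_lt hdeg))
    (Scheme.rev_not_mem_thin hdeg hh hf) ?_ _ ?_
  · rw [S.isMap.head_rev]
    exact Scheme.mem_null_of_degree_lt hdeg
  · intro h3
    have := congrArg Fin.val h3
    rw [Fin.val_last] at this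
    simp only at this
    omega

/-- A chosen dart inside a chain is excluded in all cases: a null endpoint contradicts `ahead`, a
null origin of degree at least `3` contradicts `behind`, and otherwise admissibility makes the walk
positive inside the chain. -/
theorem eq_zero_of_chosen (h : IsDecomp hm L δ ι) (hk : 1 ≤ k) {e : S.D} {i : ℕ} (hi : i < δ.r e)
    (hc : (core hm L).Chosen (fun c => L c.1) ((core hm L).next^[i] (ι e))) : i = 0 := by
  have hC := core.isMap hm L hk
  by_contra hne
  have h0 : 0 < i := Nat.pos_of_ne_zero hne
  have hf : S.face e = 0 := by rw [← h.sub.face_iterate hC e i, hc.face]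
  have hf' : S.face (S.rev e) ≠ 0 := by
    rw [← h.sub.face_rev_iterate hC e hi]; exact hc.face_rev
  have hint : S.IsInterfaceEdge e := Or.inl ⟨hf, hf'⟩
  have hM : δ.M e ⟨i, by omega⟩ = 0 := by
    rw [← h.label_le e ⟨i, by omega⟩]; exact hc.label
  have hhead : S.head e ∉ S.null := by
    intro hn
    have h1 := hc.ahead (δ.r e - i) (by omega) (fun j hj hj' => by
      rw [← Function.iterate_add_apply]
      exact h.not_branch_interior hk e (by omega) (by omega))
    rw [← Function.iterate_add_apply, Nat.sub_add_cancel hi.le, h.sub.next_r] at h1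
    exact h1 (by rw [h.label_zero, tail_next, δ.ℓ_null _ hn])
  by_cases htail : S.tail e ∈ S.null
  · have hdeg : ¬ 3 ≤ S.degree (S.tail e) := by
      intro hdeg
      have h1 := hc.behind
      rw [h.sub.rot_interior hC e h0 hi] at h1
      have h2 : (core hm L).next^[i] ((core hm L).next^[δ.r e - i] (ι (S.rev e))) =
          ι (S.rot.symm e) := by
        rw [← Function.iterate_add_apply, Nat.add_sub_cancel' hi.le, ← δ.r_rev, h.sub.next_r,
          S.isMap.next_rev]
      have h3 : S.tail (S.rot.symm e) = S.tail e := tail_iterate_rot_symm 1 e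
      refine h1 i h0 (fun j hj hj' => ?_) ?_ ?_
      · rw [← Function.iterate_add_apply]
        exact h.not_branch_interior hk _ (by omega) (by rw [δ.r_rev]; omega)
      · rw [h2, h.branch_iff hk, h3]
        exact hdeg
      · rw [h2]
        rw [h.label_zero, h3, δ.ℓ_null _ htail]
    have h1 := h.label_ahead_pos hdeg hhead hint hf' h0 hi.le
    have h2 : L ((core hm L).next^[i] (ι e)).1 = 0 := hc.label
    omega
  · have h1 := δ.M_pos_EI e ⟨hint, fun h2 => h2.2.elim htail hhead⟩ ⟨i, by omega⟩
    omega

/-- Ahead of the null-vertex the labels are positive by admissibility. Both its neighbors in the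
scheme are branching points that are not null, so their labels are nonzero. -/
theorem chosen_of_degree_two (h : IsDecomp hm L δ ι) (hk : 2 ≤ k) {e : S.D}
    (hdeg : ¬ 3 ≤ S.degree (S.tail e)) (hf : S.face e = 0) :
    (core hm L).Chosen (fun c => L c.1) (ι e) := by
  have hC := core.isMap hm L (by omega)
  have hrr := Scheme.rot_rot_of_degree_lt hdeg
  have hn := Scheme.mem_null_of_degree_lt hdeg
  have hhead := Scheme.head_not_mem_null hk hdeg
  have hf' := Scheme.face_rev_ne_zero hrr (S.null_interface _ hn) hf
  have hint : S.IsInterfaceEdge e := Or.inl ⟨hf, hf'⟩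
  have hbr : ∀ e : S.D, ¬ 3 ≤ S.degree (S.tail e) →
      (core hm L).Branch ((core hm L).next^[δ.r e] (ι e)) := fun e he => by
    rw [h.sub.next_r, h.branch_iff (by omega), tail_next]
    exact Scheme.three_le_degree_head hk he
  refine ⟨by rw [h.sub.face, hf], ?_, ?_, ?_, fun n hn0 hnb => ?_, fun n hn0 hnb hb => ?_⟩
  · have := h.sub.face_rev_iterate hC e (δ.r_pos e)
    rw [Function.iterate_zero_apply] at this
    rwa [this]
  · rwa [h.branch_iff (by omega)]
  · rw [h.label_zero, δ.ℓ_null _ hn]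
  · have hle : n ≤ δ.r e := by
      by_contra! hlt
      exact hnb _ (δ.r_pos e) hlt (hbr e hdeg)
    exact (h.label_ahead_pos hdeg hhead hint hf' hn0 hle).ne'
  · rw [h.sub.rot hC] at hnb hb ⊢
    have hdeg' : ¬ 3 ≤ S.degree (S.tail (S.rot e)) := by rwa [tail_rot]
    have hrr' := Scheme.rot_rot_of_degree_lt hdeg'
    have hhead' := Scheme.head_not_mem_null hk hdeg'
    have hle : n = δ.r (S.rot e) := by
      rcases lt_trichotomy n (δ.r (S.rot e)) with hlt | heq | hlt
      · exact absurd hb (h.not_branch_interior (by omega) _ hn0 hlt)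
      · exact heq
      · exact absurd (hbr _ hdeg') (hnb _ (δ.r_pos _) hlt)
    rw [hle, h.sub.next_r]
    change L (ι (S.next (S.rot e))).1 ≠ 0
    rw [h.label_zero, tail_next]
    refine (δ.ℓ_pos _ ⟨Scheme.isInterfaceVertex_head (Or.inr ⟨?_, ?_⟩), hhead'⟩).ne'
    · rwa [← Scheme.face_rev_eq_face_rot hrr]
    · rw [Scheme.face_rev_eq_face_rot hrr', hrr, hf]

/-- The darts of the scheme are recognized from the core and its labels alone; uniqueness of the
scheme rests on this. -/
theorem marked_iff (h : IsDecomp hm L δ ι) (hk : 2 ≤ k) (c : (core hm L).D) :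
    (core hm L).Marked (fun c => L c.1) c ↔ ∃ e, ι e = c := by
  have hC := core.isMap hm L (by omega)
  have hch : ∀ c, (core hm L).Chosen (fun c => L c.1) c → ∃ e, ι e = c := fun c hc => by
    obtain ⟨e, i, hi, rfl⟩ := h.sub.exists_eq c
    obtain rfl := h.eq_zero_of_chosen (by omega) hi hc
    exact ⟨e, rfl⟩
  constructor
  · rintro (hb | hc | hc)
    · obtain ⟨e, i, hi, rfl⟩ := h.sub.exists_eq c
      rcases Nat.eq_zero_or_pos i with rfl | h0
      · exact ⟨e, rfl⟩
      · exact absurd hb (h.not_branch_interior (by omega) e h0 hi)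
    · exact hch c hc
    · obtain ⟨e, he⟩ := hch _ hc
      refine ⟨S.rot.symm e, ?_⟩
      rw [← h.sub.rot_symm hC, he, Equiv.symm_apply_apply]
  · rintro ⟨e, rfl⟩
    by_cases hdeg : 3 ≤ S.degree (S.tail e)
    · exact Or.inl ((h.branch_iff (by omega) e).2 hdeg)
    · right
      have hrr := Scheme.rot_rot_of_degree_lt hdeg
      obtain ⟨d, hd, hd'⟩ := (S.null_interface _ (Scheme.mem_null_of_degree_lt hdeg)).1
      rcases (tail_eq_iff_of_rot_rot hrr d).1 hd with rfl | rfl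
      · exact Or.inl (h.chosen_of_degree_two hk hdeg hd')
      · right
        rw [h.sub.rot hC]
        exact h.chosen_of_degree_two hk (by rwa [tail_rot]) hd'

theorem mem_null_iff (h : IsDecomp hm L δ ι) (hk : 1 ≤ k) (e : S.D) :
    S.tail e ∈ S.null ↔ (core hm L).IsInterfaceVertex ((core hm L).tail (ι e)) ∧ L (ι e).1 = 0 := by
  have hC := core.isMap hm L hk
  unfold IsInterfaceVertex
  simp_rw [h.sub.incident_iff hC]
  rw [h.label_zero]
  constructor
  · exact fun hn => ⟨S.null_interface _ hn, δ.ℓ_null _ hn⟩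
  · rintro ⟨h1, h2⟩
    by_contra hn
    exact (δ.ℓ_pos _ ⟨h1, hn⟩).ne' h2

variable {S' : Scheme k} {δ' : SnakeData S'} {ι' : S'.D → (core hm L).D}

/-- The length of an edge is the time between consecutive marked darts along the face. -/
theorem r_eq (h : IsDecomp hm L δ ι) (h' : IsDecomp hm L δ' ι') (hk : 2 ≤ k) {e : S.D} {e' : S'.D}
    (he : ι' e' = ι e) : δ.r e = δ'.r e' := by
  have h1 : ∃ e'', ι' e'' = ι (S.next e) := (h'.marked_iff hk _).1 ((h.marked_iff hk _).2 ⟨_, rfl⟩)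
  have h2 : ∃ e'', ι e'' = ι' (S'.next e') :=
    (h.marked_iff hk _).1 ((h'.marked_iff hk _).2 ⟨_, rfl⟩)
  rw [← h.sub.next_r] at h1
  rw [← h'.sub.next_r, he] at h2
  rcases lt_trichotomy (δ.r e) (δ'.r e') with hlt | heq | hlt
  · obtain ⟨e'', h1⟩ := h1
    rw [← he] at h1
    exact absurd h1 (h'.sub.not_mem_range_interior e' (δ.r_pos e) hlt e'')
  · exact heq
  · obtain ⟨e'', h2⟩ := h2
    exact absurd h2 (h.sub.not_mem_range_interior e (δ'.r_pos e') hlt e'')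

/-- The scheme of a decomposed map is unique. -/
theorem exists_iso (h : IsDecomp hm L δ ι) (h' : IsDecomp hm L δ' ι') (hk : 2 ≤ k) :
    ∃ f : S.D ≃ S'.D, (∀ e, ι' (f e) = ι e) ∧
      NamedMap.IsIso (m := S.toNamedMap) (m' := S'.toNamedMap) f ∧
      ∀ e, S'.tail (f e) ∈ S'.null ↔ S.tail e ∈ S.null := by
  have h1 : ∀ e, ∃ e', ι' e' = ι e := fun e =>
    (h'.marked_iff hk _).1 ((h.marked_iff hk _).2 ⟨_, rfl⟩)
  have h2 : ∀ e', ∃ e, ι e = ι' e' := fun e =>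
    (h.marked_iff hk _).1 ((h'.marked_iff hk _).2 ⟨_, rfl⟩)
  choose f hf using h1
  choose g hg using h2
  refine ⟨⟨f, g, fun e => h.sub.injective (by rw [hg, hf]),
    fun e => h'.sub.injective (by rw [hf, hg])⟩, hf, ⟨fun e => ?_, fun e => ?_, fun e => ?_⟩,
    fun e => ?_⟩
  · refine h'.sub.injective ?_
    change ι' (f (S.rev e)) = ι' (S'.rev (f e))
    rw [hf, ← h.sub.rev_last, ← h'.sub.rev_last, hf, h.r_eq h' hk (hf e)]
  · refine h'.sub.injective ?_
    change ι' (f (S.next e)) = ι' (S'.next (f e))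
    rw [hf, ← h.sub.next_r, ← h'.sub.next_r, hf, h.r_eq h' hk (hf e)]
  · change S'.face (f e) = S.face e
    rw [← h.sub.face, ← h'.sub.face, hf]
  · change S'.tail (f e) ∈ S'.null ↔ _
    rw [h.mem_null_iff (by omega), h'.mem_null_iff (by omega), hf]

theorem data_eq {δ' : SnakeData S} (h : IsDecomp hm L δ ι) (h' : IsDecomp hm L δ' ι) (hk : 2 ≤ k) :
    δ = δ' := by
  refine SnakeData.forest_injective (funext fun e => ?_)
  have ext : ∀ (F F' : LabeledForest), F.r = F'.r →
      (∀ i h h', F.floor ⟨i, h⟩ = F'.floor ⟨i, h'⟩) → (∀ i h h', F.tree ⟨i, h⟩ = F'.tree ⟨i, h'⟩) →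
      F = F' := by
    rintro ⟨r, M, t⟩ ⟨r', M', t'⟩ h1 h2 h3
    obtain rfl : r = r' := h1
    obtain rfl : M = M' := funext fun i => h2 i i.2 i.2
    obtain rfl : t = t' := funext fun i => h3 i i.2 i.2
    rfl
  refine ext _ _ (h.r_eq h' hk rfl) (fun i hi hi' => ?_) (fun i hi hi' => ?_)
  · exact (h.label_le e ⟨i, hi⟩).symm.trans (h'.label_le e ⟨i, hi'⟩)
  · exact (h.tree e ⟨i, hi⟩).symm.trans (h'.tree e ⟨i, hi'⟩)

end IsDecomp

end NamedMap

/-! ### The scheme of a map -/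

namespace NamedMap

variable {k : ℕ} {C : NamedMap k} {L : C.D → ℤ}

theorem branch_rot {c : C.D} : C.Branch (C.rot c) ↔ C.Branch c :=
  C.rot.injective.ne_iff

theorem label_rot (hL : ∀ d, L (C.next d) = L (C.rev d)) (c : C.D) : L (C.rot c) = L c :=
  label_eq_of_tail_eq hL (tail_rot c)

theorem marked_rot (c : C.D) : C.Marked L (C.rot c) ↔ C.Marked L c := by
  unfold Marked
  rw [branch_rot]
  by_cases h : C.Branch c
  · simp only [h, true_or]
  · rw [not_not.1 h, or_comm (a := C.Chosen L c)]

theorem marked_rot_symm (c : C.D) : C.Marked L (C.rot.symm c) ↔ C.Marked L c := by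
  rw [← marked_rot, Equiv.apply_symm_apply]

theorem next_rev_of_not_branch (hC : C.IsMap) {c : C.D} (h : ¬ C.Branch c) :
    C.next (C.rev c) = C.rot c := by
  rw [hC.next_rev, Equiv.symm_apply_eq, not_not.1 h]

theorem face_rot_of_not_branch (hC : C.IsMap) {c : C.D} (h : ¬ C.Branch c) :
    C.face (C.rot c) = C.face (C.rev c) := by
  rw [← next_rev_of_not_branch hC h, hC.face_next]

/-- A chain of vertices of degree `2` in the reverse direction. -/
theorem iterate_rev_iterate (hC : C.IsMap) {c : C.D} {i : ℕ}
    (h : ∀ j, 0 < j → j ≤ i → ¬ C.Branch (C.next^[j] c)) :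
    C.next^[i] (C.rev (C.next^[i] c)) = C.rev c := by
  induction i with
  | zero => rfl
  | succ i ih =>
    rw [Function.iterate_succ_apply, next_rev_of_not_branch hC (h _ (Nat.succ_pos i) le_rfl),
      Function.iterate_succ_apply', rot_next]
    exact ih fun j hj hj' => h j hj (by omega)

theorem iterate_rev_iterate_add (hC : C.IsMap) {c : C.D} {i j : ℕ}
    (h : ∀ n, j < n → n ≤ i + j → ¬ C.Branch (C.next^[n] c)) :
    C.next^[i] (C.rev (C.next^[i + j] c)) = C.rev (C.next^[j] c) := by
  rw [Function.iterate_add_apply]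
  refine iterate_rev_iterate hC fun n hn hn' => ?_
  rw [← Function.iterate_add_apply]
  exact h _ (by omega) (by omega)

theorem face_rev_iterate (hC : C.IsMap) {c : C.D} {i : ℕ}
    (h : ∀ j, 0 < j → j ≤ i → ¬ C.Branch (C.next^[j] c)) :
    C.face (C.rev (C.next^[i] c)) = C.face (C.rev c) := by
  rw [← iterate_rev_iterate hC h, hC.face_iterate]

/-- Otherwise the vertices after `c` form a cycle of vertices of degree `2`, whose darts and
reversals exhaust the map and leave only two faces. -/
theorem exists_branch (hC : C.IsMap) (hk : 2 ≤ k) (c : C.D) :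
    ∃ n, 0 < n ∧ C.Branch (C.next^[n] c) := by
  by_contra! h
  obtain ⟨N, hN, hN'⟩ := C.next.exists_iterate_eq_self c
  obtain ⟨d, hd, hd'⟩ := hC.exists_face_ne hk (C.face c) (C.face (C.rev c))
  have h1 := hC.induction
    (A := fun d => ∃ n, 0 < n ∧ (d = C.next^[n] c ∨ d = C.rev (C.next^[n] c))) ?_ ?_
    (d := C.next c) ⟨1, one_pos, Or.inl rfl⟩ d
  · obtain ⟨n, -, rfl | rfl⟩ := h1
    · exact hd (hC.face_iterate n c)
    · exact hd' (face_rev_iterate hC fun j hj _ => h j hj)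
  · rintro _ ⟨n, hn, rfl | rfl⟩
    · exact ⟨n, hn, Or.inr rfl⟩
    · exact ⟨n, hn, Or.inl (hC.rev_rev _)⟩
  · rintro _ ⟨n, hn, rfl | rfl⟩
    · exact ⟨n + 1, by omega, Or.inl (Function.iterate_succ_apply' _ _ _).symm⟩
    · rw [next_rev_of_not_branch hC (h n hn)]
      obtain ⟨n, rfl⟩ := Nat.exists_eq_add_of_lt hn
      rw [zero_add, Function.iterate_succ_apply', rot_next]
      -- Time `0` is replaced with the period `N`, since only positive times are allowed.
      rcases Nat.eq_zero_or_pos n with rfl | h0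
      · exact ⟨N, hN, Or.inr (by rw [hN']; rfl)⟩
      · exact ⟨n, h0, Or.inr rfl⟩

/-- `C.next^[n] c` is the first branching point after the origin of `c`. -/
structure FirstBranch (C : NamedMap k) (c : C.D) (n : ℕ) : Prop where
  pos : 0 < n
  branch : C.Branch (C.next^[n] c)
  not_branch : ∀ i, 0 < i → i < n → ¬ C.Branch (C.next^[i] c)

theorem exists_firstBranch (hC : C.IsMap) (hk : 2 ≤ k) (c : C.D) : ∃ n, C.FirstBranch c n := by
  classical
  have h := exists_branch hC hk c
  exact ⟨Nat.find h, (Nat.find_spec h).1, (Nat.find_spec h).2,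
    fun i hi hi' hb => Nat.find_min h hi' ⟨hi, hb⟩⟩

theorem FirstBranch.unique {c : C.D} {n n' : ℕ} (h : C.FirstBranch c n) (h' : C.FirstBranch c n') :
    n = n' := by
  rcases lt_trichotomy n n' with h1 | h1 | h1
  · exact absurd h.branch (h'.not_branch n h.pos h1)
  · exact h1
  · exact absurd h'.branch (h.not_branch n' h'.pos h1)

theorem FirstBranch.incident (hC : C.IsMap) {c : C.D} {n : ℕ} (h : C.FirstBranch c n) :
    C.Incident (C.tail (C.next^[n] c)) (C.face c) ∧
      C.Incident (C.tail (C.next^[n] c)) (C.face (C.rev c)) := by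
  refine ⟨⟨_, rfl, hC.face_iterate n c⟩, C.rot (C.next^[n] c), tail_rot _, ?_⟩
  obtain ⟨n, rfl⟩ := Nat.exists_eq_add_of_lt h.pos
  rw [zero_add, Function.iterate_succ_apply', rot_next]
  exact face_rev_iterate hC fun j hj hj' => h.not_branch j hj (by omega)

theorem iterate_rot_iterate (hC : C.IsMap) {c : C.D} {i j : ℕ}
    (h : ∀ n, j ≤ n → n ≤ i + j → ¬ C.Branch (C.next^[n] c)) :
    C.next^[i] (C.rot (C.next^[i + j] c)) = C.rot (C.next^[j] c) := by
  rw [← next_rev_of_not_branch hC (h (i + j) (by omega) le_rfl), ← Function.iterate_succ_apply,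
    Function.iterate_succ_apply', iterate_rev_iterate_add hC fun n hn hn' => h n hn.le hn',
    next_rev_of_not_branch hC (h j le_rfl (by omega))]

/-- On a chain between branching points with nonzero labels, the last vertex with label `0` is
chosen. -/
theorem exists_chosen (hC : C.IsMap) {c : C.D} {n n' : ℕ} (hf : C.face c = 0)
    (hf' : C.face (C.rev c) ≠ 0) (hnb : ¬ C.Branch c) (h0 : L c = 0)
    (hn : C.FirstBranch c n) (hn' : C.FirstBranch (C.rot c) n') (hLn : L (C.next^[n] c) ≠ 0)
    (hLn' : L (C.next^[n'] (C.rot c)) ≠ 0) : ∃ j < n, C.Chosen L (C.next^[j] c) := by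
  classical
  -- The witness `j` is the last time, up to the next branching point, at which the label vanishes.
  have hj0 := Nat.findGreatest_spec (P := fun j => L (C.next^[j] c) = 0) (Nat.zero_le n) h0
  have hjn := Nat.findGreatest_le (P := fun j => L (C.next^[j] c) = 0) n
  have hjmax : ∀ i, Nat.findGreatest (fun j => L (C.next^[j] c) = 0) n < i → i ≤ n →
    L (C.next^[i] c) ≠ 0 := fun i hi hi' => Nat.findGreatest_is_greatest hi hi'
  generalize Nat.findGreatest (fun j => L (C.next^[j] c) = 0) n = j at hj0 hjn hjmax
  have hjn : j < n := lt_of_le_of_ne hjn fun h => hLn (h ▸ hj0)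
  have hnb' : ∀ i, i < n → ¬ C.Branch (C.next^[i] c) := fun i hi => by
    rcases Nat.eq_zero_or_pos i with rfl | hi0
    · exact hnb
    · exact hn.not_branch i hi0 hi
  refine ⟨j, hjn, by rw [hC.face_iterate, hf], ?_, hnb' j hjn, hj0, fun N hN hN' => ?_,
    fun N hN hN' hb => ?_⟩
  · rwa [face_rev_iterate hC fun i _ hi' => hnb' i (by omega)]
  · rw [← Function.iterate_add_apply]
    refine hjmax _ (by omega) ?_
    by_contra! hlt
    refine hN' (n - j) (by omega) (by omega) ?_
    rw [← Function.iterate_add_apply, Nat.sub_add_cancel hjn.le]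
    exact hn.branch
  -- From time `j` backwards, the walk passes the origin of `c` and continues along `C.rot c`, so
  -- the branching point behind is the one given by `hn'`.
  · have hrot : ∀ i ≤ j, C.next^[i] (C.rot (C.next^[j] c)) = C.rot (C.next^[j - i] c) :=
      fun i hi => by
        obtain ⟨l, rfl⟩ := Nat.exists_eq_add_of_le hi
        rw [iterate_rot_iterate hC fun n _ hn' => hnb' n (by omega), Nat.add_sub_cancel_left]
    have hlt : j < N := by
      by_contra! hle
      rw [hrot N hle, branch_rot] at hb
      exact hnb' _ (by omega) hb
    have hsub : ∀ i, C.next^[i + j] (C.rot (C.next^[j] c)) = C.next^[i] (C.rot c) := fun i => by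
      rw [Function.iterate_add_apply, hrot j le_rfl, Nat.sub_self]
      rfl
    obtain ⟨l, rfl⟩ := Nat.exists_eq_add_of_le' hlt.le
    rw [hsub] at hb ⊢
    obtain rfl : l = n' := FirstBranch.unique ⟨by omega, hb, fun i hi hi' => by
      rw [← hsub]
      exact hN' _ (by omega) (by omega)⟩ hn'
    exact hLn'

/-- The map whose darts are the marked darts of `C`. -/
noncomputable def markedMap (C : NamedMap k) (L : C.D → ℤ) : NamedMap k where
  D := {c // C.Marked L c}
  finite := have := C.finite; inferInstance
  -- The identity `rev = rot * next`, valid in any map, leaves no other choice of reversal.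
  rev := C.rot.subtypePerm marked_rot * have := C.finite; C.next.induced (C.Marked L)
  next := have := C.finite; C.next.induced (C.Marked L)
  face c := C.face c.1

/-- Lengths are first return times to the marked darts. Unmarked vertices have degree `2`, so a
chain read backwards again follows a face. -/
theorem markedMap.isSubdivision (hC : C.IsMap) (hk : 2 ≤ k) : ∃ r : (markedMap C L).D → ℕ,
    IsSubdivision (markedMap C L) C r Subtype.val := by
  have := C.finite
  let r := C.next.returnTime (C.Marked L)
  have r_pos : ∀ e, 0 < r e := C.next.returnTime_pos _
  have hint : ∀ e i, 0 < i → i < r e → ¬ C.Marked L (C.next^[i] e.1) :=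
    fun e i => C.next.not_of_lt_returnTime _ e
  have hint' : ∀ e i, 0 < i → i < r e → ¬ C.Branch (C.next^[i] e.1) :=
    fun e i hi hi' hb => hint e i hi hi' (Or.inl hb)
  have hrev : ∀ e : (markedMap C L).D, ((markedMap C L).rev e).1 = C.rev (C.next^[r e - 1] e.1) := by
    intro e
    change C.rot (C.next^[r e] e.1) = _
    obtain ⟨n, hn⟩ := Nat.exists_eq_add_of_lt (r_pos e)
    rw [hn, zero_add, Function.iterate_succ_apply', rot_next]
    rfl
  have hrev' : ∀ (e : (markedMap C L).D) i, i < r e →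
      C.next^[i] ((markedMap C L).rev e).1 = C.rev (C.next^[r e - 1 - i] e.1) := by
    intro e i hi
    have h1 := iterate_rev_iterate_add hC (c := e.1) (i := i) (j := r e - 1 - i)
      fun n hn hn' => hint' e n (by omega) (by omega)
    rw [hrev, ← h1]
    congr 4
    omega
  have hrevm : ∀ (e : (markedMap C L).D) i, i < r e → C.next^[i + 1] ((markedMap C L).rev e).1 =
      C.rot.symm (C.next^[r e - 1 - i] e.1) := fun e i hi => by
    rw [Function.iterate_succ_apply', hrev' e i hi, hC.next_rev]
  refine ⟨r, r_pos, fun e => ?_, fun _ => rfl, fun e i hi => ?_, fun c => ?_, ?_, fun _ => rfl⟩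
  -- Being marked depends only on the vertex, so the reversed chain meets its first marked dart
  -- after the same number of steps.
  · refine C.next.returnTime_eq _ _ (r_pos e) ?_ fun i hi hi' => ?_
    · have h1 := hrevm e (r e - 1) (by have := r_pos e; omega)
      rw [Nat.sub_add_cancel (r_pos e), Nat.sub_self] at h1
      rw [h1, marked_rot_symm]
      exact e.2
    · obtain ⟨i, rfl⟩ := Nat.exists_eq_add_of_lt hi
      rw [zero_add, hrevm e i (by omega), marked_rot_symm]
      exact hint e _ (by omega) (by omega)
  · have := hrev' e (r e - 1 - i) (by omega)
    rw [this]
    congr 2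
    omega
  -- The face of `c` contains a branching point, from which `c` is reached by going on along the
  -- face.
  · obtain ⟨n, hn, hb⟩ := exists_branch hC hk c
    refine Equiv.Perm.mem_of_sameCycle (σ := C.next)
      (A := fun c => ∃ (e : (markedMap C L).D) (i : ℕ), i < r e ∧ C.next^[i] e.1 = c) ?_
      (C.next.sameCycle_iterate n c).symm ⟨⟨_, Or.inl hb⟩, 0, r_pos _, rfl⟩
    rintro _ ⟨e, i, hi, rfl⟩
    rw [← Function.iterate_succ_apply' C.next]
    rcases Nat.lt_or_ge (i + 1) (r e) with h1 | h1
    · exact ⟨e, _, h1, rfl⟩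
    · refine ⟨(markedMap C L).next e, 0, r_pos _, ?_⟩
      rw [show i.succ = r e by omega]
      rfl
  · have key : ∀ (e e' : (markedMap C L).D) (i i' : ℕ), i ≤ i' → i' < r e' →
        C.next^[i] e.1 = C.next^[i'] e'.1 → e = e' ∧ i = i' := by
      intro e e' i i' hle hi' heq
      obtain ⟨l, rfl⟩ := Nat.exists_eq_add_of_le hle
      rw [Function.iterate_add_apply] at heq
      have h1 := C.next.injective.iterate i heq
      rcases Nat.eq_zero_or_pos l with rfl | hl
      · exact ⟨Subtype.ext h1, rfl⟩
      · exact absurd (h1 ▸ e.2) (hint e' l hl (by omega))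
    intro e e' i i' hi hi' heq
    rcases le_total i i' with hle | hle
    · exact key e e' i i' hle hi' heq
    · obtain ⟨h1, h2⟩ := key e' e i' i hle hi heq.symm
      exact ⟨h1.symm, h2.symm⟩

/-- `C` is a planar map without vertices of degree `1`, whose labels `L` have minimum `0` over the
vertices incident to `f₀` and `f_i`, for `i ≠ 0`. -/
structure IsReduced (C : NamedMap k) (L : C.D → ℤ) : Prop where
  isMap : C.IsMap
  rot_ne : ∀ c, C.rot c ≠ c
  euler : C.Euler
  label_next : ∀ c, L (C.next c) = L (C.rev c)
  label_nonneg : ∀ c, C.IsInterfaceVertex (C.tail c) → 0 ≤ L c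
  exists_label_zero : ∀ i, i ≠ 0 →
    ∃ c, C.Incident (C.tail c) 0 ∧ C.Incident (C.tail c) i ∧ L c = 0

/-- The vertices of the scheme `S` are the marked vertices of `C`, the null-vertices being those
incident to `f₀` and to another face and with label `0`. -/
structure IsMarking (S C : NamedMap k) (L : C.D → ℤ) (null : Set S.Vertex) (r : S.D → ℕ)
    (ι : S.D → C.D) : Prop where
  sub : IsSubdivision S C r ι
  marked_iff : ∀ c, C.Marked L c ↔ ∃ e, ι e = c
  mem_null_iff : ∀ e, S.tail e ∈ null ↔ C.IsInterfaceVertex (C.tail (ι e)) ∧ L (ι e) = 0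

theorem Chosen.isInterfaceVertex (hC : C.IsMap) {c : C.D} (h : C.Chosen L c) :
    C.IsInterfaceVertex (C.tail c) :=
  ⟨⟨c, rfl, h.face⟩, _, h.face_rev, C.rot c, tail_rot c, face_rot_of_not_branch hC h.not_branch⟩

/-- A zero of degree `2` lies on a chain. Either an end of this chain has label `0`, or a vertex of
the chain is chosen, and all these vertices are incident to both faces along the chain. -/
theorem IsReduced.exists_marked_zero (h : C.IsReduced L) (hk : 2 ≤ k) {i : Fin (k + 1)}
    (hi : i ≠ 0) : ∃ c, C.Marked L c ∧ C.Incident (C.tail c) 0 ∧ C.Incident (C.tail c) i ∧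
      L c = 0 := by
  have hC := h.isMap
  obtain ⟨c, h1, h2, h3⟩ := h.exists_label_zero i hi
  by_cases hb : C.Branch c
  · exact ⟨c, Or.inl hb, h1, h2, h3⟩
  obtain ⟨c, hb, hf, hf', h3⟩ : ∃ c, ¬ C.Branch c ∧ C.face c = 0 ∧ C.face (C.rev c) = i ∧
      L c = 0 := by
    obtain ⟨d, hd, hd'⟩ := h1
    obtain ⟨d', hd1, hd1'⟩ := h2
    have hdb : ¬ C.Branch d := by
      rcases (tail_eq_iff_of_rot_rot (not_not.1 hb) d).1 hd with rfl | rfl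
      · exact hb
      · rwa [branch_rot]
    refine ⟨d, hdb, hd', ?_, by rw [label_eq_of_tail_eq h.label_next hd, h3]⟩
    rcases (tail_eq_iff_of_rot_rot (not_not.1 hdb) d').1 (hd1.trans hd.symm) with rfl | rfl
    · exact absurd (hd1'.symm.trans hd') hi
    · rw [← face_rot_of_not_branch hC hdb, hd1']
  obtain ⟨n, hn⟩ := exists_firstBranch hC hk c
  obtain ⟨n', hn'⟩ := exists_firstBranch hC hk (C.rot c)
  by_cases hLn : L (C.next^[n] c) = 0
  · have h4 := hn.incident hC
    rw [hf, hf'] at h4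
    exact ⟨_, Or.inl hn.branch, h4.1, h4.2, hLn⟩
  by_cases hLn' : L (C.next^[n'] (C.rot c)) = 0
  · have h4 := hn'.incident hC
    rw [← face_rot_of_not_branch hC (by rwa [branch_rot]), not_not.1 hb,
      face_rot_of_not_branch hC hb, hf, hf'] at h4
    exact ⟨_, Or.inl hn'.branch, h4.2, h4.1, hLn'⟩
  obtain ⟨j, hj, hc⟩ := exists_chosen hC hf (hf'.trans_ne hi) hb h3 hn hn' hLn hLn'
  refine ⟨_, Or.inr (Or.inl hc), ⟨_, rfl, hc.face⟩, ⟨_, tail_rot _, ?_⟩, hc.label⟩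
  rw [face_rot_of_not_branch hC hc.not_branch, ← hf']
  exact face_rev_iterate hC fun l hl hl' => hn.not_branch l hl (by omega)

end NamedMap

/-! ### The marked map satisfies the axioms of a scheme. -/

namespace NamedMap

namespace IsMarking

variable {k : ℕ} {S C : NamedMap k} {L : C.D → ℤ} {null : Set S.Vertex} {r : S.D → ℕ}
  {ι : S.D → C.D}

theorem isInterfaceVertex_iff (h : IsMarking S C L null r ι) (hC : C.IsMap) (e : S.D) :
    C.IsInterfaceVertex (C.tail (ι e)) ↔ S.IsInterfaceVertex (S.tail e) := by
  unfold IsInterfaceVertex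
  simp_rw [h.sub.incident_iff hC]

theorem branch_iff (h : IsMarking S C L null r ι) (hC : C.IsMap) (e : S.D) :
    C.Branch (ι e) ↔ 3 ≤ S.degree (S.tail e) := by
  rw [three_le_degree_iff, Branch, h.sub.rot hC, h.sub.rot hC, h.sub.injective.ne_iff]

theorem not_marked_interior (h : IsMarking S C L null r ι) (e : S.D) {i : ℕ} (h0 : 0 < i)
    (hi : i < r e) : ¬ C.Marked L (C.next^[i] (ι e)) := fun hm => by
  obtain ⟨e', he⟩ := (h.marked_iff _).1 hm
  exact h.sub.not_mem_range_interior e h0 hi e' he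

theorem not_branch_interior (h : IsMarking S C L null r ι) (e : S.D) {i : ℕ} (h0 : 0 < i)
    (hi : i < r e) : ¬ C.Branch (C.next^[i] (ι e)) := fun hb =>
  h.not_marked_interior e h0 hi (Or.inl hb)

theorem chosen_of_not_branch (h : IsMarking S C L null r ι) (hC : C.IsMap) {e : S.D}
    (he : ¬ C.Branch (ι e)) : C.Chosen L (ι e) ∨ C.Chosen L (ι (S.rot e)) := by
  rw [← h.sub.rot hC]
  exact ((h.marked_iff _).2 ⟨e, rfl⟩).resolve_left he

theorem mem_null_of_chosen (h : IsMarking S C L null r ι) (hC : C.IsMap) {e : S.D}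
    (he : C.Chosen L (ι e)) : S.tail e ∈ null :=
  (h.mem_null_iff e).2 ⟨he.isInterfaceVertex hC, he.label⟩

theorem mem_null_of_not_branch (h : IsMarking S C L null r ι) (hC : C.IsMap) {e : S.D}
    (he : ¬ C.Branch (ι e)) : S.tail e ∈ null := by
  rcases h.chosen_of_not_branch hC he with h1 | h1
  · exact h.mem_null_of_chosen hC h1
  · rw [← tail_rot]
    exact h.mem_null_of_chosen hC h1

theorem label_ahead_ne (h : IsMarking S C L null r ι) {e : S.D} (he : C.Chosen L (ι e)) {n : ℕ}
    (h0 : 0 < n) (hn : n ≤ r e) : L (C.next^[n] (ι e)) ≠ 0 :=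
  he.ahead n h0 fun _ hi hi' => h.not_branch_interior e hi (by omega)

/-- This keeps null-vertices of degree `2` away from other null-vertices. If `ι e` is chosen,
`ahead` applies. If `ι (rot e)` is chosen, `behind` settles a branching endpoint. An endpoint of
degree `2` can then only be chosen through `ι (rev e)`, as `f₀` is not on the left of `e`, and
`ahead` for this dart forbids the label `0` at the origin of `e`. -/
theorem label_next_ne (h : IsMarking S C L null r ι) (hC : C.IsMap) {e : S.D}
    (he : ¬ C.Branch (ι e)) : L (ι (S.next e)) ≠ 0 := by
  rcases h.chosen_of_not_branch hC he with h1 | h1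
  · rw [← h.sub.next_r]
    exact h.label_ahead_ne h1 (h.sub.r_pos e) le_rfl
  · have hee : S.rot (S.rot e) = e := h.sub.injective (by
      rw [← h.sub.rot hC, ← h.sub.rot hC]; exact not_not.1 he)
    have hr := h.sub.rot hC (S.rot e)
    rw [hee] at hr
    by_cases hb : C.Branch (ι (S.next e))
    · have h2 := h1.behind (r e) (h.sub.r_pos e)
      rw [hr, h.sub.next_r] at h2
      exact h2 (fun i hi hi' => h.not_branch_interior e hi hi') hb
    · rcases h.chosen_of_not_branch hC hb with h2 | h2
      · have h3 := h1.face_rev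
        rw [← face_rot_of_not_branch hC h1.not_branch, hr] at h3
        have h4 := h2.face
        rw [← h.sub.next_r, hC.face_iterate] at h4
        exact absurd h4 h3
      · rw [rot_next] at h2
        have h3 := h.label_ahead_ne h2 (h.sub.r_pos _) le_rfl
        have h4 : S.next (S.rev e) = S.rot e :=
          S.rot.injective (by rw [rot_next, h.sub.rev_rev hC, hee])
        rw [h.sub.next_r, h4] at h3
        exact absurd h1.label h3

end IsMarking

/-- The scheme of a map. -/
theorem IsReduced.exists_scheme {k : ℕ} {C : NamedMap k} {L : C.D → ℤ} (hR : C.IsReduced L)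
    (hk : 2 ≤ k) : ∃ (S : Scheme k) (r : S.D → ℕ) (ι : S.D → C.D),
      IsMarking S.toNamedMap C L S.null r ι := by
  have hC := hR.isMap
  obtain ⟨r, hsub⟩ := markedMap.isSubdivision (L := L) hC hk
  let null : Set (markedMap C L).Vertex := {v | (markedMap C L).IsInterfaceVertex v ∧
    ∀ e : (markedMap C L).D, (markedMap C L).tail e = v → L e.1 = 0}
  have h : IsMarking (markedMap C L) C L null r Subtype.val := by
    refine ⟨hsub, fun c => ⟨fun hc => ⟨⟨c, hc⟩, rfl⟩, ?_⟩, fun e => ?_⟩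
    · rintro ⟨e, rfl⟩
      exact e.2
    · refine and_congr ?_ ⟨fun h => h e rfl, fun h e' he => ?_⟩
      · unfold IsInterfaceVertex
        simp_rw [hsub.incident_iff hC]
      · rw [label_eq_of_tail_eq hR.label_next ((hsub.tail_eq_iff hC).2 he), h]
  have hS := hsub.isMap hC hR.rot_ne
  have hrot : ∀ e, (markedMap C L).rot e ≠ e := fun e he =>
    hR.rot_ne e.1 (by rw [hsub.rot hC, he])
  have two_le : ∀ v, 2 ≤ (markedMap C L).degree v := fun v => by
    obtain ⟨e, rfl⟩ := exists_tail_eq v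
    by_cases h1 : (markedMap C L).rot ((markedMap C L).rot e) = e
    · rw [degree_eq_two h1 (hrot e)]
    · have := three_le_degree h1
      omega
  have two_null : ∀ v, (markedMap C L).degree v = 2 → v ∈ null := fun v hv => by
    obtain ⟨e, rfl⟩ := exists_tail_eq v
    exact h.mem_null_of_not_branch hC (by rw [h.branch_iff hC]; omega)
  have not_adj : ∀ d, (markedMap C L).tail d ≠ (markedMap C L).head d →
      (markedMap C L).degree ((markedMap C L).tail d) = 2 → (markedMap C L).head d ∉ null := by
    intro d _ hd hn
    rw [← tail_next, h.mem_null_iff] at hn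
    exact h.label_next_ne hC (by rw [h.branch_iff hC]; omega) hn.2
  have exists_null : ∀ i, i ≠ 0 → ∃ v ∈ null, (markedMap C L).Incident v i := fun i hi => by
    obtain ⟨c, h1, h2, h3, h4⟩ := hR.exists_marked_zero hk hi
    obtain ⟨e, rfl⟩ := (h.marked_iff c).1 h1
    exact ⟨_, (h.mem_null_iff e).2 ⟨⟨h2, i, hi, h3⟩, h4⟩, (hsub.incident_iff hC).1 h3⟩
  exact ⟨
    { toNamedMap := markedMap C L
      null := null
      isPlanarMap := hS.isPlanarMap ((hsub.euler_iff hC hR.rot_ne).1 hR.euler)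
      common_vertex := fun i hi => by
        obtain ⟨v, hv, hvi⟩ := exists_null i hi
        exact ⟨v, hv.1.1, hvi⟩
      two_le_degree := two_le
      degree_two_interface := fun v hv => (two_null v hv).1
      degree_two_not_adj := fun d h1 h2 h3 => not_adj d h1 h2 (two_null _ h3)
      degree_two_null := two_null
      null_interface := fun v hv => hv.1
      exists_null := exists_null
      degree_two_not_adj_null := not_adj }, r, Subtype.val, h⟩

/-- Markings are invariant under isomorphisms of schemes. -/
theorem IsMarking.comp {k : ℕ} {S S' : Scheme k} {C : NamedMap k} {L : C.D → ℤ} {r : S.D → ℕ}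
    {ι : S.D → C.D} (h : IsMarking S.toNamedMap C L S.null r ι) {f : S'.D ≃ S.D}
    (hf : NamedMap.IsIso (m := S'.toNamedMap) (m' := S.toNamedMap) f)
    (hn : ∀ e, S.tail (f e) ∈ S.null ↔ S'.tail e ∈ S'.null) :
    IsMarking S'.toNamedMap C L S'.null (r ∘ f) (ι ∘ f) where
  sub :=
    { r_pos := fun e => h.sub.r_pos _
      r_rev := fun e => by
        simp only [Function.comp_apply, hf.rev]
        exact h.sub.r_rev _
      next_r := fun e => by
        simp only [Function.comp_apply, hf.next]
        exact h.sub.next_r _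
      rev_next := fun e i hi => by
        simp only [Function.comp_apply, hf.rev]
        exact h.sub.rev_next _ i hi
      exists_eq := fun c => by
        obtain ⟨e, i, hi, he⟩ := h.sub.exists_eq c
        exact ⟨f.symm e, i, by simpa using hi, by simpa using he⟩
      inj := fun e e' i i' hi hi' he => by
        obtain ⟨h1, h2⟩ := h.sub.inj _ _ i i' hi hi' he
        exact ⟨f.injective h1, h2⟩
      face := fun e => (h.sub.face _).trans (hf.face e) }
  marked_iff c := (h.marked_iff c).trans
    ⟨fun ⟨e, he⟩ => ⟨f.symm e, by simpa using he⟩, fun ⟨e, he⟩ => ⟨f e, he⟩⟩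
  mem_null_iff e := (hn e).symm.trans (h.mem_null_iff _)

end NamedMap

/-! ### The decomposition of a map -/

namespace NamedMap

variable {k : ℕ}

namespace IsMarking

variable {S : Scheme k} {C : NamedMap k} {L : C.D → ℤ} {r : S.D → ℕ} {ι : S.D → C.D}

theorem tail_next_eq (h : IsMarking S.toNamedMap C L S.null r ι) (hC : C.IsMap) (e : S.D) :
    C.tail (ι (S.next e)) = C.tail (ι (S.rev e)) :=
  (h.sub.tail_eq_iff hC).2 (tail_next e)

theorem label_rev (h : IsMarking S.toNamedMap C L S.null r ι) (hR : C.IsReduced L) (e : S.D)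
    {i j : ℕ} (hij : i + j = r e) : L (C.next^[j] (ι (S.rev e))) = L (C.next^[i] (ι e)) := by
  have hC := hR.isMap
  rcases Nat.lt_or_ge i (r e) with hi | hi
  · have h1 := h.sub.rot_symm_interior hC e hi
    rw [show r e - i = j by omega] at h1
    rw [← h1, ← NamedMap.label_rot hR.label_next, Equiv.apply_symm_apply]
  · obtain rfl : i = r e := by have := hij; omega
    obtain rfl : j = 0 := by omega
    rw [h.sub.next_r]
    exact (label_eq_of_tail_eq hR.label_next (h.tail_next_eq hC e)).symm

theorem label_nonneg (h : IsMarking S.toNamedMap C L S.null r ι) (hR : C.IsReduced L) {e : S.D}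
    (he : S.IsInterfaceEdge e) {i : ℕ} (hi : i ≤ r e) : 0 ≤ L (C.next^[i] (ι e)) := by
  have hC := hR.isMap
  refine hR.label_nonneg _ ?_
  rcases hi.lt_or_eq with hi | rfl
  · have h1 : C.Incident (C.tail (C.next^[i] (ι e))) (S.face e) :=
      ⟨_, rfl, h.sub.face_iterate hC e i⟩
    have h2 : C.Incident (C.tail (C.next^[i] (ι e))) (S.face (S.rev e)) :=
      ⟨C.rot.symm (C.next^[i] (ι e)), tail_iterate_rot_symm 1 _, by
        rw [h.sub.rot_symm_interior hC e hi, h.sub.face_iterate hC]⟩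
    rcases he with ⟨h3, h4⟩ | ⟨h3, h4⟩
    · exact ⟨h3 ▸ h1, _, h4, h2⟩
    · exact ⟨h4 ▸ h2, _, h3, h1⟩
  · rw [h.sub.next_r, h.isInterfaceVertex_iff hC, tail_next]
    exact Scheme.isInterfaceVertex_head he

theorem label_ne_of_not_mem_null (h : IsMarking S.toNamedMap C L S.null r ι) (hC : C.IsMap)
    {e : S.D} (hi : S.IsInterfaceVertex (S.tail e)) (hn : S.tail e ∉ S.null) : L (ι e) ≠ 0 :=
  fun h0 => hn ((h.mem_null_iff e).2 ⟨(h.isInterfaceVertex_iff hC e).2 hi, h0⟩)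

theorem branch_of_not_mem_null (h : IsMarking S.toNamedMap C L S.null r ι) (hC : C.IsMap)
    {e : S.D} (hn : S.tail e ∉ S.null) : C.Branch (ι e) :=
  not_not.1 fun hb => hn (h.mem_null_of_not_branch hC hb)

/-- The ends are branching points with nonzero labels, so by `exists_chosen` a zero between them
would produce a chosen dart inside the chain, where nothing is marked. -/
theorem label_ne_of_face (h : IsMarking S.toNamedMap C L S.null r ι) (hR : C.IsReduced L) {e : S.D}
    (hf : S.face e = 0) (hf' : S.face (S.rev e) ≠ 0) (htail : S.tail e ∉ S.null)
    (hhead : S.head e ∉ S.null) {i : ℕ} (hi : i ≤ r e) : L (C.next^[i] (ι e)) ≠ 0 := by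
  have hC := hR.isMap
  have hint : S.IsInterfaceEdge e := Or.inl ⟨hf, hf'⟩
  have hti : S.IsInterfaceVertex (S.tail e) := by
    have := Scheme.isInterfaceVertex_head (Scheme.isInterfaceEdge_rev hint)
    rwa [S.isMap.head_rev] at this
  have hhi := Scheme.isInterfaceVertex_head hint
  rw [← tail_next] at hhi hhead
  have hLt := h.label_ne_of_not_mem_null hC hti htail
  have hLh := h.label_ne_of_not_mem_null hC hhi hhead
  rcases hi.lt_or_eq with hi | rfl
  · rcases Nat.eq_zero_or_pos i with rfl | h0
    · exact hLt
    intro hL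
    have hr := h.sub.r_rev e
    have hnext : C.next^[r e - i] (C.next^[i] (ι e)) = ι (S.next e) := by
      rw [← Function.iterate_add_apply, Nat.sub_add_cancel hi.le, h.sub.next_r]
    have hnext' : C.next^[i] (C.rot (C.next^[i] (ι e))) = ι (S.rot.symm e) := by
      rw [h.sub.rot_interior hC e h0 hi, ← Function.iterate_add_apply, Nat.add_sub_cancel' hi.le,
        ← hr, h.sub.next_r, S.isMap.next_rev]
    have hts : S.tail (S.rot.symm e) = S.tail e := tail_iterate_rot_symm 1 e
    have hb : C.FirstBranch (C.next^[i] (ι e)) (r e - i) := by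
      refine ⟨by omega, ?_, fun j hj hj' => ?_⟩
      · rw [hnext]
        exact h.branch_of_not_mem_null hC hhead
      · rw [← Function.iterate_add_apply]
        exact h.not_branch_interior e (by omega) (by omega)
    have hb' : C.FirstBranch (C.rot (C.next^[i] (ι e))) i := by
      refine ⟨h0, ?_, fun j hj hj' => ?_⟩
      · rw [hnext']
        exact h.branch_of_not_mem_null hC (by rwa [hts])
      · rw [h.sub.rot_interior hC e h0 hi, ← Function.iterate_add_apply]
        exact h.not_branch_interior _ (by omega) (by omega)
    obtain ⟨j, hj, hc⟩ := exists_chosen hC (by rw [h.sub.face_iterate hC, hf])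
      (by rwa [h.sub.face_rev_iterate hC e hi]) (h.not_branch_interior e h0 hi) hL hb hb'
      (by rwa [hnext]) (by
        rw [hnext']
        exact h.label_ne_of_not_mem_null hC (by rwa [hts]) (by rwa [hts]))
    rw [← Function.iterate_add_apply] at hc
    exact h.not_marked_interior e (by omega) (by omega) (Or.inr (Or.inl hc))
  · rwa [h.sub.next_r]

theorem label_pos_EI (h : IsMarking S.toNamedMap C L S.null r ι) (hR : C.IsReduced L) {e : S.D}
    (he : e ∈ S.EI) {i : ℕ} (hi : i ≤ r e) : 0 < L (C.next^[i] (ι e)) := by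
  have h1 : S.tail e ∉ S.null := fun h1 => he.2 ⟨he.1, Or.inl h1⟩
  have h2 : S.head e ∉ S.null := fun h1 => he.2 ⟨he.1, Or.inr h1⟩
  refine (h.label_nonneg hR he.1 hi).lt_of_ne' ?_
  rcases he.1 with ⟨h3, h4⟩ | ⟨h3, h4⟩
  · exact h.label_ne_of_face hR h3 h4 h1 h2 hi
  -- With `f₀` on the right, the chain is read along `rev e`.
  · rw [← h.label_rev hR e (Nat.add_sub_cancel' hi)]
    refine h.label_ne_of_face hR h4 ?_ h2 ?_ (by rw [h.sub.r_rev]; omega)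
    · rwa [S.isMap.rev_rev]
    · rwa [S.isMap.head_rev]

/-- Since `e` is not thin, its endpoint has degree `2` and `f₀` is not on the left of `e`. The dart
chosen at the endpoint is therefore `ι (rev e)`, and no label ahead of it vanishes along the edge.
-/
theorem label_pos_EN (h : IsMarking S.toNamedMap C L S.null r ι) (hR : C.IsReduced L) {e : S.D}
    (he : e ∈ S.EN) (ht : e ∉ S.Thin) (hn : S.head e ∈ S.null) {i : ℕ} (hi : i < r e) :
    0 < L (C.next^[i] (ι e)) := by
  have hC := hR.isMap
  have hdeg : ¬ 3 ≤ S.degree (S.head e) := fun h1 => ht (Or.inr (Or.inr ⟨he, Or.inr ⟨hn, h1⟩⟩))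
  have hf : S.face e ≠ 0 := fun h1 => ht (Or.inl ⟨hn, by
    have := S.two_le_degree (S.head e)
    omega, h1⟩)
  refine (h.label_nonneg hR he.1 hi.le).lt_of_ne' ?_
  rw [← h.label_rev hR e (Nat.add_sub_cancel' hi.le)]
  have hb : ¬ C.Branch (ι (S.rev e)) := by rwa [h.branch_iff hC]
  have hr := h.sub.r_rev e
  rcases h.chosen_of_not_branch hC hb with h1 | h1
  · exact h.label_ahead_ne h1 (by omega) (by omega)
  · have h2 := h1.face
    rw [← h.sub.rot hC, face_rot_of_not_branch hC hb, ← Function.iterate_zero_apply C.next (ι _),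
      h.sub.face_rev_iterate hC _ (h.sub.r_pos _), S.isMap.rev_rev] at h2
    exact absurd h2 hf

end IsMarking

variable {m : NamedMap k} {L : m.D → ℤ}

theorem IsMarking.exists_isDecomp {hm : m.IsMap} {S : Scheme k} {r : S.D → ℕ}
    {ι : S.D → (core hm L).D}
    (h : IsMarking S.toNamedMap (core hm L) (fun c => L c.1) S.null r ι)
    (hR : (core hm L).IsReduced fun c => L c.1)
    (hL : ∀ d, L (m.next d) = L (m.rev d)) (hadj : ∀ d, |L (m.rev d) - L d| ≤ 1) :
    ∃ δ : SnakeData S, IsDecomp hm L δ ι := by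
  have hC := hR.isMap
  refine ⟨
    { ℓ := Quotient.lift (fun e => L (ι e).1) fun e e' he =>
        label_eq_of_tail_eq (L := fun c : (core hm L).D => L c.1) hR.label_next
          ((h.sub.tail_eq_iff hC).2 (Quotient.sound he))
      r := r
      M := fun e i => L ((core hm L).next^[i] (ι e)).1
      tree := fun e i => core.tree ((core hm L).next^[i] (ι e))
      ℓ_null := fun v hv => ?_
      ℓ_pos := fun v hv => ?_
      r_pos := h.sub.r_pos
      r_rev := h.sub.r_rev
      M_rev := fun e i j hij => h.label_rev hR e hij
      M_zero := fun e => rfl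
      M_nonneg := fun e he i => h.label_nonneg hR (he.elim And.left And.left) (Nat.lt_succ_iff.1 i.2)
      M_pos_EI := fun e he i => h.label_pos_EI hR he (Nat.lt_succ_iff.1 i.2)
      M_pos_EN := fun e he ht hn i hi => h.label_pos_EN hR he ht hn
        ((Nat.lt_succ_iff.1 i.2).lt_of_ne fun h1 => hi (Fin.ext h1))
      isLabeling := fun e => ⟨fun i => ?_, fun i => ?_⟩ }, h.sub, fun e i => rfl, fun e i => rfl⟩
  · obtain ⟨e, rfl⟩ := exists_tail_eq v
    exact ((h.mem_null_iff e).1 hv).2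
  · obtain ⟨e, rfl⟩ := exists_tail_eq v
    exact (hR.label_nonneg _ ((h.isInterfaceVertex_iff hC e).2 hv.1)).lt_of_ne'
      (h.label_ne_of_not_mem_null hC hv.1 hv.2)
  · have h1 := hR.label_next ((core hm L).next^[i] (ι e))
    rw [← Function.iterate_succ_apply' (core hm L).next] at h1
    change |L ((core hm L).next^[i + 1] (ι e)).1 - L ((core hm L).next^[i] (ι e)).1| ≤ 1
    exact h1 ▸ hadj _
  · have h1 := core.fits_tree ((core hm L).next^[i] (ι e))
    have h2 := h1.isLabeling hm hL hadj
    rw [← h1.label_eq hm hL] at h2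
    exact h2

end NamedMap

namespace LabeledMap.IsLM

variable {k : ℕ} {m : LabeledMap k}

theorem label_next (h : m.IsLM) (d : m.D) : m.label (m.next d) = m.label (m.rev d) :=
  h.label_eq _ _ (NamedMap.tail_next d)

theorem isReduced_core (h : m.IsLM) (hk : 1 ≤ k) :
    (NamedMap.core h.isPlanarMap.isMap m.label).IsReduced fun c => m.label c.1 where
  isMap := NamedMap.core.isMap _ _ hk
  rot_ne := NamedMap.core.rot_ne
  euler := (NamedMap.core.euler_iff _ _ hk).2 h.isPlanarMap.euler
  label_next := NamedMap.core.label_next hk h.label_next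
  label_nonneg c hc := by
    obtain ⟨h0, i, hi, h1⟩ := hc
    exact h.label_nonneg i hi _ ((NamedMap.core.incident_iff hk).1 h0)
      ((NamedMap.core.incident_iff hk).1 h1)
  exists_label_zero i hi := by
    obtain ⟨d, h0, h1, h2⟩ := h.exists_label_zero i hi
    obtain ⟨c, hc, hcd⟩ := NamedMap.exists_core_of_incident h.isPlanarMap.isMap hk m.label h0 h1
      hi.symm
    refine ⟨⟨c, hc⟩, (NamedMap.core.incident_iff hk).2 ?_, (NamedMap.core.incident_iff hk).2 ?_, ?_⟩
    · exact hcd ▸ h0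
    · exact hcd ▸ h1
    · exact (h.label_eq _ _ hcd).trans h2

/-- Every labeled map of the required type is reconstructed from a scheme, which may be replaced
with an isomorphic one. -/
theorem exists_isDecomp (h : m.IsLM) (hk : 2 ≤ k) : ∃ S : Scheme k, ∀ S' : Scheme k, S' ≈ S →
    ∃ (δ : SnakeData S') (ι : S'.D → (NamedMap.core h.isPlanarMap.isMap m.label).D),
      NamedMap.IsDecomp h.isPlanarMap.isMap m.label δ ι := by
  have hR := h.isReduced_core (by omega)
  obtain ⟨S, r, ι, hS⟩ := hR.exists_scheme hk
  refine ⟨S, ?_⟩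
  rintro S' ⟨f, hf, hn⟩
  obtain ⟨δ, hδ⟩ := (hS.comp hf hn).exists_isDecomp hR h.label_next h.label_adj
  exact ⟨δ, _, hδ⟩

end LabeledMap.IsLM

/-! ### The bijection -/

section Bijection

variable {k : ℕ}

theorem AdmissibleFamily.data_snake {S : Scheme k} (W : AdmissibleFamily S) : W.data.snake = W.1 :=
  Classical.choose_spec W.2

theorem AdmissibleFamily.data_injective {S : Scheme k} :
    Function.Injective (AdmissibleFamily.data (S := S)) := fun W W' h =>
  Subtype.ext (by rw [← W.data_snake, ← W'.data_snake, h])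

/-- The data chosen for a family of snakes are the only possible ones, by injectivity. -/
theorem AdmissibleFamily.exists_data_eq {S : Scheme k} (δ : SnakeData S) :
    ∃ W : AdmissibleFamily S, W.data = δ :=
  ⟨⟨δ.snake, δ, rfl⟩, SnakeData.snake_injective (AdmissibleFamily.data_snake ⟨δ.snake, δ, rfl⟩)⟩

/-- A reconstructed map is decomposed by any isomorphism to it. -/
theorem SnakeData.exists_iso_of_glue_iso {S S' : Scheme k} {δ : SnakeData S} {δ' : SnakeData S'}
    {x : δ.OrientedEdge} {x' : δ'.OrientedEdge} (hk : 2 ≤ k)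
    (h : LabeledMap.Iso (δ.glue x) (δ'.glue x')) : S ≈ S' := by
  obtain ⟨g, hg, hl, -⟩ := h
  have h1 : SnakeData.IsGlued δ δ'.glueMap δ'.label g := ⟨hg.rev, hg.next, hg.face, hl⟩
  obtain ⟨f, -, hf, hn⟩ := (h1.isDecomp δ'.glueMap_isMap (by omega)).exists_iso
    (δ'.isGlued_refl.isDecomp δ'.glueMap_isMap (by omega)) hk
  exact ⟨f, hf, hn⟩

theorem SnakeData.eq_of_glue_iso {S : Scheme k} {δ δ' : SnakeData S}
    {x : δ.OrientedEdge} {x' : δ'.OrientedEdge} (hk : 2 ≤ k)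
    (h : LabeledMap.Iso (δ.glue x) (δ'.glue x')) :
    (⟨δ, x⟩ : Σ δ : SnakeData S, δ.OrientedEdge) = ⟨δ', x'⟩ := by
  obtain ⟨g, hg, hl, hx⟩ := h
  have h1 : SnakeData.IsGlued δ δ'.glueMap δ'.label g := ⟨hg.rev, hg.next, hg.face, hl⟩
  have hd := h1.isDecomp δ'.glueMap_isMap (by omega)
  have hd' := δ'.isGlued_refl.isDecomp δ'.glueMap_isMap (by omega)
  obtain ⟨f, hf, hiso, -⟩ := hd.exists_iso hd' hk
  -- Rigidity enters here: both families are indexed by the same darts without any twist.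
  obtain rfl := S.isPlanarMap.eq_refl_of_isIso hk hiso
  have hι := funext hf
  obtain rfl : δ = δ' := hd.data_eq (hι ▸ hd') hk
  obtain ⟨e, -⟩ := S.isPlanarMap.face_surjective 0
  -- `g` fixes the first floor edge of `F_e`, so it is the identity and the roots agree.
  have hg' : g = Equiv.refl _ := NamedMap.IsIso.eq_of_apply_eq δ.glueMap_isMap hg (.refl _)
    (congrArg Subtype.val (hf e)).symm
  subst hg'
  exact congrArg _ hx

end Bijection

theorem mainTheorem10 (k : ℕ) (hk : 2 ≤ k) :
    -- every map automorphism of a scheme that preserves the named faces is the identity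
    (∀ (S : Scheme k) (f : S.D ≃ S.D),
      NamedMap.IsIso (m := S.toNamedMap) (m' := S.toNamedMap) f → f = Equiv.refl _) ∧
    -- the discrete snakes determine the labeling, the edge-lengths, the walks and the forests
    (∀ S : Scheme k, Function.Injective fun δ : SnakeData S => δ.snake) ∧
    -- the reconstruction always yields a labeled map of the required type
    (∀ (S : Scheme k) (δ : SnakeData S) (x : δ.OrientedEdge), (δ.glue x).IsLM) ∧
    -- the reconstruction is a bijection
    (∀ rep : SchemeClass k → Scheme k, (∀ s, Quotient.mk _ (rep s) = s) →
      Set.BijOn (reconstruct rep) Set.univ (LM k)) := by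
  refine ⟨fun S f hf => S.isPlanarMap.eq_refl_of_isIso hk hf, fun S => SnakeData.snake_injective,
    fun S δ x => δ.isLM_glue (by omega) x, fun rep hrep => ⟨?_, ?_, ?_⟩⟩
  · exact fun t _ => ⟨_, t.2.1.data.isLM_glue (by omega) t.2.2, rfl⟩
  · rintro ⟨s, W, x⟩ - ⟨s', W', x'⟩ - h
    have h1 : LabeledMap.Iso (W.data.glue x) (W'.data.glue x') := Quotient.exact h
    obtain rfl : s = s' := by
      rw [← hrep s, ← hrep s']
      exact Quotient.sound (SnakeData.exists_iso_of_glue_iso hk h1)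
    have h2 := SnakeData.eq_of_glue_iso hk h1
    rw [Sigma.mk.injEq] at h2
    obtain rfl := AdmissibleFamily.data_injective h2.1
    obtain rfl := eq_of_heq h2.2
    rfl
  · rintro _ ⟨m, hm, rfl⟩
    obtain ⟨S, hS⟩ := hm.exists_isDecomp hk
    -- The decomposition is transported from `S` to the fixed representative of its class.
    obtain ⟨δ, ι, h⟩ := hS (rep (Quotient.mk _ S)) (Quotient.exact (hrep _))
    obtain ⟨W, rfl⟩ := AdmissibleFamily.exists_data_eq δ
    obtain ⟨φ, hφ⟩ := h.exists_isGlued hm.label_next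
    refine ⟨⟨_, W, φ.symm m.root⟩, Set.mem_univ _, Quotient.sound ?_⟩
    exact ⟨φ, ⟨hφ.rev, hφ.next, hφ.face⟩, hφ.label, φ.apply_symm_apply _⟩
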